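/- **Setting.** Let $q\in C^2(0,2\pi)\cap L^2(0,2\pi)$ be real-valued, and denote by $q$ also its $2\pi$-periodic continuation to $\mathbb R$. For $f_1,f_2\in C_0^\infty(\mathbb R_+)$ (smooth, compact support in $(0,\infty)$, extended by $0$) and $F=(f_1,f_2)$ let $u^F$ be the solution of $$u_{tt}-u_{xx}+q(x)u=0\quad(0<x<2\pi,\ t>0),\qquad u(0,t)-u(2\pi,t)=f_1(t),\quad u_x(0,t)-u_x(2\pi,t)=f_2'(t),\qquad u(\cdot,0)=u_t(\cdot,0)=0 .$$ A solution on a time interval $(0,T)$ is a function of class $C^2((0,2\pi)\times(0,T))\cap C^1([0,2\pi]\times[0,T))$ satisfying these relations for $0<t<T$, the boundary values being one-sided limits. Put $c_1=-\frac14$, $c_2=\frac14$. **Theorem 1.** For every $T>0$ and all such $F$ a solution on $(0,T)$ exists. Every solution $u^F$ on $(0,T)$ has, for $0<x<2\pi$ and $0<t<T$, the following representations, with kernels independent of $F$ and $T$. 1) There are kernels $w_i^0,w_i^{2\pi}$ ($i=1,2$) such that for $0<t<2\pi$ $$u^F(x,t)=\tfrac12f_1(t-x)-\tfrac12f_2(t-x)+\int_x^t\big(w_1^0(x,s)f_1(t-s)+w_2^0(x,s)f_2(t-s)\big)ds$$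 $$\qquad-\tfrac12f_1(t+x-2\pi)-\tfrac12f_2(t+x-2\pi)+\int_{2\pi-x}^t\big(w_1^{2\pi}(x,s)f_1(t-s)+w_2^{2\pi}(x,s)f_2(t-s)\big)ds .$$ The kernel $w_i^0$ satisfies $w_{tt}-w_{xx}+qw=0$ for $0<x<t<2\pi$ and $\frac{d}{dx}w_i^0(x,x)=c_iq(x)$ for $0<x<2\pi$; the kernel $w_i^{2\pi}$ satisfies the same equation for $0<2\pi-x<t<2\pi$ and $\frac{d}{dx}w_i^{2\pi}(x,2\pi-x)=-\frac{q(x)}4$ for $0<x<2\pi$. Both are $C^2$ in these open domains, continuous up to the characteristic, and $C^1$ up to the edges $x=0$, respectively $x=2\pi$. Moreover $w_i^0(0,0)=w_i^{2\pi}(2\pi,0)=0$ and $w_i^0(0,s)=w_i^{2\pi}(2\pi,s)$, $\partial_xw_i^0(0,s)=\partial_xw_i^{2\pi}(2\pi,s)$ for $0<s<2\pi$. 2) There are kernels $w_i^0,w_i^{2\pi},\widetilde w_i^0,\widetilde w_i^{2\pi}$ ($i=1,2$) such that for $0<t<4\pi$ the function $u^F(x,t)$ is the sum of the right-hand side of 1)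 and of $$\tfrac12f_1(t-2\pi-x)-\tfrac12f_2(t-2\pi-x)+\int_x^{t-2\pi}\big(\widetilde w_1^0(x,s)f_1(t-2\pi-s)+\widetilde w_2^0(x,s)f_2(t-2\pi-s)\big)ds$$ $$-\tfrac12f_1(t+x-4\pi)-\tfrac12f_2(t+x-4\pi)+\int_{2\pi-x}^{t-2\pi}\big(\widetilde w_1^{2\pi}(x,s)f_1(t-2\pi-s)+\widetilde w_2^{2\pi}(x,s)f_2(t-2\pi-s)\big)ds .$$ For $0<x<2\pi$ the kernels $w_i^0$ (in $x<t<4\pi$) and $\widetilde w_i^0$ (in $x<t<2\pi$) solve the wave equation with $\frac d{dx}w(x,x)=c_iq(x)$, and $w_i^{2\pi}$ (in $2\pi-x<t<4\pi$) and $\widetilde w_i^{2\pi}$ (in $2\pi-x<t<2\pi$) solve it with $\frac d{dx}w(x,2\pi-x)=-\frac{q(x)}4$; they are continuous up to the characteristic and $C^1$ up to the edges $x=0$ and $x=2\pi$. Moreover $w_i^0(0,0)=w_i^{2\pi}(2\pi,0)=0$, $\widetilde w_i^0(0,0)=w_i^0(2\pi,2\pi)$, $\widetilde w_i^{2\pi}(2\pi,0)=w_i^{2\pi}(0,2\pi)$,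 and the following equalities hold together with the same equalities for the $x$-derivatives: $w_i^0(0,s)=w_i^{2\pi}(2\pi,s)$ for $0<s<4\pi$; $w_i^0(2\pi,s)=\widetilde w_i^0(0,s-2\pi)$ and $w_i^{2\pi}(0,s)=\widetilde w_i^{2\pi}(2\pi,s-2\pi)$ for $2\pi<s<4\pi$. If the periodic function $q$ is $C^1$ on $\mathbb R$, all of this holds classically (with $C^2$ kernels in the open domains); otherwise the equations for $w_i^0$, $w_i^{2\pi}$ hold in the sense of distributions, and the smoothness and the classical equation hold outside the line $t+x=4\pi$ for $w_i^0$ and outside $t-x=2\pi$ for $w_i^{2\pi}$. 3) For every $n>1$ there are kernels $w_1,w_2$ such that for $0<t<2n\pi$ one has $u^F=\sum_{k=1}^n(u_k^{F_+}+u_k^{F_-})$, where $$u_k^{F_+}(x,t)=\tfrac12f_1(t-x-2(k-1)\pi)-\tfrac12f_2(t-x-2(k-1)\pi)+\int_{x+2(k-1)\pi}^t\big(w_1(x+2(k-1)\pi,s)f_1(t-s)+w_2(x+2(k-1)\pi,s)f_2(t-s)\big)ds,$$ $$u_k^{F_-}(x,t)=-\tfrac12f_1(t+x-2k\pi)-\tfrac12f_2(t+x-2k\pi)+\int_{2k\pi-x}^t\big(w_1(x-2k\pi,s)f_1(t-s)+w_2(x-2k\pi,s)f_2(t-s)\big)ds$$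 are the $k$-th clockwise and counterclockwise waves. Here $w_i$ is continuous in $|x|\le t<2n\pi$, $w_i(0,0)=0$, $w_{tt}-w_{xx}+q(x)w=0$ in $|x|<t<2n\pi$, $\frac d{dx}w_i(x,x)=c_iq(x)$ for $0<x<2n\pi$, and $\frac d{dx}w_i(x,-x)=-\frac{q(x)}4$ for $-2n\pi<x<0$. If the periodic function $q$ is $C^1$ on $\mathbb R$, then $w_i\in C^2$ in $|x|<t<2n\pi$ and these relations are classical. Otherwise the equation holds in the sense of distributions in $|x|<t<2n\pi$; it holds classically, with $w_i$ of class $C^2$, outside the lines $x\in2\pi\mathbb Z$, $t\pm x\in4\pi\mathbb Z$; and the characteristic conditions hold for $x\notin2\pi\mathbb Z$. -/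

import Mathlib

open Set Filter Topology MeasureTheory
open scoped Real ContDiff

namespace PeriodicWave

noncomputable section

/-- The wave operator `w_tt - w_xx + q w` evaluated at `(x, t)`, for a function `w x t`. -/
def waveOp (q : ℝ → ℝ) (w : ℝ → ℝ → ℝ) (x t : ℝ) : ℝ :=
  iteratedDeriv 2 (fun s => w x s) t - iteratedDeriv 2 (fun y => w y t) x + q x * w x t

/-- Scalar controls of class `C₀^∞(ℝ₊)` (compact support in the open half-line), extended by zero
to the whole line. -/
structure IsSmoothControl (f : ℝ → ℝ) : Prop where
  smooth : ContDiff ℝ ∞ f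
  compact : HasCompactSupport f
  supp : tsupport f ⊆ Ioi 0

/-- `Γ₀ w = (a, b)`: the one-sided limits of `w` and `w'` at the ends of `(0, 2π)` exist, and
`w(0+) - w(2π-) = a`, `w'(0+) - w'(2π-) = b`. -/
def HasGamma0 (w : ℝ → ℝ) (a b : ℝ) : Prop :=
  ∃ w0 w2 d0 d2 : ℝ,
    Tendsto w (𝓝[>] 0) (𝓝 w0) ∧ Tendsto w (𝓝[<] (2 * π)) (𝓝 w2) ∧
    Tendsto (deriv w) (𝓝[>] 0) (𝓝 d0) ∧ Tendsto (deriv w) (𝓝[<] (2 * π)) (𝓝 d2) ∧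
    w0 - w2 = a ∧ d0 - d2 = b

/-- `u` is a classical solution, on the time interval `(0, T)`, of
`u_tt - u_xx + q u = 0`, `Γ₀ u = (f₁, f₂')`, `u(·,0) = u_t(·,0) = 0`:
it is `C²` in `(0,2π) × (0,T)` and `C¹` on `[0,2π] × [0,T)`. -/
structure IsSolution (q f₁ f₂ : ℝ → ℝ) (T : ℝ) (u : ℝ → ℝ → ℝ) : Prop where
  c2 : ContDiffOn ℝ 2 (fun p : ℝ × ℝ => u p.1 p.2) (Ioo 0 (2 * π) ×ˢ Ioo 0 T)
  c1 : ContDiffOn ℝ 1 (fun p : ℝ × ℝ => u p.1 p.2) (Icc 0 (2 * π) ×ˢ Ico 0 T)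
  pde : ∀ x ∈ Ioo 0 (2 * π), ∀ t ∈ Ioo 0 T, waveOp q u x t = 0
  boundary : ∀ t ∈ Ioo 0 T, HasGamma0 (fun x => u x t) (f₁ t) (deriv f₂ t)
  initial : ∀ x ∈ Ioo 0 (2 * π), u x 0 = 0 ∧ HasDerivWithinAt (fun t => u x t) 0 (Ici 0) 0

/-- `w_tt - w_xx + q w = 0` in the open set `U`: in the sense of distributions in all of `U`, and
classically (with `w` of class `C²`) in `U` outside the exceptional set `N`. -/
structure SolvesWaveEq (q : ℝ → ℝ) (U N : Set (ℝ × ℝ)) (w : ℝ → ℝ → ℝ) : Prop where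
  weak : ∀ φ : ℝ → ℝ → ℝ,
    ContDiff ℝ ∞ (fun p : ℝ × ℝ => φ p.1 p.2) →
    HasCompactSupport (fun p : ℝ × ℝ => φ p.1 p.2) →
    tsupport (fun p : ℝ × ℝ => φ p.1 p.2) ⊆ U →
    ∫ p : ℝ × ℝ, w p.1 p.2 * waveOp q φ p.1 p.2 = 0
  c2 : ContDiffOn ℝ 2 (fun p : ℝ × ℝ => w p.1 p.2) (U \ N)
  classical : ∀ p ∈ U \ N, waveOp q w p.1 p.2 = 0

/-- A kernel `w(x, t)`, `0 < x < 2π`, `front x < t < τ`, of a Goursat problem: continuous up to the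
characteristic `t = front x`, `C¹` up to the edges `x = 0`, `x = 2π` (outside `N`), solving the
wave equation, and with `(d/dx) w(x, front x) = c q(x)`. -/
structure IsGoursatKernel (q front : ℝ → ℝ) (c τ : ℝ) (N : Set (ℝ × ℝ)) (w : ℝ → ℝ → ℝ) :
    Prop where
  cont : ContinuousOn (fun p : ℝ × ℝ => w p.1 p.2)
    {p | p.1 ∈ Icc 0 (2 * π) ∧ front p.1 ≤ p.2 ∧ p.2 < τ}
  c1 : ContDiffOn ℝ 1 (fun p : ℝ × ℝ => w p.1 p.2)
    ({p | p.1 ∈ Icc 0 (2 * π) ∧ front p.1 < p.2 ∧ p.2 < τ} \ N)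
  eqn : SolvesWaveEq q {p | p.1 ∈ Ioo 0 (2 * π) ∧ front p.1 < p.2 ∧ p.2 < τ} N w
  char : ∀ x ∈ Ioo 0 (2 * π), HasDerivAt (fun y => w y (front y)) (c * q x) x

/-- The value and the right derivative of `a` at `0` coincide with the value and the left derivative
of `b` at `2π`. -/
def Glue (a b : ℝ → ℝ) : Prop :=
  a 0 = b (2 * π) ∧
    ∃ d : ℝ, HasDerivWithinAt a d (Ici 0) 0 ∧ HasDerivWithinAt b d (Iic (2 * π)) (2 * π)

/-- The coupled Goursat problems for a pair `w⁰, w^{2π}` on `0 < t < 2π`; the characteristic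
condition for `w⁰` is `(d/dx) w⁰(x,x) = c q(x)`. -/
structure GoursatPair (q : ℝ → ℝ) (c : ℝ) (w0 w2 : ℝ → ℝ → ℝ) : Prop where
  kernel0 : IsGoursatKernel q (fun x => x) c (2 * π) ∅ w0
  kernel2 : IsGoursatKernel q (fun x => 2 * π - x) (-1 / 4) (2 * π) ∅ w2
  corner : w0 0 0 = 0 ∧ w2 (2 * π) 0 = 0
  glue : ∀ s ∈ Ioo 0 (2 * π), Glue (fun x => w0 x s) (fun x => w2 x s)

/-- The coupled Goursat problems for `w⁰, w^{2π}` (on `0 < t < 4π`) and `w̃⁰, w̃^{2π}`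
(on `0 < t < 2π`). If the periodic function `q` is not `C¹` on `ℝ`, its jumps at `2π ℤ` break the
smoothness of `w⁰` on the line `t + x = 4π` and that of `w^{2π}` on `t - x = 2π`. -/
structure GoursatQuadruple (q : ℝ → ℝ) (c : ℝ) (w0 w2 v0 v2 : ℝ → ℝ → ℝ) : Prop where
  kernel0 : IsGoursatKernel q (fun x => x) c (4 * π)
    {p | ¬ ContDiff ℝ 1 q ∧ p.2 + p.1 = 4 * π} w0
  kernel2 : IsGoursatKernel q (fun x => 2 * π - x) (-1 / 4) (4 * π)
    {p | ¬ ContDiff ℝ 1 q ∧ p.2 - p.1 = 2 * π} w2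
  kernel0' : IsGoursatKernel q (fun x => x) c (2 * π) ∅ v0
  kernel2' : IsGoursatKernel q (fun x => 2 * π - x) (-1 / 4) (2 * π) ∅ v2
  corner : w0 0 0 = 0 ∧ w2 (2 * π) 0 = 0 ∧ v0 0 0 = w0 (2 * π) (2 * π) ∧
    v2 (2 * π) 0 = w2 0 (2 * π)
  glue : ∀ s ∈ Ioo 0 (4 * π), Glue (fun x => w0 x s) (fun x => w2 x s)
  glue0 : ∀ s ∈ Ioo (2 * π) (4 * π), Glue (fun x => v0 x (s - 2 * π)) (fun x => w0 x s)
  glue2 : ∀ s ∈ Ioo (2 * π) (4 * π), Glue (fun x => w2 x s) (fun x => v2 x (s - 2 * π))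

/-- The Goursat problem on the whole line, in the cone `|x| < t < τ`, for the periodic potential `q`:
`w(0,0) = 0`, `(d/dx) w(x,x) = c q(x)` for `x > 0`, `(d/dx) w(x,-x) = -q(x)/4` for `x < 0`.
If `q` is `C¹` on `ℝ`, everything is classical. Otherwise, because of the jumps of `q` at `2π ℤ`, the
classical equation is required outside the lines `x ∈ 2π ℤ`, `t ± x ∈ 4π ℤ`, the equation in the
sense of distributions everywhere in the cone, and the characteristic conditions for
`x ∉ 2π ℤ`. -/
structure GoursatLine (q : ℝ → ℝ) (c τ : ℝ) (w : ℝ → ℝ → ℝ) : Prop where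
  cont : ContinuousOn (fun p : ℝ × ℝ => w p.1 p.2) {p | |p.1| ≤ p.2 ∧ p.2 < τ}
  eqn : SolvesWaveEq q {p | |p.1| < p.2 ∧ p.2 < τ}
    {p | ¬ ContDiff ℝ 1 q ∧ ∃ k : ℤ,
      p.1 = 2 * π * k ∨ p.2 - p.1 = 4 * π * k ∨ p.2 + p.1 = 4 * π * k} w
  char_right : ∀ x ∈ Ioo 0 τ, (ContDiff ℝ 1 q ∨ ∀ k : ℤ, x ≠ 2 * π * k) →
    HasDerivAt (fun y => w y y) (c * q x) x
  char_left : ∀ x ∈ Ioo (-τ) 0, (ContDiff ℝ 1 q ∨ ∀ k : ℤ, x ≠ 2 * π * k) →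
    HasDerivAt (fun y => w y (-y)) (-1 / 4 * q x) x
  corner : w 0 0 = 0

/-- The clockwise wave on the interval. -/
def waveCW (w₁ w₂ : ℝ → ℝ → ℝ) (f₁ f₂ : ℝ → ℝ) (x t : ℝ) : ℝ :=
  1 / 2 * f₁ (t - x) - 1 / 2 * f₂ (t - x)
    + ∫ s in x..t, (w₁ x s * f₁ (t - s) + w₂ x s * f₂ (t - s))

/-- The counterclockwise wave on the interval. -/
def waveCCW (w₁ w₂ : ℝ → ℝ → ℝ) (f₁ f₂ : ℝ → ℝ) (x t : ℝ) : ℝ :=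
  -(1 / 2) * f₁ (t + x - 2 * π) - 1 / 2 * f₂ (t + x - 2 * π)
    + ∫ s in (2 * π - x)..t, (w₁ x s * f₁ (t - s) + w₂ x s * f₂ (t - s))

/-- The `k`-th clockwise wave, `k = 1, 2, …`, in terms of kernels on the whole line. -/
def lineWaveCW (w₁ w₂ : ℝ → ℝ → ℝ) (f₁ f₂ : ℝ → ℝ) (k : ℕ) (x t : ℝ) : ℝ :=
  1 / 2 * f₁ (t - x - 2 * ((k : ℝ) - 1) * π) - 1 / 2 * f₂ (t - x - 2 * ((k : ℝ) - 1) * π)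
    + ∫ s in (x + 2 * ((k : ℝ) - 1) * π)..t,
        (w₁ (x + 2 * ((k : ℝ) - 1) * π) s * f₁ (t - s)
          + w₂ (x + 2 * ((k : ℝ) - 1) * π) s * f₂ (t - s))

/-- The `k`-th counterclockwise wave, `k = 1, 2, …`, in terms of kernels on the whole line. -/
def lineWaveCCW (w₁ w₂ : ℝ → ℝ → ℝ) (f₁ f₂ : ℝ → ℝ) (k : ℕ) (x t : ℝ) : ℝ :=
  -(1 / 2) * f₁ (t + x - 2 * (k : ℝ) * π) - 1 / 2 * f₂ (t + x - 2 * (k : ℝ) * π)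
    + ∫ s in (2 * (k : ℝ) * π - x)..t,
        (w₁ (x - 2 * (k : ℝ) * π) s * f₁ (t - s) + w₂ (x - 2 * (k : ℝ) * π) s * f₂ (t - s))

/-- Every solution with smooth controls, on whatever time interval `(0, T)` it is given, equals
`rep f₁ f₂ x t` for `0 < x < 2π` and `0 < t < τ` (as long as `t < T`). -/
def Represents (q : ℝ → ℝ) (τ : ℝ) (rep : (ℝ → ℝ) → (ℝ → ℝ) → ℝ → ℝ → ℝ) : Prop :=
  ∀ f₁ f₂ : ℝ → ℝ, IsSmoothControl f₁ → IsSmoothControl f₂ →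
    ∀ (T : ℝ) (u : ℝ → ℝ → ℝ), 0 < T → IsSolution q f₁ f₂ T u →
      ∀ x ∈ Ioo 0 (2 * π), ∀ t ∈ Ioo 0 T, t < τ → u x t = rep f₁ f₂ x t

end

end PeriodicWave

/-!
# Waves on a ring with a periodic potential

The interval with the coupled boundary conditions is a ring with one vertex, and the control at
the vertex sends a wave in each direction. Unrolling the ring gives one problem on the line: on
`|x| < 2nπ`, where the waves of the first `n` windings live, replace the periodic potential `q` by
its truncation `p`, which is integrable and square integrable, but may be singular at the points
of `2π ℤ`.

**The kernel.** With `P` the primitive of `p`, the Goursat problem for the kernel `W` is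
equivalent to the integral equation
`W(x,t) = a P((t+x)/2) + b P((x-t)/2) - ½ ∫ p(y) K(y, t - |x-y|) dy`, in which `K(y, τ)` is the integral of `W(y, ·)` from `|y|` to `τ` (`IsKernel`). It is
a contraction in a weighted sup norm, and needs no more than `p ∈ L¹` (`exists_isKernel`).
Splitting the integral at `y = x` gives one function of `t + x` and one of `t - x`, each
differentiable in that variable wherever the data are (`hasFDerivAt_waveInt`); hence `W` is `C¹`
off the characteristics through the singularities of `p(±·/2)`. A further derivative falls on an integral
with the factor `p(y) P(y - z)`, and produces the correlation `∫ p(y) p(y - z) dy`, which is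
continuous because `p ∈ L²` (`continuous_corr`). So `W` is `C²` and solves the equation
classically off the exceptional lines (`IsKernel.contDiffOn_two`, `IsKernel.waveOp_eq_zero`). In
the sense of distributions it solves the equation throughout the cone, by integrating by parts
along the two families of characteristics (`IsKernel.weak`).

**The waves.** Superposing the integral equation in time turns it into an equation for
`v = -2κ f(t-|x|) + ∫ W(x,s) f(t-s) ds`, where `κ = a` for `x > 0` and `κ = -b` for `x < 0`: the integral
term is the retarded potential of `p` times the same expression for the primitive of `f`
(`IsKernel.conv_eq_waveInt`). Therefore the integral term is `C¹` on the whole plane, so that all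
of the jump of `v` at `x = 0` comes from the free part, and `v` solves the wave equation on both
sides. With `b = -1/4`, the choice `a = -1/4` gives a jump `f` of the value alone, and `a = 1/4` a
jump `f'` of the derivative alone. Folding the waves back to `[0, 2π]`, the boundary values of
successive windings telescope, and the sum of the first `n` windings solves the problem up to the
time `2nπ` (`WavePair.isSolution_waveSum`).

**Uniqueness.** For the difference `d` of two solutions, `d_t ± d_x` has the derivative `q d`
along the characteristics. Following these around the ring bounds `d_t` by a constant times the
supremum of `|d|` at earlier times; only the `L¹` norm of `q` enters. Iterating in time gives
`d = 0` (`IsSolution.unique`). Thus every solution is the one constructed, and the representations are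
three ways of writing the same sum; the kernels on the interval are translates of the kernel on
the line.
-/

namespace PeriodicWave

/-! ### Functions of two real variables with given partial derivatives -/

/-- The linear form `(x, t) ↦ a x + b t`. -/
noncomputable def linForm (a b : ℝ) : ℝ × ℝ →L[ℝ] ℝ :=
  (ContinuousLinearMap.toSpanSingleton ℝ a).coprod (ContinuousLinearMap.toSpanSingleton ℝ b)

@[simp] lemma linForm_apply (a b : ℝ) (z : ℝ × ℝ) : linForm a b z = z.1 * a + z.2 * b := by
  simp [linForm]

lemma continuous_linForm : Continuous (fun z : ℝ × ℝ => linForm z.1 z.2) := by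
  have : (fun z : ℝ × ℝ => linForm z.1 z.2) = fun z =>
      z.1 • ContinuousLinearMap.fst ℝ ℝ ℝ + z.2 • ContinuousLinearMap.snd ℝ ℝ ℝ := by
    ext z <;> simp
  rw [this]
  fun_prop

lemma contDiff_linForm {n : WithTop ℕ∞} : ContDiff ℝ n (fun z : ℝ × ℝ => linForm z.1 z.2) := by
  have : (fun z : ℝ × ℝ => linForm z.1 z.2) = fun z =>
      z.1 • ContinuousLinearMap.fst ℝ ℝ ℝ + z.2 • ContinuousLinearMap.snd ℝ ℝ ℝ := by
    ext z <;> simp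
  rw [this]
  fun_prop

/-- Partial derivatives that exist near a point and are continuous there make up the derivative. -/
lemma hasFDerivAt_of_partials {f a b : ℝ → ℝ → ℝ} {z : ℝ × ℝ}
    (h1 : ∀ᶠ w in 𝓝 z, HasDerivAt (fun x => f x w.2) (a w.1 w.2) w.1)
    (h2 : ∀ᶠ w in 𝓝 z, HasDerivAt (fun t => f w.1 t) (b w.1 w.2) w.2)
    (ca : ContinuousAt (fun w : ℝ × ℝ => a w.1 w.2) z)
    (cb : ContinuousAt (fun w : ℝ × ℝ => b w.1 w.2) z) :
    HasFDerivAt (fun w : ℝ × ℝ => f w.1 w.2) (linForm (a z.1 z.2) (b z.1 z.2)) z := by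
  have hspan : Continuous (fun r : ℝ => ContinuousLinearMap.toSpanSingleton ℝ r) :=
    (ContinuousLinearMap.toSpanSingletonCLE (𝕜 := ℝ) (E := ℝ)).continuous
  exact (hasStrictFDerivAt_uncurry_coprod (f := f)
    (f₁ := fun x t => ContinuousLinearMap.toSpanSingleton ℝ (a x t))
    (f₂ := fun x t => ContinuousLinearMap.toSpanSingleton ℝ (b x t))
    (h1.mono fun w hw => hw.hasFDerivAt) (h2.mono fun w hw => hw.hasFDerivAt)
    (hspan.continuousAt.comp ca) (hspan.continuousAt.comp cb)).hasFDerivAt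

lemma HasFDerivAt.partial_fst {f : ℝ → ℝ → ℝ} {a b x t : ℝ}
    (h : HasFDerivAt (fun w : ℝ × ℝ => f w.1 w.2) (linForm a b) (x, t)) :
    HasDerivAt (fun y => f y t) a x := by
  have := h.comp_hasDerivAt (f := fun y : ℝ => (y, t)) x
    ((hasDerivAt_id x).prodMk (hasDerivAt_const x t))
  simpa [Function.comp_def] using this

lemma HasFDerivAt.partial_snd {f : ℝ → ℝ → ℝ} {a b x t : ℝ}
    (h : HasFDerivAt (fun w : ℝ × ℝ => f w.1 w.2) (linForm a b) (x, t)) :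
    HasDerivAt (fun s => f x s) b t := by
  have := h.comp_hasDerivAt (f := fun s : ℝ => (x, s)) t
    ((hasDerivAt_const t x).prodMk (hasDerivAt_id t))
  simpa [Function.comp_def] using this

lemma contDiffOn_succ_of_hasFDerivAt {f a b : ℝ × ℝ → ℝ} {U : Set (ℝ × ℝ)} (hU : IsOpen U) {n : ℕ}
    (h : ∀ z ∈ U, HasFDerivAt f (linForm (a z) (b z)) z)
    (ca : ContDiffOn ℝ n a U) (cb : ContDiffOn ℝ n b U) : ContDiffOn ℝ (n + 1) f U := by
  rw [contDiffOn_succ_iff_fderiv_of_isOpen hU]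
  refine ⟨fun z hz => (h z hz).differentiableAt.differentiableWithinAt, by simp, ?_⟩
  refine (contDiff_linForm.comp_contDiffOn (ca.prodMk cb)).congr fun z hz => ?_
  exact (h z hz).fderiv

lemma contDiffOn_one_of_hasFDerivAt {f a b : ℝ × ℝ → ℝ} {U : Set (ℝ × ℝ)} (hU : IsOpen U)
    (h : ∀ z ∈ U, HasFDerivAt f (linForm (a z) (b z)) z)
    (ca : ContinuousOn a U) (cb : ContinuousOn b U) : ContDiffOn ℝ 1 f U := by
  have := contDiffOn_succ_of_hasFDerivAt (n := 0) hU h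
    (by simpa using ca) (by simpa using cb)
  simpa [Function.comp_def] using this

lemma contDiffOn_two_of_hasFDerivAt {f a b : ℝ × ℝ → ℝ} {U : Set (ℝ × ℝ)} (hU : IsOpen U)
    (h : ∀ z ∈ U, HasFDerivAt f (linForm (a z) (b z)) z)
    (ca : ContDiffOn ℝ 1 a U) (cb : ContDiffOn ℝ 1 b U) : ContDiffOn ℝ 2 f U := by
  have := contDiffOn_succ_of_hasFDerivAt (n := 1) hU h
    (by exact_mod_cast ca) (by exact_mod_cast cb)
  exact_mod_cast this

lemma contDiffOn_one_of_partials {f a b : ℝ → ℝ → ℝ} {U : Set (ℝ × ℝ)} (hU : IsOpen U)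
    (h1 : ∀ w ∈ U, HasDerivAt (fun x => f x w.2) (a w.1 w.2) w.1)
    (h2 : ∀ w ∈ U, HasDerivAt (fun t => f w.1 t) (b w.1 w.2) w.2)
    (ca : ContinuousOn (fun w : ℝ × ℝ => a w.1 w.2) U)
    (cb : ContinuousOn (fun w : ℝ × ℝ => b w.1 w.2) U) :
    ContDiffOn ℝ 1 (fun w : ℝ × ℝ => f w.1 w.2) U := by
  refine contDiffOn_one_of_hasFDerivAt hU (fun z hz => ?_) ca cb
  exact hasFDerivAt_of_partials (Filter.mem_of_superset (hU.mem_nhds hz) h1)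
    (Filter.mem_of_superset (hU.mem_nhds hz) h2) (ca.continuousAt (hU.mem_nhds hz))
    (cb.continuousAt (hU.mem_nhds hz))

lemma iteratedDeriv_two_eq {g g' : ℝ → ℝ} {g'' x : ℝ} (h : ∀ᶠ y in 𝓝 x, HasDerivAt g (g' y) y)
    (h' : HasDerivAt g' g'' x) : iteratedDeriv 2 g x = g'' := by
  rw [iteratedDeriv_succ, iteratedDeriv_one]
  exact (Filter.EventuallyEq.deriv_eq (h.mono fun y hy => hy.deriv)).trans h'.deriv

/-- The wave operator in terms of given first and second partial derivatives. -/
lemma waveOp_eq {q : ℝ → ℝ} {w a b : ℝ → ℝ → ℝ} {x t wxx wtt : ℝ}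
    (h : ∀ᶠ z in 𝓝 (x, t), HasFDerivAt (fun z : ℝ × ℝ => w z.1 z.2)
      (linForm (a z.1 z.2) (b z.1 z.2)) z)
    (ha : HasDerivAt (fun y => a y t) wxx x) (hb : HasDerivAt (fun s => b x s) wtt t) :
    waveOp q w x t = wtt - wxx + q x * w x t := by
  have e1 : Tendsto (fun y : ℝ => (y, t)) (𝓝 x) (𝓝 (x, t)) :=
    (Continuous.prodMk_left t).tendsto x
  have e2 : Tendsto (fun s : ℝ => (x, s)) (𝓝 t) (𝓝 (x, t)) :=
    (Continuous.prodMk_right x).tendsto t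
  rw [waveOp, iteratedDeriv_two_eq ((e1.eventually h).mono fun y hy => HasFDerivAt.partial_fst hy) ha,
    iteratedDeriv_two_eq ((e2.eventually h).mono fun y hy => HasFDerivAt.partial_snd hy) hb]

/-! ### Integration of `p H` along characteristics -/

/-- The integral of `p H` over the part `y > x` of the characteristic line `y + s = ξ`. -/
noncomputable def rightInt (p : ℝ → ℝ) (H : ℝ → ℝ → ℝ) (x ξ : ℝ) : ℝ :=
  ∫ y in Ioi x, p y * H y (ξ - y)

/-- The integral of `p H` over the part `y ≤ x` of the characteristic line `s - y = η`. -/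
noncomputable def leftInt (p : ℝ → ℝ) (H : ℝ → ℝ → ℝ) (x η : ℝ) : ℝ :=
  ∫ y in Iic x, p y * H y (η + y)

/-- The integral of `p H` over both characteristics issuing backwards from `(x, t)`. With `H` the
time primitive of `h` vanishing for small times, half of it is the d'Alembert integral of `p h` over
the backward light cone of `(x, t)`. -/
noncomputable def waveInt (p : ℝ → ℝ) (H : ℝ → ℝ → ℝ) (x t : ℝ) : ℝ :=
  ∫ y, p y * H y (t - |x - y|)

/-- `H` is measurable, and bounded on every half-plane `τ ≤ T`. -/
structure BddBelowTime (H : ℝ → ℝ → ℝ) : Prop where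
  meas : Measurable (fun z : ℝ × ℝ => H z.1 z.2)
  bdd : ∀ T : ℝ, ∃ C : ℝ, 0 ≤ C ∧ ∀ y τ, τ ≤ T → |H y τ| ≤ C

/-- `H` is moreover Lipschitz in time on every half-plane `τ ≤ T`. -/
structure LipBelowTime (H : ℝ → ℝ → ℝ) : Prop extends BddBelowTime H where
  lip : ∀ T : ℝ, ∃ C : ℝ, 0 ≤ C ∧ ∀ y τ τ', τ ≤ T → τ' ≤ T → |H y τ - H y τ'| ≤ C * |τ - τ'|

lemma BddBelowTime.reflect {H : ℝ → ℝ → ℝ} (h : BddBelowTime H) :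
    BddBelowTime (fun y => H (-y)) :=
  ⟨h.meas.comp (measurable_fst.neg.prodMk measurable_snd), fun T =>
    (h.bdd T).imp fun _ hC => ⟨hC.1, fun y => hC.2 (-y)⟩⟩

lemma LipBelowTime.reflect {H : ℝ → ℝ → ℝ} (h : LipBelowTime H) :
    LipBelowTime (fun y => H (-y)) :=
  ⟨h.toBddBelowTime.reflect, fun T => (h.lip T).imp fun _ hC => ⟨hC.1, fun y => hC.2 (-y)⟩⟩

/-- A function with a time derivative that is bounded on half-planes is Lipschitz in time there. -/
lemma LipBelowTime.of_hasDerivAt {H h : ℝ → ℝ → ℝ} (hH : BddBelowTime H) (hh : BddBelowTime h)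
    (hd : ∀ y τ, HasDerivAt (H y) (h y τ) τ) : LipBelowTime H := by
  refine ⟨hH, fun T => ?_⟩
  obtain ⟨C, hC0, hC⟩ := hh.bdd T
  refine ⟨C, hC0, fun y τ τ' hτ hτ' => ?_⟩
  exact (convex_Iic T).norm_image_sub_le_of_norm_hasDerivWithin_le
    (fun s _ => (hd y s).hasDerivWithinAt) (fun s hs => hC y s hs) hτ' hτ

/-- The reflection `x ↦ -x` exchanges the two families of characteristics. -/
lemma leftInt_eq_rightInt (p : ℝ → ℝ) (H : ℝ → ℝ → ℝ) (x η : ℝ) :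
    leftInt p H x η = rightInt (fun y => p (-y)) (fun y => H (-y)) (-x) η := by
  have := integral_comp_neg_Ioi (-x) (fun y => p y * H y (η + y))
  simp only [neg_neg] at this
  rw [leftInt, rightInt, ← this]
  simp [sub_eq_add_neg]

lemma aestronglyMeasurable_mul_comp {p : ℝ → ℝ} (hp : Integrable p) {H : ℝ → ℝ → ℝ}
    (hH : Measurable (fun z : ℝ × ℝ => H z.1 z.2)) {τ : ℝ → ℝ} (hτ : Measurable τ) :
    AEStronglyMeasurable (fun y => p y * H y (τ y)) :=
  hp.aestronglyMeasurable.mul (hH.comp (measurable_id.prodMk hτ)).aestronglyMeasurable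

lemma integrableOn_mul_comp {p : ℝ → ℝ} (hp : Integrable p) {H : ℝ → ℝ → ℝ}
    (hH : BddBelowTime H) {τ : ℝ → ℝ} (hτ : Measurable τ) {S : Set ℝ} (hS : MeasurableSet S)
    {T : ℝ} (hT : ∀ y ∈ S, τ y ≤ T) : IntegrableOn (fun y => p y * H y (τ y)) S := by
  obtain ⟨C, -, hC⟩ := hH.bdd T
  refine Integrable.mono' (g := fun y => |p y| * C) (hp.abs.mul_const C).integrableOn
    (aestronglyMeasurable_mul_comp hp hH.meas hτ).restrict ?_
  refine (ae_restrict_iff' hS).2 (ae_of_all _ fun y hy => ?_)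
  rw [Real.norm_eq_abs, abs_mul]
  exact mul_le_mul_of_nonneg_left (hC _ _ (hT y hy)) (abs_nonneg _)

lemma integrable_waveInt {p : ℝ → ℝ} (hp : Integrable p) {H : ℝ → ℝ → ℝ}
    (hH : BddBelowTime H) (x t : ℝ) : Integrable (fun y => p y * H y (t - |x - y|)) := by
  rw [← integrableOn_univ]
  exact integrableOn_mul_comp hp hH (by fun_prop) MeasurableSet.univ (T := t)
    fun y _ => by linarith [abs_nonneg (x - y)]

lemma setIntegral_waveInt_split (p : ℝ → ℝ) (H : ℝ → ℝ → ℝ) (x t : ℝ) :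
    (∫ y in Ioi x, p y * H y (t - |x - y|)) = rightInt p H x (t + x) ∧
      (∫ y in Iic x, p y * H y (t - |x - y|)) = leftInt p H x (t - x) := by
  constructor
  · refine setIntegral_congr_fun measurableSet_Ioi fun y hy => ?_
    have : |x - y| = y - x := by rw [abs_sub_comm, abs_of_pos (sub_pos.2 hy)]
    simp only [this]
    ring_nf
  · refine setIntegral_congr_fun measurableSet_Iic fun y hy => ?_
    have : |x - y| = x - y := abs_of_nonneg (sub_nonneg.2 hy)
    simp only [this]
    ring_nf

lemma waveInt_eq_add {p : ℝ → ℝ} (hp : Integrable p) {H : ℝ → ℝ → ℝ}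
    (hH : BddBelowTime H) (x t : ℝ) :
    waveInt p H x t = rightInt p H x (t + x) + leftInt p H x (t - x) := by
  rw [← (setIntegral_waveInt_split p H x t).1, ← (setIntegral_waveInt_split p H x t).2, waveInt,
    ← compl_Iic, add_comm]
  exact (integral_add_compl measurableSet_Iic (integrable_waveInt hp hH x t)).symm

lemma continuousAt_rightInt {p : ℝ → ℝ} (hp : Integrable p) {H : ℝ → ℝ → ℝ}
    (hH : BddBelowTime H) {z : ℝ × ℝ}
    (hc : ∀ᵐ y : ℝ, z.1 < y → ContinuousAt (H y) (z.2 - y)) :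
    ContinuousAt (fun w : ℝ × ℝ => rightInt p H w.1 w.2) z := by
  obtain ⟨C, hC0, hC⟩ := hH.bdd (z.2 - z.1 + 1)
  have e : (fun w : ℝ × ℝ => rightInt p H w.1 w.2) =
      fun w => ∫ y, (Ioi w.1).indicator (fun y => p y * H y (w.2 - y)) y := by
    funext w
    rw [integral_indicator measurableSet_Ioi, rightInt]
  rw [e]
  refine continuousAt_of_dominated (bound := fun y => |p y| * C) ?_ ?_ (hp.abs.mul_const C) ?_
  · refine Eventually.of_forall fun w => ?_
    exact (aestronglyMeasurable_mul_comp hp hH.meas (by fun_prop)).indicator measurableSet_Ioi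
  · have h1 : ∀ᶠ w : ℝ × ℝ in 𝓝 z, w.2 - w.1 < z.2 - z.1 + 1 :=
      ((continuous_snd.sub continuous_fst).tendsto z).eventually_lt_const (by simp)
    filter_upwards [h1] with w hw
    refine ae_of_all _ fun y => ?_
    by_cases hy : w.1 < y
    · rw [indicator_of_mem (show y ∈ Ioi w.1 from hy), Real.norm_eq_abs, abs_mul]
      exact mul_le_mul_of_nonneg_left (hC _ _ (by linarith)) (abs_nonneg _)
    · rw [indicator_of_notMem (show y ∉ Ioi w.1 from hy), norm_zero]
      positivity
  · filter_upwards [hc, Measure.ae_ne volume z.1] with y hy hne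
    rcases lt_or_gt_of_ne hne with h | h
    · have : ∀ᶠ w : ℝ × ℝ in 𝓝 z, y < w.1 := (continuous_fst.tendsto z).eventually_const_lt h
      refine (continuousAt_const (y := (0 : ℝ))).congr ?_
      filter_upwards [this] with w hw
      rw [indicator_of_notMem (show y ∉ Ioi w.1 from not_lt.2 hw.le)]
    · have : ∀ᶠ w : ℝ × ℝ in 𝓝 z, w.1 < y := (continuous_fst.tendsto z).eventually_lt_const h
      have h2 : ContinuousAt (fun w : ℝ × ℝ => p y * H y (w.2 - y)) z := by
        refine continuousAt_const.mul ?_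
        exact ContinuousAt.comp (f := fun w : ℝ × ℝ => w.2 - y) (g := H y) (hy h) (by fun_prop)
      refine h2.congr ?_
      filter_upwards [this] with w hw
      rw [indicator_of_mem (show y ∈ Ioi w.1 from hw)]

lemma hasDerivAt_rightInt_snd {p : ℝ → ℝ} (hp : Integrable p) {H h : ℝ → ℝ → ℝ}
    (hH : LipBelowTime H) (hh : Measurable (fun z : ℝ × ℝ => h z.1 z.2)) {x ξ : ℝ}
    (hd : ∀ᵐ y : ℝ, x < y → HasDerivAt (H y) (h y (ξ - y)) (ξ - y)) :
    HasDerivAt (fun ζ => rightInt p H x ζ) (rightInt p h x ξ) ξ := by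
  obtain ⟨C, hC0, hC⟩ := hH.lip (ξ - x + 1)
  refine (hasDerivAt_integral_of_dominated_loc_of_lip (μ := volume.restrict (Ioi x))
    (F := fun ζ y => p y * H y (ζ - y)) (F' := fun y => p y * h y (ξ - y)) (x₀ := ξ)
    (s := Iio (ξ + 1)) (bound := fun y => |p y| * C)
    (Iio_mem_nhds (by linarith)) ?_ ?_ ?_ ?_ ?_ ?_).2
  · exact Eventually.of_forall fun ζ =>
      (aestronglyMeasurable_mul_comp hp hH.meas (by fun_prop)).restrict
  · exact integrableOn_mul_comp hp hH.toBddBelowTime (by fun_prop) measurableSet_Ioi (T := ξ - x)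
      fun y hy => by linarith [mem_Ioi.1 hy]
  · exact (aestronglyMeasurable_mul_comp hp hh (by fun_prop)).restrict
  · refine (ae_restrict_iff' measurableSet_Ioi).2 (ae_of_all _ fun y hy => ?_)
    refine LipschitzOnWith.of_dist_le_mul fun ζ hζ ζ' hζ' => ?_
    have hy' := mem_Ioi.1 hy
    have h1 := mem_Iio.1 hζ
    have h2 := mem_Iio.1 hζ'
    rw [Real.dist_eq, Real.dist_eq, ← mul_sub, abs_mul, Real.coe_nnabs,
      abs_of_nonneg (mul_nonneg (abs_nonneg _) hC0), mul_assoc]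
    refine mul_le_mul_of_nonneg_left ?_ (abs_nonneg _)
    simpa using hC y (ζ - y) (ζ' - y) (by linarith) (by linarith)
  · exact (hp.abs.mul_const C).integrableOn
  · refine (ae_restrict_iff' measurableSet_Ioi).2 (hd.mono fun y hy hxy => ?_)
    exact ((hy hxy).comp_sub_const ξ y).const_mul (p y)

lemma hasDerivAt_rightInt_fst {p : ℝ → ℝ} (hp : Integrable p) {H : ℝ → ℝ → ℝ}
    (hH : BddBelowTime H) {x ξ : ℝ} (hpx : ContinuousAt p x)
    (hc : ContinuousAt (fun z : ℝ × ℝ => H z.1 z.2) (x, ξ - x)) :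
    HasDerivAt (fun y => rightInt p H y ξ) (-(p x * H x (ξ - x))) x := by
  have hint : IntegrableOn (fun y => p y * H y (ξ - y)) (Ioi (x - 1)) :=
    integrableOn_mul_comp hp hH (by fun_prop) measurableSet_Ioi (T := ξ - x + 1)
      fun y hy => by linarith [mem_Ioi.1 hy]
  have hcont : ContinuousAt (fun y => p y * H y (ξ - y)) x :=
    hpx.mul (ContinuousAt.comp (f := fun y : ℝ => (y, ξ - y)) (g := fun z : ℝ × ℝ => H z.1 z.2) hc
      (by fun_prop))
  have hI : IntervalIntegrable (fun y => p y * H y (ξ - y)) volume (x - 1) x := by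
    rw [intervalIntegrable_iff_integrableOn_Ioc_of_le (by linarith)]
    exact hint.mono_set Ioc_subset_Ioi_self
  have hd := intervalIntegral.integral_hasDerivAt_right hI
    ((aestronglyMeasurable_mul_comp hp hH.meas (by fun_prop)).stronglyMeasurableAtFilter) hcont
  have := hd.const_sub (∫ y in Ioi (x - 1), p y * H y (ξ - y))
  refine this.congr_of_eventuallyEq ?_
  filter_upwards [Ioi_mem_nhds (show x - 1 < x by linarith)] with y hy
  have := intervalIntegral.integral_Ioi_sub_Ioi hint (le_of_lt hy)
  rw [rightInt]
  linarith

lemma continuousAt_leftInt {p : ℝ → ℝ} (hp : Integrable p) {H : ℝ → ℝ → ℝ}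
    (hH : BddBelowTime H) {z : ℝ × ℝ}
    (hc : ∀ᵐ y : ℝ, y < z.1 → ContinuousAt (H y) (z.2 + y)) :
    ContinuousAt (fun w : ℝ × ℝ => leftInt p H w.1 w.2) z := by
  simp only [leftInt_eq_rightInt]
  have h1 := continuousAt_rightInt (p := fun y => p (-y)) (z := (-z.1, z.2)) hp.comp_neg hH.reflect ?_
  · exact ContinuousAt.comp (f := fun w : ℝ × ℝ => (-w.1, w.2))
      (g := fun w : ℝ × ℝ => rightInt (fun y => p (-y)) (fun y => H (-y)) w.1 w.2) h1 (by fun_prop)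
  · have := (Measure.measurePreserving_neg (volume : Measure ℝ)).quasiMeasurePreserving.ae hc
    filter_upwards [this] with y hy hlt
    simpa [sub_eq_add_neg] using hy (by simpa using neg_lt_neg hlt)

lemma hasDerivAt_leftInt_snd {p : ℝ → ℝ} (hp : Integrable p) {H h : ℝ → ℝ → ℝ}
    (hH : LipBelowTime H) (hh : Measurable (fun z : ℝ × ℝ => h z.1 z.2)) {x η : ℝ}
    (hd : ∀ᵐ y : ℝ, y < x → HasDerivAt (H y) (h y (η + y)) (η + y)) :
    HasDerivAt (fun ζ => leftInt p H x ζ) (leftInt p h x η) η := by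
  simp only [leftInt_eq_rightInt]
  refine hasDerivAt_rightInt_snd hp.comp_neg hH.reflect
    (hh.comp (f := fun z : ℝ × ℝ => (-z.1, z.2)) (by fun_prop)) ?_
  have := (Measure.measurePreserving_neg (volume : Measure ℝ)).quasiMeasurePreserving.ae hd
  filter_upwards [this] with y hy hlt
  simpa [sub_eq_add_neg] using hy (by simpa using neg_lt_neg hlt)

lemma hasDerivAt_leftInt_fst {p : ℝ → ℝ} (hp : Integrable p) {H : ℝ → ℝ → ℝ}
    (hH : BddBelowTime H) {x η : ℝ} (hpx : ContinuousAt p x)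
    (hc : ContinuousAt (fun z : ℝ × ℝ => H z.1 z.2) (x, η + x)) :
    HasDerivAt (fun y => leftInt p H y η) (p x * H x (η + x)) x := by
  simp only [leftInt_eq_rightInt]
  have := hasDerivAt_rightInt_fst (p := fun y => p (-y)) (H := fun y => H (-y)) (x := -x) (ξ := η)
    hp.comp_neg hH.reflect
    (ContinuousAt.comp (f := fun y : ℝ => -y) (g := p) (by simpa using hpx) (by fun_prop))
    (ContinuousAt.comp (f := fun z : ℝ × ℝ => (-z.1, z.2)) (g := fun z : ℝ × ℝ => H z.1 z.2)
      (by simpa using hc) (by fun_prop))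
  have h2 := HasDerivAt.comp x this (hasDerivAt_neg x)
  simpa [Function.comp_def] using h2

/-- `waveInt p H` is differentiable wherever almost all `H y` are differentiable in time at the
points of the two characteristics. No continuity of `p` is needed. -/
lemma hasFDerivAt_waveInt {p : ℝ → ℝ} (hp : Integrable p) {H h : ℝ → ℝ → ℝ}
    (hH : LipBelowTime H) (hh : Measurable (fun z : ℝ × ℝ => h z.1 z.2)) {x t : ℝ}
    (hd : ∀ᵐ y : ℝ, HasDerivAt (H y) (h y (t - |x - y|)) (t - |x - y|)) :
    HasFDerivAt (fun z : ℝ × ℝ => waveInt p H z.1 z.2)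
      (linForm (rightInt p h x (t + x) - leftInt p h x (t - x))
        (rightInt p h x (t + x) + leftInt p h x (t - x))) (x, t) := by
  obtain ⟨C, hC0, hC⟩ := hH.lip (t + 1)
  set σ : ℝ → ℝ := fun y => if x < y then -1 else 1 with hσ
  have hσm : Measurable σ := Measurable.ite measurableSet_Ioi measurable_const measurable_const
  set F' : ℝ → ℝ × ℝ →L[ℝ] ℝ := fun y =>
    (p y * h y (t - |x - y|)) • linForm (-σ y) 1 with hF'
  have key := hasFDerivAt_integral_of_dominated_loc_of_lip (𝕜 := ℝ) (μ := (volume : Measure ℝ))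
    (F := fun (z : ℝ × ℝ) y => p y * H y (z.2 - |z.1 - y|)) (F' := F') (x₀ := (x, t))
    (s := {z | z.2 < t + 1}) (bound := fun y => |p y| * (C * 2))
    ((isOpen_lt continuous_snd continuous_const).mem_nhds (by simp)) ?_
    (integrable_waveInt hp hH.toBddBelowTime x t) ?_ ?_ (hp.abs.mul_const _) ?_
  · obtain ⟨hint, hder⟩ := key
    have hhint : Integrable (fun y => p y * h y (t - |x - y|)) := by
      have := hint.apply_continuousLinearMap (0, 1)
      simpa [hF'] using this
    refine hder.congr_fderiv ?_
    have e1 := (setIntegral_waveInt_split p h x t).1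
    have e2 := (setIntegral_waveInt_split p h x t).2
    have e3 : ∫ y, p y * h y (t - |x - y|) =
        rightInt p h x (t + x) + leftInt p h x (t - x) := by
      rw [← e1, ← e2, ← compl_Iic, add_comm]
      exact (integral_add_compl measurableSet_Iic hhint).symm
    have hhint' : Integrable (fun y => p y * h y (t - |x - y|) * -σ y) := by
      have := hint.apply_continuousLinearMap (1, 0)
      simpa [hF'] using this
    have e4 : ∫ y, p y * h y (t - |x - y|) * -σ y =
        rightInt p h x (t + x) - leftInt p h x (t - x) := by
      rw [← e1, ← e2, ← compl_Iic, ← integral_add_compl measurableSet_Iic hhint', compl_Iic,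
        sub_eq_neg_add, ← integral_neg]
      congr 1
      · refine setIntegral_congr_fun measurableSet_Iic fun y hy => ?_
        simp [hσ, not_lt.2 (mem_Iic.1 hy)]
      · refine setIntegral_congr_fun measurableSet_Ioi fun y hy => ?_
        simp [hσ, mem_Ioi.1 hy]
    apply ContinuousLinearMap.ext
    intro w
    rw [ContinuousLinearMap.integral_apply hint]
    have : (fun y => F' y w) = fun y => w.1 * (p y * h y (t - |x - y|) * -σ y) +
        w.2 * (p y * h y (t - |x - y|)) := by
      funext y
      simp only [hF', smul_apply, linForm_apply, smul_eq_mul]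
      ring
    rw [this, integral_add (hhint'.const_mul _) (hhint.const_mul _), integral_const_mul,
      integral_const_mul, e3, e4, linForm_apply]
  · exact Eventually.of_forall fun z => aestronglyMeasurable_mul_comp hp hH.meas (by fun_prop)
  · refine (aestronglyMeasurable_mul_comp hp hh (by fun_prop)).smul ?_
    exact (continuous_linForm.measurable.comp
      (hσm.neg.prodMk measurable_const)).aestronglyMeasurable
  · refine ae_of_all _ fun y => LipschitzOnWith.of_dist_le_mul fun z hz z' hz' => ?_
    have h1 : z.2 < t + 1 := hz
    have h2 : z'.2 < t + 1 := hz'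
    rw [Real.dist_eq, ← mul_sub, abs_mul, Real.coe_nnabs,
      abs_of_nonneg (mul_nonneg (abs_nonneg (p y)) (mul_nonneg hC0 zero_le_two)), mul_assoc]
    refine mul_le_mul_of_nonneg_left ?_ (abs_nonneg _)
    refine (hC y _ _ (by linarith [abs_nonneg (z.1 - y)])
      (by linarith [abs_nonneg (z'.1 - y)])).trans ?_
    rw [mul_assoc]
    refine mul_le_mul_of_nonneg_left ?_ hC0
    have h3 : |z.2 - z'.2| ≤ dist z z' := by
      rw [← Real.dist_eq]; exact le_max_right _ _
    have h4 : |z.1 - z'.1| ≤ dist z z' := by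
      rw [← Real.dist_eq]; exact le_max_left _ _
    have h5 : |(|z.1 - y| - |z'.1 - y|)| ≤ |z.1 - z'.1| := by
      refine (abs_abs_sub_abs_le_abs_sub _ _).trans (le_of_eq ?_)
      congr 1; ring
    calc |z.2 - |z.1 - y| - (z'.2 - |z'.1 - y|)|
        = |(z.2 - z'.2) - (|z.1 - y| - |z'.1 - y|)| := by congr 1; ring
      _ ≤ |z.2 - z'.2| + |(|z.1 - y| - |z'.1 - y|)| := abs_sub _ _
      _ ≤ 2 * dist z z' := by linarith
  · filter_upwards [hd, Measure.ae_ne volume x] with y hy hne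
    have habs : HasFDerivAt (fun z : ℝ × ℝ => z.2 - |z.1 - y|) (linForm (-σ y) 1) (x, t) := by
      rcases lt_or_gt_of_ne hne with hlt | hlt
      · have e : (fun z : ℝ × ℝ => z.2 - |z.1 - y|) =ᶠ[𝓝 (x, t)] fun z => z.2 - (z.1 - y) := by
          filter_upwards [(continuous_fst.tendsto (x, t)).eventually_const_lt hlt] with z hz
          rw [abs_of_pos (sub_pos.2 hz)]
        refine HasFDerivAt.congr_of_eventuallyEq ?_ e
        refine (hasFDerivAt_snd.sub (hasFDerivAt_fst.sub_const y)).congr_fderiv ?_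
        ext <;> simp [hσ, not_lt.2 hlt.le]
      · have e : (fun z : ℝ × ℝ => z.2 - |z.1 - y|) =ᶠ[𝓝 (x, t)] fun z => z.2 + (z.1 - y) := by
          filter_upwards [(continuous_fst.tendsto (x, t)).eventually_lt_const hlt] with z hz
          rw [abs_of_neg (sub_neg.2 hz)]; ring
        refine HasFDerivAt.congr_of_eventuallyEq ?_ e
        refine (hasFDerivAt_snd.add (hasFDerivAt_fst.sub_const y)).congr_fderiv ?_
        ext <;> simp [hσ, hlt]
    have := (HasDerivAt.comp_hasFDerivAt (x, t) hy habs).const_mul (p y)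
    refine this.congr_fderiv ?_
    simp only [hF', smul_smul]

/-! ### The integral equation of the Goursat problem -/

/-- The primitive `∫₀ˣ p`. -/
noncomputable def primitive (p : ℝ → ℝ) (x : ℝ) : ℝ := ∫ y in (0 : ℝ)..x, p y

/-- The solution of the wave equation without potential that has the values `a ∫₀ˣ p` on `t = x`
and `b ∫₀ˣ p` on `t = -x`. -/
noncomputable def goursatData (p : ℝ → ℝ) (a b x t : ℝ) : ℝ :=
  a * primitive p ((t + x) / 2) + b * primitive p ((x - t) / 2)

/-- The restriction of `W` to the open cone `|y| < s`, extended by zero. -/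
noncomputable def coneCut (W : ℝ → ℝ → ℝ) (y s : ℝ) : ℝ := if |y| < s then W y s else 0

/-- The time primitive of `coneCut W`. -/
noncomputable def conePrim (W : ℝ → ℝ → ℝ) (y τ : ℝ) : ℝ := ∫ s in |y|..(max |y| τ), W y s

/-- `W` is a continuous solution of the integral equation which, in the cone `|x| ≤ t`, is
equivalent to the Goursat problem for `w_tt - w_xx + p w = 0`. The values of `W` outside the cone are
irrelevant; taking the same equation there keeps `W` continuous on the plane. -/
structure IsKernel (p : ℝ → ℝ) (a b : ℝ) (W : ℝ → ℝ → ℝ) : Prop where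
  cont : Continuous (fun z : ℝ × ℝ => W z.1 z.2)
  bdd : ∀ T : ℝ, ∃ C : ℝ, 0 ≤ C ∧ ∀ x t, |t| ≤ T → |W x t| ≤ C
  eqn : ∀ x t, W x t = goursatData p a b x t - 1 / 2 * waveInt p (conePrim W) x t

lemma continuous_primitive {p : ℝ → ℝ} (hp : Integrable p) : Continuous (primitive p) :=
  intervalIntegral.continuous_primitive (fun _ _ => hp.intervalIntegrable) 0

lemma abs_primitive_le {p : ℝ → ℝ} (hp : Integrable p) (x : ℝ) :
    |primitive p x| ≤ ∫ y, |p y| := by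
  rw [← Real.norm_eq_abs]
  refine (intervalIntegral.norm_integral_le_integral_norm_uIoc).trans ?_
  exact setIntegral_le_integral hp.norm (ae_of_all _ fun y => norm_nonneg _)

@[simp] lemma primitive_zero (p : ℝ → ℝ) : primitive p 0 = 0 := by simp [primitive]

lemma hasDerivAt_primitive {p : ℝ → ℝ} (hp : Integrable p) {x : ℝ} (hx : ContinuousAt p x) :
    HasDerivAt (primitive p) (p x) x :=
  intervalIntegral.integral_hasDerivAt_right hp.intervalIntegrable
    hp.aestronglyMeasurable.stronglyMeasurableAtFilter hx

lemma conePrim_of_le (W : ℝ → ℝ → ℝ) {y τ : ℝ} (h : τ ≤ |y|) : conePrim W y τ = 0 := by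
  simp [conePrim, max_eq_left h]

lemma conePrim_of_ge (W : ℝ → ℝ → ℝ) {y τ : ℝ} (h : |y| ≤ τ) :
    conePrim W y τ = ∫ s in |y|..τ, W y s := by
  simp [conePrim, max_eq_right h]

lemma waveInt_eq_zero (p : ℝ → ℝ) {H : ℝ → ℝ → ℝ} (hH : ∀ y τ, τ ≤ |y| → H y τ = 0) {x t : ℝ}
    (h : t ≤ |x|) : waveInt p H x t = 0 := by
  rw [waveInt]
  refine integral_eq_zero_of_ae (ae_of_all _ fun y => ?_)
  have : t - |x - y| ≤ |y| := by
    have := abs_sub_abs_le_abs_sub x y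
    linarith
  simp [hH _ _ this]

lemma continuous_slice {W : ℝ → ℝ → ℝ} (hW : Continuous (fun z : ℝ × ℝ => W z.1 z.2)) (y : ℝ) :
    Continuous (W y) :=
  hW.comp (Continuous.prodMk_right y)

lemma continuous_conePrim {W : ℝ → ℝ → ℝ} (hW : Continuous (fun z : ℝ × ℝ => W z.1 z.2)) :
    Continuous (fun z : ℝ × ℝ => conePrim W z.1 z.2) := by
  have hc : Continuous (Function.uncurry fun (z : ℝ × ℝ) (s : ℝ) => W z.1 s) :=
    hW.comp ((continuous_fst.comp continuous_fst).prodMk continuous_snd)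
  have h1 : Continuous fun z : ℝ × ℝ => ∫ s in (0 : ℝ)..(max |z.1| z.2), W z.1 s :=
    intervalIntegral.continuous_parametric_intervalIntegral_of_continuous hc (by fun_prop)
  have h2 : Continuous fun z : ℝ × ℝ => ∫ s in (0 : ℝ)..|z.1|, W z.1 s :=
    intervalIntegral.continuous_parametric_intervalIntegral_of_continuous hc (by fun_prop)
  refine (h1.sub h2).congr fun z => ?_
  rw [conePrim]
  exact intervalIntegral.integral_interval_sub_left
    ((continuous_slice hW _).intervalIntegrable _ _) ((continuous_slice hW _).intervalIntegrable _ _)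

lemma measurable_coneCut {W : ℝ → ℝ → ℝ} (hW : Continuous (fun z : ℝ × ℝ => W z.1 z.2)) :
    Measurable (fun z : ℝ × ℝ => coneCut W z.1 z.2) :=
  Measurable.ite (measurableSet_lt (by fun_prop) (by fun_prop)) hW.measurable measurable_const

lemma abs_conePrim_le {W : ℝ → ℝ → ℝ} {M l : ℝ} (hM : 0 ≤ M) (hl : 0 < l)
    (hb : ∀ y s, |W y s| ≤ M * Real.exp (l * |s|)) {y τ t : ℝ} (h : τ ≤ t) :
    |conePrim W y τ| ≤ M / l * Real.exp (l * |t|) := by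
  rcases le_total τ |y| with h' | h'
  · rw [conePrim_of_le W h', abs_zero]; positivity
  have hτ : 0 ≤ τ := (abs_nonneg y).trans h'
  rw [conePrim_of_ge W h', ← Real.norm_eq_abs]
  have hI : ∫ s in |y|..τ, M * Real.exp (l * s) =
      M / l * (Real.exp (l * τ) - Real.exp (l * |y|)) := by
    rw [intervalIntegral.integral_const_mul, intervalIntegral.integral_comp_mul_left _ hl.ne',
      integral_exp, smul_eq_mul]
    ring
  have h1 : ‖∫ s in |y|..τ, W y s‖ ≤ ∫ s in |y|..τ, M * Real.exp (l * s) := by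
    refine intervalIntegral.norm_integral_le_of_norm_le h' (ae_of_all _ fun s hs => ?_)
      (Continuous.intervalIntegrable (by fun_prop) _ _)
    have := hb y s
    rwa [abs_of_nonneg ((abs_nonneg y).trans hs.1.le)] at this
  refine h1.trans ?_
  rw [hI]
  refine mul_le_mul_of_nonneg_left ?_ (by positivity)
  have h2 : Real.exp (l * τ) ≤ Real.exp (l * |t|) :=
    Real.exp_le_exp.2 (mul_le_mul_of_nonneg_left (h.trans (le_abs_self t)) hl.le)
  linarith [Real.exp_pos (l * |y|)]

lemma bddBelowTime_conePrim_of_exp {W : ℝ → ℝ → ℝ} (hW : Continuous (fun z : ℝ × ℝ => W z.1 z.2))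
    {M l : ℝ} (hM : 0 ≤ M) (hl : 0 < l) (hb : ∀ y s, |W y s| ≤ M * Real.exp (l * |s|)) :
    BddBelowTime (conePrim W) :=
  ⟨(continuous_conePrim hW).measurable, fun T => ⟨M / l * Real.exp (l * |T|), by positivity,
    fun _ _ h => abs_conePrim_le hM hl hb h⟩⟩

lemma continuous_waveInt {p : ℝ → ℝ} (hp : Integrable p) {H : ℝ → ℝ → ℝ} (hH : BddBelowTime H)
    (hc : ∀ᵐ y : ℝ, Continuous (H y)) : Continuous (fun z : ℝ × ℝ => waveInt p H z.1 z.2) := by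
  simp only [waveInt_eq_add hp hH]
  refine continuous_iff_continuousAt.2 fun z => ContinuousAt.add ?_ ?_
  · exact ContinuousAt.comp (f := fun w : ℝ × ℝ => (w.1, w.2 + w.1))
      (g := fun w : ℝ × ℝ => rightInt p H w.1 w.2)
      (continuousAt_rightInt hp hH (hc.mono fun y h _ => h.continuousAt)) (by fun_prop)
  · exact ContinuousAt.comp (f := fun w : ℝ × ℝ => (w.1, w.2 - w.1))
      (g := fun w : ℝ × ℝ => leftInt p H w.1 w.2)
      (continuousAt_leftInt hp hH (hc.mono fun y h _ => h.continuousAt)) (by fun_prop)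

lemma abs_waveInt_le {p : ℝ → ℝ} (hp : Integrable p) {H : ℝ → ℝ → ℝ} {x t C : ℝ}
    (hC : ∀ y τ, τ ≤ t → |H y τ| ≤ C) : |waveInt p H x t| ≤ (∫ y, |p y|) * C := by
  rw [← integral_mul_const, ← Real.norm_eq_abs, waveInt]
  refine norm_integral_le_of_norm_le (hp.abs.mul_const C) (ae_of_all _ fun y => ?_)
  rw [Real.norm_eq_abs, abs_mul]
  exact mul_le_mul_of_nonneg_left (hC _ _ (by linarith [abs_nonneg (x - y)])) (abs_nonneg _)

lemma continuous_goursatData {p : ℝ → ℝ} (hp : Integrable p) (a b : ℝ) :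
    Continuous (fun z : ℝ × ℝ => goursatData p a b z.1 z.2) := by
  have := continuous_primitive hp
  unfold goursatData
  fun_prop

/-- The integral equation has a solution: in the norm weighted by `exp (-l |t|)` with `l` large, its
right-hand side is a contraction. -/
theorem exists_isKernel {p : ℝ → ℝ} (hp : Integrable p) (a b : ℝ) : ∃ W, IsKernel p a b W := by
  set N : ℝ := ∫ y, |p y| with hN
  have hN0 : 0 ≤ N := integral_nonneg fun y => abs_nonneg _
  set l : ℝ := N + 1 with hl
  have hl0 : 0 < l := by positivity
  let wt : BoundedContinuousFunction (ℝ × ℝ) ℝ → ℝ → ℝ → ℝ :=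
    fun v x t => Real.exp (l * |t|) * v (x, t)
  have wt_cont : ∀ v, Continuous (fun z : ℝ × ℝ => wt v z.1 z.2) := fun v => by
    have := v.continuous
    show Continuous (fun z : ℝ × ℝ => Real.exp (l * |z.2|) * v z)
    fun_prop
  have wt_bound : ∀ v y s, |wt v y s| ≤ ‖v‖ * Real.exp (l * |s|) := fun v y s => by
    rw [abs_mul, abs_of_pos (Real.exp_pos _), mul_comm]
    exact mul_le_mul_of_nonneg_right (v.norm_coe_le_norm (y, s)) (Real.exp_pos _).le
  have wt_bdd : ∀ v, BddBelowTime (conePrim (wt v)) := fun v =>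
    bddBelowTime_conePrim_of_exp (wt_cont v) (norm_nonneg v) hl0 (wt_bound v)
  have wt_wave : ∀ v x t, |waveInt p (conePrim (wt v)) x t| ≤
      N * (‖v‖ / l * Real.exp (l * |t|)) := fun v x t =>
    abs_waveInt_le hp fun y τ h => abs_conePrim_le (norm_nonneg v) hl0 (wt_bound v) h
  have exp_cancel : ∀ t, Real.exp (-(l * |t|)) * Real.exp (l * |t|) = 1 := fun t => by
    rw [← Real.exp_add]; simp
  have exp_le : ∀ t, Real.exp (-(l * |t|)) ≤ 1 := fun t =>
    Real.exp_le_one_iff.2 (by simp only [Left.neg_nonpos_iff]; positivity)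
  let S : BoundedContinuousFunction (ℝ × ℝ) ℝ → BoundedContinuousFunction (ℝ × ℝ) ℝ := fun v =>
    BoundedContinuousFunction.ofNormedAddCommGroup
      (fun z => Real.exp (-(l * |z.2|)) *
        (goursatData p a b z.1 z.2 - 1 / 2 * waveInt p (conePrim (wt v)) z.1 z.2))
      (by
        have h1 := continuous_goursatData hp a b
        have h2 := continuous_waveInt hp (wt_bdd v)
          (ae_of_all _ fun y => continuous_slice (continuous_conePrim (wt_cont v)) y)
        fun_prop)
      ((|a| * N + |b| * N) + 1 / 2 * (N * (‖v‖ / l)))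
      (by
        intro z
        have hG : |goursatData p a b z.1 z.2| ≤ |a| * N + |b| * N := by
          refine (abs_add_le _ _).trans ?_
          rw [abs_mul, abs_mul]
          exact add_le_add (mul_le_mul_of_nonneg_left (abs_primitive_le hp _) (abs_nonneg _))
            (mul_le_mul_of_nonneg_left (abs_primitive_le hp _) (abs_nonneg _))
        have hw := wt_wave v z.1 z.2
        rw [Real.norm_eq_abs, abs_mul, abs_of_pos (Real.exp_pos _)]
        calc Real.exp (-(l * |z.2|)) *
              |goursatData p a b z.1 z.2 - 1 / 2 * waveInt p (conePrim (wt v)) z.1 z.2|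
            ≤ Real.exp (-(l * |z.2|)) *
              ((|a| * N + |b| * N) + 1 / 2 * (N * (‖v‖ / l * Real.exp (l * |z.2|)))) := by
              refine mul_le_mul_of_nonneg_left ((abs_sub _ _).trans ?_) (Real.exp_pos _).le
              rw [abs_mul, abs_of_pos (show (0 : ℝ) < 1 / 2 by norm_num)]
              linarith
          _ = Real.exp (-(l * |z.2|)) * (|a| * N + |b| * N) + (1 / 2 * (N * (‖v‖ / l))) *
                (Real.exp (-(l * |z.2|)) * Real.exp (l * |z.2|)) := by ring
          _ ≤ _ := by
              rw [exp_cancel, mul_one]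
              have : 0 ≤ |a| * N + |b| * N := by positivity
              nlinarith [exp_le z.2])
  have hS : ContractingWith (1 / 2) S := by
    refine ⟨by rw [← NNReal.coe_lt_coe]; norm_num, LipschitzWith.of_dist_le_mul fun v v' => ?_⟩
    rw [BoundedContinuousFunction.dist_le (by positivity)]
    intro z
    have hsub : waveInt p (conePrim (wt v)) z.1 z.2 - waveInt p (conePrim (wt v')) z.1 z.2 =
        waveInt p (conePrim (wt (v - v'))) z.1 z.2 := by
      rw [waveInt, waveInt, waveInt, ← integral_sub (integrable_waveInt hp (wt_bdd v) _ _)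
        (integrable_waveInt hp (wt_bdd v') _ _)]
      congr 1
      funext y
      rw [← mul_sub, conePrim, conePrim, conePrim, ← intervalIntegral.integral_sub
        ((continuous_slice (wt_cont v) _).intervalIntegrable _ _)
        ((continuous_slice (wt_cont v') _).intervalIntegrable _ _)]
      congr 2
      funext s
      simp [wt, mul_sub]
    have hw := wt_wave (v - v') z.1 z.2
    have hd : dist (S v z) (S v' z) = Real.exp (-(l * |z.2|)) *
        (1 / 2 * |waveInt p (conePrim (wt (v - v'))) z.1 z.2|) := by
      rw [Real.dist_eq, ← hsub]
      show |Real.exp (-(l * |z.2|)) * (goursatData p a b z.1 z.2 - 1 / 2 * _) -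
        Real.exp (-(l * |z.2|)) * (goursatData p a b z.1 z.2 - 1 / 2 * _)| = _
      rw [← mul_sub, abs_mul, abs_of_pos (Real.exp_pos _), sub_sub_sub_cancel_left, ← mul_sub,
        abs_mul, abs_of_pos (show (0 : ℝ) < 1 / 2 by norm_num), abs_sub_comm]
    rw [hd, dist_eq_norm]
    have hNl : N * (‖v - v'‖ / l) ≤ ‖v - v'‖ := by
      rw [mul_div_assoc', div_le_iff₀ hl0]
      nlinarith [norm_nonneg (v - v')]
    calc Real.exp (-(l * |z.2|)) * (1 / 2 * |waveInt p (conePrim (wt (v - v'))) z.1 z.2|)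
        ≤ Real.exp (-(l * |z.2|)) * (1 / 2 * (N * (‖v - v'‖ / l * Real.exp (l * |z.2|)))) := by
          refine mul_le_mul_of_nonneg_left ?_ (Real.exp_pos _).le
          linarith
      _ = 1 / 2 * (N * (‖v - v'‖ / l)) * (Real.exp (-(l * |z.2|)) * Real.exp (l * |z.2|)) := by
          ring
      _ ≤ _ := by
          rw [exp_cancel, mul_one]
          push_cast
          linarith
  set v := hS.fixedPoint S
  have hv : S v = v := hS.fixedPoint_isFixedPt
  refine ⟨wt v, wt_cont v, fun T => ⟨‖v‖ * Real.exp (l * T), by positivity, fun x t h => ?_⟩,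
    fun x t => ?_⟩
  · refine (wt_bound v x t).trans (mul_le_mul_of_nonneg_left ?_ (norm_nonneg _))
    exact Real.exp_le_exp.2 (mul_le_mul_of_nonneg_left h hl0.le)
  · have h1 : v (x, t) = Real.exp (-(l * |t|)) *
        (goursatData p a b x t - 1 / 2 * waveInt p (conePrim (wt v)) x t) := by
      conv_lhs => rw [← hv]
      rfl
    show Real.exp (l * |t|) * v (x, t) = _
    rw [h1, ← mul_assoc, mul_comm (Real.exp (l * |t|)), exp_cancel, one_mul]

/-! ### Continuity and time derivatives of the parts of the kernel -/

namespace IsKernel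

variable {p : ℝ → ℝ} {a b : ℝ} {W : ℝ → ℝ → ℝ}

lemma bddBelowTime_coneCut (hW : IsKernel p a b W) : BddBelowTime (coneCut W) := by
  refine ⟨measurable_coneCut hW.cont, fun T => ?_⟩
  obtain ⟨C, hC0, hC⟩ := hW.bdd T
  refine ⟨C, hC0, fun y τ hτ => ?_⟩
  rw [coneCut]
  split_ifs with h
  · exact hC _ _ (by rwa [abs_of_pos ((abs_nonneg y).trans_lt h)])
  · simpa using hC0

lemma lipBelowTime_conePrim (hW : IsKernel p a b W) : LipBelowTime (conePrim W) := by
  have hlip : ∀ T : ℝ, ∃ C : ℝ, 0 ≤ C ∧ ∀ y τ τ', τ ≤ T → τ' ≤ T →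
      |conePrim W y τ - conePrim W y τ'| ≤ C * |τ - τ'| := by
    intro T
    obtain ⟨C, hC0, hC⟩ := hW.bdd T
    refine ⟨C, hC0, fun y τ τ' hτ hτ' => ?_⟩
    rw [conePrim, conePrim, intervalIntegral.integral_interval_sub_left
      ((continuous_slice hW.cont _).intervalIntegrable _ _)
      ((continuous_slice hW.cont _).intervalIntegrable _ _), ← Real.norm_eq_abs]
    refine (intervalIntegral.norm_integral_le_of_norm_le_const (C := C) fun s hs => ?_).trans ?_
    · have h1 : |y| < s := (le_min (le_max_left _ _) (le_max_left _ _)).trans_lt hs.1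
      have h2 : s ≤ T := by
        have := hs.2
        simp only [le_max_iff] at this
        rcases this with (h | h) | (h | h) <;> linarith
      exact hC _ _ (by rwa [abs_of_pos ((abs_nonneg y).trans_lt h1)])
    · refine mul_le_mul_of_nonneg_left ?_ hC0
      simpa [max_comm] using abs_max_sub_max_le_abs τ τ' |y|
  refine ⟨⟨(continuous_conePrim hW.cont).measurable, fun T => ?_⟩, hlip⟩
  obtain ⟨C, hC0, hC⟩ := hlip T
  refine ⟨C * |T|, by positivity, fun y τ hτ => ?_⟩
  rcases le_total τ |y| with h | h
  · rw [conePrim_of_le W h, abs_zero]; positivity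
  · have := hC y τ |y| hτ (h.trans hτ)
    rw [conePrim_of_le W le_rfl, sub_zero] at this
    refine this.trans (mul_le_mul_of_nonneg_left ?_ hC0)
    rw [abs_of_nonneg (sub_nonneg.2 h)]
    linarith [abs_nonneg y, le_abs_self T]

lemma hasDerivAt_conePrim (hW : IsKernel p a b W) {y τ : ℝ} (h : τ ≠ |y|) :
    HasDerivAt (conePrim W y) (coneCut W y τ) τ := by
  rcases lt_or_gt_of_ne h with h | h
  · rw [coneCut, if_neg (not_lt.2 h.le)]
    refine (hasDerivAt_const τ (0 : ℝ)).congr_of_eventuallyEq ?_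
    filter_upwards [Iio_mem_nhds h] with s hs
    exact conePrim_of_le W (le_of_lt hs)
  · rw [coneCut, if_pos h]
    have hc := continuous_slice hW.cont y
    refine (intervalIntegral.integral_hasDerivAt_right (hc.intervalIntegrable |y| τ)
      (hc.stronglyMeasurableAtFilter _ _) hc.continuousAt).congr_of_eventuallyEq ?_
    filter_upwards [Ioi_mem_nhds h] with s hs
    exact conePrim_of_ge W (le_of_lt hs)

lemma continuousAt_coneCut (hW : IsKernel p a b W) {y s : ℝ} (h : s ≠ |y|) :
    ContinuousAt (fun z : ℝ × ℝ => coneCut W z.1 z.2) (y, s) := by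
  rcases lt_or_gt_of_ne h with h | h
  · refine (continuousAt_const (y := (0 : ℝ))).congr ?_
    filter_upwards [(isOpen_lt continuous_snd continuous_fst.abs).mem_nhds
      (show (y, s) ∈ {z : ℝ × ℝ | z.2 < |z.1|} from h)] with z hz
    exact (if_neg (not_lt.2 (le_of_lt hz))).symm
  · refine hW.cont.continuousAt.congr ?_
    filter_upwards [(isOpen_lt continuous_fst.abs continuous_snd).mem_nhds
      (show (y, s) ∈ {z : ℝ × ℝ | |z.1| < z.2} from h)] with z hz
    exact (if_pos hz).symm

lemma waveInt_conePrim_eq_zero {x t : ℝ} (h : t ≤ |x|) : waveInt p (conePrim W) x t = 0 :=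
  waveInt_eq_zero p (fun _ _ => conePrim_of_le W) h

/-- On the characteristics from the vertex, the kernel takes the prescribed values. -/
lemma eq_on_right (hW : IsKernel p a b W) (y : ℝ) : W y y = a * primitive p y := by
  rw [hW.eqn, waveInt_conePrim_eq_zero (le_abs_self y), goursatData]
  simp

lemma eq_on_left (hW : IsKernel p a b W) (y : ℝ) : W y (-y) = b * primitive p y := by
  rw [hW.eqn, waveInt_conePrim_eq_zero (neg_le_abs y), goursatData]
  simp only [neg_add_cancel, zero_div, primitive_zero, sub_neg_eq_add, add_self_div_two]
  simp

end IsKernel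

/-! ### Truncated correlations of a square integrable potential -/

/-- The correlation `∫_x^z p(y) p(y - z) dy`. -/
noncomputable def corr (p : ℝ → ℝ) (x z : ℝ) : ℝ :=
  ∫ y, (Ioi x).indicator p y * (Ioi 0).indicator (fun u => p (-u)) (z - y)

/-- The truncations `p 1_{(x, ∞)}` depend continuously on `x` in `L²`. -/
lemma continuous_toLp_indicator_Ioi {p : ℝ → ℝ} (hp2 : MemLp p 2) :
    Continuous (fun x : ℝ => (hp2.indicator (measurableSet_Ioi (a := x))).toLp
      ((Ioi x).indicator p)) := by
  refine continuous_iff_continuousAt.2 fun x₀ => ?_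
  rw [ContinuousAt, tendsto_iff_norm_sub_tendsto_zero]
  have hint : Integrable (fun y => p y ^ 2) := (memLp_two_iff_integrable_sq hp2.1).1 hp2
  have hsq : ∀ x : ℝ, ‖(hp2.indicator (measurableSet_Ioi (a := x))).toLp ((Ioi x).indicator p) -
      (hp2.indicator (measurableSet_Ioi (a := x₀))).toLp ((Ioi x₀).indicator p)‖ ^ 2 =
      ∫ y, ((Ioi x).indicator p y - (Ioi x₀).indicator p y) ^ 2 := fun x => by
    rw [← MemLp.toLp_sub, ← real_inner_self_eq_norm_sq, L2.inner_def]
    refine integral_congr_ae ?_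
    filter_upwards [MemLp.coeFn_toLp ((hp2.indicator (measurableSet_Ioi (a := x))).sub
      (hp2.indicator (measurableSet_Ioi (a := x₀))))] with y hy
    rw [hy]
    simp [sq]
  have hlim : Tendsto (fun x : ℝ => ∫ y, ((Ioi x).indicator p y - (Ioi x₀).indicator p y) ^ 2)
      (𝓝 x₀) (𝓝 0) := by
    have hcont : ContinuousAt
        (fun x : ℝ => ∫ y, ((Ioi x).indicator p y - (Ioi x₀).indicator p y) ^ 2) x₀ := by
      refine continuousAt_of_dominated (bound := fun y => p y ^ 2) ?_ ?_ hint ?_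
      · exact Eventually.of_forall fun x =>
          ((hp2.1.indicator measurableSet_Ioi).sub (hp2.1.indicator measurableSet_Ioi)).pow 2
      · refine Eventually.of_forall fun x => ae_of_all _ fun y => ?_
        by_cases h1 : x < y <;> by_cases h2 : x₀ < y <;> simp [h1, h2, sq_nonneg]
      · filter_upwards [Measure.ae_ne volume x₀] with y hy
        refine (continuousAt_const (y := (0 : ℝ))).congr ?_
        rcases lt_or_gt_of_ne hy with h | h
        · filter_upwards [Ioi_mem_nhds h] with x hx
          simp [not_lt.2 h.le, not_lt.2 (le_of_lt (mem_Ioi.1 hx))]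
        · filter_upwards [Iio_mem_nhds h] with x hx
          simp [h, mem_Iio.1 hx]
    have := hcont.tendsto
    simpa using this
  have := hlim.sqrt
  rw [Real.sqrt_zero] at this
  refine this.congr fun x => ?_
  rw [← hsq, Real.sqrt_sq (norm_nonneg _)]

/-- The reflected translates of a square integrable function depend continuously on the centre. -/
lemma continuous_toLp_comp_sub_left {g : ℝ → ℝ} (hg : MemLp g 2) :
    Continuous fun z : ℝ => (hg.comp_measurePreserving
      (Measure.measurePreserving_sub_left volume z)).toLp (g ∘ fun y => z - y) := by
  have hφ : Continuous fun z : ℝ => (⟨fun y => z - y, by fun_prop⟩ : C(ℝ, ℝ)) :=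
    ContinuousMap.continuous_of_continuous_uncurry _
      (show Continuous fun w : ℝ × ℝ => w.1 - w.2 by fun_prop)
  exact (continuous_const (y := hg.toLp g)).compMeasurePreservingLp hφ
    (fun z => Measure.measurePreserving_sub_left volume z) (by norm_num)

lemma inner_toLp_eq_integral {f g : ℝ → ℝ} (hf : MemLp f 2) (hg : MemLp g 2) :
    inner ℝ (hf.toLp f) (hg.toLp g) = ∫ y, f y * g y := by
  rw [L2.inner_def]
  refine integral_congr_ae ?_
  filter_upwards [hf.coeFn_toLp, hg.coeFn_toLp] with y h1 h2
  rw [h1, h2]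
  simp [mul_comm]

lemma continuous_corr {p : ℝ → ℝ} (hp2 : MemLp p 2) :
    Continuous (fun w : ℝ × ℝ => corr p w.1 w.2) := by
  have hn2 : MemLp (fun u => p (-u)) 2 :=
    hp2.comp_measurePreserving (Measure.measurePreserving_neg (volume : Measure ℝ))
  have hg2 : MemLp ((Ioi (0 : ℝ)).indicator (fun u => p (-u))) 2 := hn2.indicator measurableSet_Ioi
  unfold corr
  generalize (Ioi (0 : ℝ)).indicator (fun u => p (-u)) = g at hg2
  have hin := ((continuous_toLp_indicator_Ioi hp2).comp (continuous_fst (X := ℝ) (Y := ℝ))).inner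
    (𝕜 := ℝ) ((continuous_toLp_comp_sub_left hg2).comp (continuous_snd (X := ℝ) (Y := ℝ)))
  exact hin.congr fun w => inner_toLp_eq_integral (hp2.indicator measurableSet_Ioi)
    (hg2.comp_measurePreserving (Measure.measurePreserving_sub_left volume w.2))

/-- `∫_x^z p(y) (∫₀^{y-z} p) dy` is minus the integral of the correlation from `x` to `z`. -/
lemma integral_mul_primitive {p : ℝ → ℝ} (hp : Integrable p) {x z : ℝ} (hxz : x ≤ z) :
    ∫ y in x..z, p y * primitive p (y - z) = -∫ ζ in x..z, corr p x ζ := by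
  set f : ℝ → ℝ := (Ioi x).indicator p with hf
  set g : ℝ → ℝ := (Ioi 0).indicator (fun u => p (-u)) with hg
  have hfi : Integrable f := hp.indicator measurableSet_Ioi
  have hgi : Integrable g := hp.comp_neg.indicator measurableSet_Ioi
  have hconv : Integrable (fun w : ℝ × ℝ => f w.2 * g (w.1 - w.2)) :=
    Integrable.convolution_integrand (ContinuousLinearMap.mul ℝ ℝ) hfi hgi
  have hinner : ∀ y, ∫ ζ in Ioc x z, f y * g (ζ - y) =
      (Ioc x z).indicator (fun y => -(p y * primitive p (y - z))) y := by
    intro y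
    rw [integral_const_mul]
    by_cases hxy : x < y
    · have hfy : f y = p y := indicator_of_mem (show y ∈ Ioi x from hxy) _
      by_cases hyz : y ≤ z
      · rw [indicator_of_mem (show y ∈ Ioc x z from ⟨hxy, hyz⟩), hfy, ← mul_neg]
        congr 1
        have e1 : ∫ ζ in Ioc x z, g (ζ - y) = ∫ ζ in Ioc y z, p (y - ζ) := by
          rw [← integral_indicator measurableSet_Ioc, ← integral_indicator measurableSet_Ioc]
          congr 1
          funext ζ
          by_cases h1 : y < ζ
          · by_cases h2 : ζ ≤ z
            · rw [indicator_of_mem (show ζ ∈ Ioc x z from ⟨hxy.trans h1, h2⟩),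
                indicator_of_mem (show ζ ∈ Ioc y z from ⟨h1, h2⟩), hg,
                indicator_of_mem (show ζ - y ∈ Ioi (0 : ℝ) from sub_pos.2 h1), neg_sub]
            · rw [indicator_of_notMem (fun h => h2 h.2), indicator_of_notMem (fun h => h2 h.2)]
          · rw [indicator_of_notMem (s := Ioc y z) (fun h => h1 h.1)]
            have : g (ζ - y) = 0 :=
              indicator_of_notMem (fun h => h1 (sub_pos.1 h)) _
            simp [indicator, this]
        rw [e1, ← intervalIntegral.integral_of_le hyz, intervalIntegral.integral_comp_sub_left,
          sub_self, intervalIntegral.integral_symm, primitive]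
      · rw [indicator_of_notMem (fun h => hyz h.2)]
        have : ∫ ζ in Ioc x z, g (ζ - y) = 0 := by
          refine setIntegral_eq_zero_of_forall_eq_zero fun ζ hζ => ?_
          refine indicator_of_notMem (fun h => ?_) _
          have := mem_Ioi.1 h
          linarith [hζ.2, not_le.1 hyz]
        rw [this, mul_zero]
    · rw [indicator_of_notMem (fun h => hxy h.1)]
      have hfy : f y = 0 := indicator_of_notMem (show y ∉ Ioi x from hxy) _
      rw [hfy, zero_mul]
  have hsub : Integrable (Function.uncurry fun (ζ y : ℝ) => f y * g (ζ - y))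
      ((volume.restrict (Ioc x z)).prod volume) := by
    have := hconv.restrict (s := Ioc x z ×ˢ univ)
    rwa [Measure.volume_eq_prod, ← Measure.prod_restrict, Measure.restrict_univ] at this
  rw [intervalIntegral.integral_of_le hxz, intervalIntegral.integral_of_le hxz]
  have hswap := integral_integral_swap hsub
  have : ∫ ζ in Ioc x z, corr p x ζ = ∫ y, ∫ ζ in Ioc x z, f y * g (ζ - y) := hswap
  rw [this]
  simp only [hinner]
  rw [integral_indicator measurableSet_Ioc, integral_neg, neg_neg]

/-! ### Regularity of the kernel -/

/-- Off the light cone of the origin, almost no point of the backward characteristics of `(x, t)`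
lies on that cone. -/
lemma ae_sub_abs_ne {x t : ℝ} (h : t ≠ |x|) : ∀ᵐ y : ℝ, t - |x - y| ≠ |y| := by
  filter_upwards [Measure.ae_ne volume ((t + x) / 2), Measure.ae_ne volume ((x - t) / 2)]
    with y h1 h2 h3
  rcases abs_cases y with ⟨hy, hy'⟩ | ⟨hy, hy'⟩ <;>
    rcases abs_cases (x - y) with ⟨hx, hx'⟩ | ⟨hx, hx'⟩ <;> rw [hy, hx] at h3
  · exact h (by rw [abs_of_nonneg (by linarith)]; linarith)
  · exact h1 (by linarith)
  · exact h2 (by linarith)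
  · exact h (by rw [abs_of_nonpos (by linarith)]; linarith)

lemma measurable_coneCut_of_continuousOn {W : ℝ → ℝ → ℝ}
    (hW : ContinuousOn (fun z : ℝ × ℝ => W z.1 z.2) {z | |z.1| < z.2}) :
    Measurable (fun z : ℝ × ℝ => coneCut W z.1 z.2) := by
  classical
  have := hW.measurable_piecewise (g := fun _ : ℝ × ℝ => (0 : ℝ)) continuousOn_const
    (isOpen_lt continuous_fst.abs continuous_snd).measurableSet
  convert this using 2 with z
  simp [coneCut, Set.piecewise]

lemma continuousAt_coneCut_of_continuousOn {W : ℝ → ℝ → ℝ}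
    (hW : ContinuousOn (fun z : ℝ × ℝ => W z.1 z.2) {z | |z.1| < z.2}) {y s : ℝ} (h : s ≠ |y|) :
    ContinuousAt (fun z : ℝ × ℝ => coneCut W z.1 z.2) (y, s) := by
  rcases lt_or_gt_of_ne h with h | h
  · refine (continuousAt_const (y := (0 : ℝ))).congr ?_
    filter_upwards [(isOpen_lt continuous_snd continuous_fst.abs).mem_nhds
      (show (y, s) ∈ {z : ℝ × ℝ | z.2 < |z.1|} from h)] with z hz
    exact (if_neg (not_lt.2 (le_of_lt hz))).symm
  · have hm := (isOpen_lt continuous_fst.abs continuous_snd).mem_nhds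
      (show (y, s) ∈ {z : ℝ × ℝ | |z.1| < z.2} from h)
    refine (hW.continuousAt hm).congr ?_
    filter_upwards [hm] with z hz
    exact (if_pos hz).symm

lemma abs_rightInt_le {p : ℝ → ℝ} (hp : Integrable p) {H : ℝ → ℝ → ℝ} {x ξ C : ℝ} (hC0 : 0 ≤ C)
    (hC : ∀ y τ, τ ≤ ξ - x → |H y τ| ≤ C) : |rightInt p H x ξ| ≤ (∫ y, |p y|) * C := by
  rw [← integral_mul_const, ← Real.norm_eq_abs, rightInt]
  refine (norm_integral_le_of_norm_le (hp.abs.mul_const C).integrableOn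
    ((ae_restrict_iff' measurableSet_Ioi).2 (ae_of_all _ fun y hy => ?_))).trans
    (setIntegral_le_integral (hp.abs.mul_const C)
      (ae_of_all _ fun y => mul_nonneg (abs_nonneg _) hC0))
  rw [Real.norm_eq_abs, abs_mul]
  exact mul_le_mul_of_nonneg_left (hC _ _ (by linarith [mem_Ioi.1 hy])) (abs_nonneg _)

lemma integral_abs_comp_neg (p : ℝ → ℝ) : ∫ y, |p (-y)| = ∫ y, |p y| :=
  integral_neg_eq_self (fun y => |p y|) volume

lemma abs_leftInt_le {p : ℝ → ℝ} (hp : Integrable p) {H : ℝ → ℝ → ℝ} {x η C : ℝ} (hC0 : 0 ≤ C)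
    (hC : ∀ y τ, τ ≤ η + x → |H y τ| ≤ C) : |leftInt p H x η| ≤ (∫ y, |p y|) * C := by
  rw [leftInt_eq_rightInt, ← integral_abs_comp_neg]
  exact abs_rightInt_le hp.comp_neg hC0 fun y τ hτ => hC _ _ (by linarith)

lemma LipBelowTime.waveInt {p : ℝ → ℝ} (hp : Integrable p) {H : ℝ → ℝ → ℝ} (hH : LipBelowTime H)
    (hc : Continuous (fun z : ℝ × ℝ => H z.1 z.2)) : LipBelowTime (waveInt p H) := by
  refine ⟨⟨(continuous_waveInt hp hH.toBddBelowTime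
    (ae_of_all _ fun y => continuous_slice hc y)).measurable, fun T => ?_⟩, fun T => ?_⟩
  · obtain ⟨C, hC0, hC⟩ := hH.bdd T
    exact ⟨(∫ y, |p y|) * C, mul_nonneg (integral_nonneg fun y => abs_nonneg _) hC0,
      fun y τ hτ => abs_waveInt_le hp fun y' τ' h => hC _ _ (h.trans hτ)⟩
  · obtain ⟨C, hC0, hC⟩ := hH.lip T
    refine ⟨(∫ y, |p y|) * C, mul_nonneg (integral_nonneg fun y => abs_nonneg _) hC0,
      fun x τ τ' hτ hτ' => ?_⟩
    rw [PeriodicWave.waveInt, PeriodicWave.waveInt,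
      ← integral_sub (integrable_waveInt hp hH.toBddBelowTime x τ)
        (integrable_waveInt hp hH.toBddBelowTime x τ'), mul_assoc, ← integral_mul_const,
      ← Real.norm_eq_abs]
    refine norm_integral_le_of_norm_le (hp.abs.mul_const _) (ae_of_all _ fun y => ?_)
    rw [← mul_sub, Real.norm_eq_abs, abs_mul]
    refine mul_le_mul_of_nonneg_left ?_ (abs_nonneg _)
    have := hC y (τ - |x - y|) (τ' - |x - y|) (by linarith [abs_nonneg (x - y)])
      (by linarith [abs_nonneg (x - y)])
    simpa using this

namespace IsKernel

variable {p : ℝ → ℝ} {a b : ℝ} {W : ℝ → ℝ → ℝ}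

lemma primitive_comp_neg (p : ℝ → ℝ) (x : ℝ) :
    primitive (fun y => p (-y)) x = -primitive p (-x) := by
  rw [primitive, primitive, intervalIntegral.integral_comp_neg (fun y => p y), neg_zero,
    intervalIntegral.integral_symm]

/-- The reflected kernel belongs to the reflected potential. -/
lemma reflect (hW : IsKernel p a b W) :
    IsKernel (fun y => p (-y)) (-b) (-a) (fun y => W (-y)) := by
  refine ⟨hW.cont.comp (continuous_fst.neg.prodMk continuous_snd), fun T =>
    (hW.bdd T).imp fun C hC => ⟨hC.1, fun x => hC.2 (-x)⟩, fun x t => ?_⟩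
  rw [hW.eqn, goursatData, goursatData, primitive_comp_neg, primitive_comp_neg]
  have h1 : waveInt p (conePrim W) (-x) t =
      waveInt (fun y => p (-y)) (conePrim fun y => W (-y)) x t := by
    rw [waveInt, waveInt, ← integral_neg_eq_self]
    congr 1
    funext y
    have : |-x - -y| = |x - y| := by rw [← abs_neg]; congr 1; ring
    rw [this, conePrim, conePrim, abs_neg]
  rw [h1, show -((t + x) / 2) = (-x - t) / 2 by ring, show -((x - t) / 2) = (t + -x) / 2 by ring]
  ring

lemma hasFDerivAt_waveInt_conePrim (hW : IsKernel p a b W) (hp : Integrable p) {x t : ℝ}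
    (h : t ≠ |x|) :
    HasFDerivAt (fun z : ℝ × ℝ => waveInt p (conePrim W) z.1 z.2)
      (linForm (rightInt p (coneCut W) x (t + x) - leftInt p (coneCut W) x (t - x))
        (rightInt p (coneCut W) x (t + x) + leftInt p (coneCut W) x (t - x))) (x, t) :=
  hasFDerivAt_waveInt hp hW.lipBelowTime_conePrim (measurable_coneCut hW.cont)
    ((ae_sub_abs_ne h).mono fun _ hy => hW.hasDerivAt_conePrim hy)

/-- The `x`-derivative of the kernel. -/
noncomputable def derivX (p : ℝ → ℝ) (a b : ℝ) (W : ℝ → ℝ → ℝ) (x t : ℝ) : ℝ :=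
  a / 2 * p ((t + x) / 2) + b / 2 * p ((x - t) / 2) -
    1 / 2 * (rightInt p (coneCut W) x (t + x) - leftInt p (coneCut W) x (t - x))

/-- The `t`-derivative of the kernel. -/
noncomputable def derivT (p : ℝ → ℝ) (a b : ℝ) (W : ℝ → ℝ → ℝ) (x t : ℝ) : ℝ :=
  a / 2 * p ((t + x) / 2) - b / 2 * p ((x - t) / 2) -
    1 / 2 * (rightInt p (coneCut W) x (t + x) + leftInt p (coneCut W) x (t - x))

lemma hasFDerivAt (hW : IsKernel p a b W) (hp : Integrable p) {x t : ℝ} (h : t ≠ |x|)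
    (h1 : ContinuousAt p ((t + x) / 2)) (h2 : ContinuousAt p ((x - t) / 2)) :
    HasFDerivAt (fun z : ℝ × ℝ => W z.1 z.2)
      (linForm (derivX p a b W x t) (derivT p a b W x t)) (x, t) := by
  have e : (fun z : ℝ × ℝ => W z.1 z.2) = fun z => goursatData p a b z.1 z.2 -
      1 / 2 * waveInt p (conePrim W) z.1 z.2 := by
    funext z; exact hW.eqn _ _
  have d1 : HasFDerivAt (fun z : ℝ × ℝ => (z.2 + z.1) / 2) (linForm (1 / 2) (1 / 2)) (x, t) := by
    refine ((hasFDerivAt_snd.add hasFDerivAt_fst).mul_const (2 : ℝ)⁻¹).congr_fderiv ?_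
    ext <;> simp
  have d2 : HasFDerivAt (fun z : ℝ × ℝ => (z.1 - z.2) / 2) (linForm (1 / 2) (-1 / 2)) (x, t) := by
    refine ((hasFDerivAt_fst.sub hasFDerivAt_snd).mul_const (2 : ℝ)⁻¹).congr_fderiv ?_
    ext
    · simp
    · simp; norm_num
  have d3 := ((hasDerivAt_primitive hp h1).comp_hasFDerivAt (x, t) d1).const_mul a
  have d4 := ((hasDerivAt_primitive hp h2).comp_hasFDerivAt (x, t) d2).const_mul b
  have d5 := (hW.hasFDerivAt_waveInt_conePrim hp h).const_mul (1 / 2)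
  rw [e]
  refine ((d3.add d4).sub d5).congr_fderiv ?_
  apply ContinuousLinearMap.ext
  intro w
  simp only [sub_apply, add_apply, smul_apply,
    linForm_apply, smul_eq_mul, derivX, derivT]
  ring

lemma continuousAt_rightInt_coneCut (hp : Integrable p) {V : ℝ → ℝ → ℝ}
    (hV : BddBelowTime (coneCut V))
    (hc : ContinuousOn (fun z : ℝ × ℝ => V z.1 z.2) {z | |z.1| < z.2})
    {x ξ : ℝ} (h : ξ - x ≠ |x|) :
    ContinuousAt (fun w : ℝ × ℝ => rightInt p (coneCut V) w.1 w.2) (x, ξ) := by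
  refine continuousAt_rightInt hp hV ((ae_sub_abs_ne h).mono fun y hy hxy => ?_)
  have e : ξ - x - |x - y| = ξ - y := by
    rw [abs_of_neg (sub_neg.2 hxy)]; ring
  rw [e] at hy
  exact ContinuousAt.comp (f := fun s : ℝ => (y, s)) (g := fun z : ℝ × ℝ => coneCut V z.1 z.2)
    (continuousAt_coneCut_of_continuousOn hc hy) (by fun_prop)

lemma continuousAt_leftInt_coneCut (hp : Integrable p) {V : ℝ → ℝ → ℝ}
    (hV : BddBelowTime (coneCut V))
    (hc : ContinuousOn (fun z : ℝ × ℝ => V z.1 z.2) {z | |z.1| < z.2})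
    {x η : ℝ} (h : η + x ≠ |x|) :
    ContinuousAt (fun w : ℝ × ℝ => leftInt p (coneCut V) w.1 w.2) (x, η) := by
  refine continuousAt_leftInt hp hV ((ae_sub_abs_ne h).mono fun y hy hxy => ?_)
  have e : η + x - |x - y| = η + y := by
    rw [abs_of_pos (sub_pos.2 hxy)]; ring
  rw [e] at hy
  exact ContinuousAt.comp (f := fun s : ℝ => (y, s)) (g := fun z : ℝ × ℝ => coneCut V z.1 z.2)
    (continuousAt_coneCut_of_continuousOn hc hy) (by fun_prop)

lemma continuousAt_rightInt' (hW : IsKernel p a b W) (hp : Integrable p) {x t : ℝ} (h : t ≠ |x|) :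
    ContinuousAt (fun z : ℝ × ℝ => rightInt p (coneCut W) z.1 (z.2 + z.1)) (x, t) :=
  ContinuousAt.comp (f := fun z : ℝ × ℝ => (z.1, z.2 + z.1))
    (g := fun z : ℝ × ℝ => rightInt p (coneCut W) z.1 z.2)
    (continuousAt_rightInt_coneCut hp hW.bddBelowTime_coneCut hW.cont.continuousOn (by simpa using h))
    (by fun_prop)

lemma continuousAt_leftInt' (hW : IsKernel p a b W) (hp : Integrable p) {x t : ℝ} (h : t ≠ |x|) :
    ContinuousAt (fun z : ℝ × ℝ => leftInt p (coneCut W) z.1 (z.2 - z.1)) (x, t) :=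
  ContinuousAt.comp (f := fun z : ℝ × ℝ => (z.1, z.2 - z.1))
    (g := fun z : ℝ × ℝ => leftInt p (coneCut W) z.1 z.2)
    (continuousAt_leftInt_coneCut hp hW.bddBelowTime_coneCut hW.cont.continuousOn (by simpa using h))
    (by fun_prop)

/-- The points of the cone whose characteristics meet the two edges of the cone in `O`. -/
def regSet (O : Set ℝ) : Set (ℝ × ℝ) :=
  {z | |z.1| < z.2 ∧ (z.2 + z.1) / 2 ∈ O ∧ (z.1 - z.2) / 2 ∈ O}

lemma isOpen_regSet {O : Set ℝ} (hO : IsOpen O) : IsOpen (regSet O) :=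
  (isOpen_lt continuous_fst.abs continuous_snd).inter
    ((hO.preimage (by fun_prop : Continuous fun z : ℝ × ℝ => (z.2 + z.1) / 2)).inter
      (hO.preimage (by fun_prop : Continuous fun z : ℝ × ℝ => (z.1 - z.2) / 2)))

/-- The kernel is `C¹` wherever the boundary data on the edges of the cone are; singularities of the
potential at the point itself do no harm. -/
lemma contDiffOn_one (hW : IsKernel p a b W) (hp : Integrable p) {O : Set ℝ} (hO : IsOpen O)
    (hpO : ContinuousOn p O) : ContDiffOn ℝ 1 (fun z : ℝ × ℝ => W z.1 z.2) (regSet O) := by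
  have c1 : ContinuousOn (fun z : ℝ × ℝ => p ((z.2 + z.1) / 2)) (regSet O) :=
    hpO.comp (f := fun z : ℝ × ℝ => (z.2 + z.1) / 2) (by fun_prop) fun z hz => hz.2.1
  have c2 : ContinuousOn (fun z : ℝ × ℝ => p ((z.1 - z.2) / 2)) (regSet O) :=
    hpO.comp (f := fun z : ℝ × ℝ => (z.1 - z.2) / 2) (by fun_prop) fun z hz => hz.2.2
  have c3 : ContinuousOn (fun z : ℝ × ℝ => rightInt p (coneCut W) z.1 (z.2 + z.1)) (regSet O) :=
    fun z hz => (hW.continuousAt_rightInt' hp hz.1.ne').continuousWithinAt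
  have c4 : ContinuousOn (fun z : ℝ × ℝ => leftInt p (coneCut W) z.1 (z.2 - z.1)) (regSet O) :=
    fun z hz => (hW.continuousAt_leftInt' hp hz.1.ne').continuousWithinAt
  refine contDiffOn_one_of_hasFDerivAt (isOpen_regSet hO)
    (a := fun z => derivX p a b W z.1 z.2) (b := fun z => derivT p a b W z.1 z.2)
    (fun z hz => hW.hasFDerivAt hp hz.1.ne' (hpO.continuousAt (hO.mem_nhds hz.2.1))
      (hpO.continuousAt (hO.mem_nhds hz.2.2))) ?_ ?_
  · exact ((continuousOn_const.mul c1).add (continuousOn_const.mul c2)).sub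
      (continuousOn_const.mul (c3.sub c4))
  · exact ((continuousOn_const.mul c1).sub (continuousOn_const.mul c2)).sub
      (continuousOn_const.mul (c3.add c4))

/-- The time derivative, inside the cone, of `waveInt p (conePrim W)`. -/
noncomputable def waveDeriv (p : ℝ → ℝ) (W : ℝ → ℝ → ℝ) (x t : ℝ) : ℝ :=
  rightInt p (coneCut W) x (t + x) + leftInt p (coneCut W) x (t - x)

lemma continuousOn_waveDeriv (hW : IsKernel p a b W) (hp : Integrable p) :
    ContinuousOn (fun z : ℝ × ℝ => waveDeriv p W z.1 z.2) {z | |z.1| < z.2} := fun _ hz =>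
  ((hW.continuousAt_rightInt' hp (ne_of_gt hz)).add
    (hW.continuousAt_leftInt' hp (ne_of_gt hz))).continuousWithinAt

lemma bddBelowTime_waveDeriv (hW : IsKernel p a b W) (hp : Integrable p) :
    BddBelowTime (coneCut (waveDeriv p W)) := by
  refine ⟨measurable_coneCut_of_continuousOn (hW.continuousOn_waveDeriv hp), fun T => ?_⟩
  obtain ⟨C, hC0, hC⟩ := hW.bddBelowTime_coneCut.bdd T
  have hN : 0 ≤ (∫ y, |p y|) * C := mul_nonneg (integral_nonneg fun y => abs_nonneg _) hC0
  refine ⟨(∫ y, |p y|) * C + (∫ y, |p y|) * C, by positivity, fun y τ hτ => ?_⟩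
  rw [coneCut]
  split_ifs with h
  · refine (abs_add_le _ _).trans (add_le_add ?_ ?_)
    · exact abs_rightInt_le hp hC0 fun y' τ' h' => hC _ _ (by linarith)
    · exact abs_leftInt_le hp hC0 fun y' τ' h' => hC _ _ (by linarith)
  · rw [abs_zero]; positivity

lemma lipBelowTime_waveInt (hW : IsKernel p a b W) (hp : Integrable p) :
    LipBelowTime (waveInt p (conePrim W)) :=
  hW.lipBelowTime_conePrim.waveInt hp (continuous_conePrim hW.cont)

lemma hasDerivAt_waveInt_time (hW : IsKernel p a b W) (hp : Integrable p) {y τ : ℝ} (h : τ ≠ |y|) :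
    HasDerivAt (waveInt p (conePrim W) y) (coneCut (waveDeriv p W) y τ) τ := by
  rcases lt_or_gt_of_ne h with h' | h'
  · rw [coneCut, if_neg (not_lt.2 h'.le)]
    refine (hasDerivAt_const τ (0 : ℝ)).congr_of_eventuallyEq ?_
    filter_upwards [Iio_mem_nhds h'] with s hs
    exact waveInt_conePrim_eq_zero (le_of_lt hs)
  · rw [coneCut, if_pos h']
    exact HasFDerivAt.partial_snd (hW.hasFDerivAt_waveInt_conePrim hp h)

/-- Inserting the integral equation for `W` into the integral of `p W` along a characteristic. -/
lemma rightInt_coneCut_eq (hW : IsKernel p a b W) (hp : Integrable p) {x ξ : ℝ} (h0 : 0 < ξ)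
    (hx : x < ξ / 2) :
    rightInt p (coneCut W) x ξ =
      a * primitive p (ξ / 2) * (primitive p (ξ / 2) - primitive p x) -
        b * (∫ ζ in x..(ξ / 2), corr p x ζ) -
        1 / 2 * rightInt p (waveInt p (conePrim W)) x ξ := by
  set z := ξ / 2 with hz
  have hP := continuous_primitive hp
  have hi1 : IntervalIntegrable (fun y => a * primitive p z * p y) volume x z :=
    hp.intervalIntegrable.const_mul _
  have hi2 : IntervalIntegrable (fun y => b * (p y * primitive p (y - z))) volume x z :=
    (hp.intervalIntegrable.mul_continuousOn (by fun_prop)).const_mul b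
  have hint : IntegrableOn
      (fun y => a * primitive p z * p y + b * (p y * primitive p (y - z))) (Ioc x z) := by
    rw [← intervalIntegrable_iff_integrableOn_Ioc_of_le hx.le]
    exact hi1.add hi2
  have hD : IntegrableOn (fun y => p y * waveInt p (conePrim W) y (ξ - y)) (Ioi x) :=
    integrableOn_mul_comp hp (hW.lipBelowTime_waveInt hp).toBddBelowTime (by fun_prop)
      measurableSet_Ioi (T := ξ - x) fun y hy => by linarith [mem_Ioi.1 hy]
  have key : ∀ᵐ y : ℝ, y ∈ Ioi x → p y * coneCut W y (ξ - y) =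
      (Ioc x z).indicator (fun y => a * primitive p z * p y + b * (p y * primitive p (y - z))) y -
        1 / 2 * (p y * waveInt p (conePrim W) y (ξ - y)) := by
    filter_upwards [Measure.ae_ne volume z] with y hyz hy
    rcases lt_or_gt_of_ne hyz with h | h
    · have hcone : |y| < ξ - y := abs_lt.2 ⟨by linarith, by linarith⟩
      rw [indicator_of_mem (show y ∈ Ioc x z from ⟨hy, h.le⟩), coneCut, if_pos hcone, hW.eqn,
        goursatData, show (ξ - y + y) / 2 = z by ring, show (y - (ξ - y)) / 2 = y - z by ring]
      ring
    · have hcone : ξ - y ≤ |y| := le_trans (by linarith) (le_abs_self y)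
      rw [indicator_of_notMem (fun h' => not_le.2 h h'.2), coneCut, if_neg (not_lt.2 hcone),
        waveInt_conePrim_eq_zero hcone]
      ring
  rw [rightInt, setIntegral_congr_ae measurableSet_Ioi key, integral_sub
    ((integrable_indicator_iff measurableSet_Ioc).2 hint).integrableOn (hD.const_mul _),
    integral_const_mul, setIntegral_indicator measurableSet_Ioc,
    inter_eq_self_of_subset_right Ioc_subset_Ioi_self, ← intervalIntegral.integral_of_le hx.le,
    intervalIntegral.integral_add hi1 hi2, intervalIntegral.integral_const_mul,
    intervalIntegral.integral_const_mul, integral_mul_primitive hp hx.le, rightInt]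
  have : ∫ y in x..z, p y = primitive p z - primitive p x :=
    (intervalIntegral.integral_interval_sub_left hp.intervalIntegrable hp.intervalIntegrable).symm
  rw [this]
  ring

/-- The derivative in `ξ` of the integral of `p W` along the characteristic `y + s = ξ`. -/
noncomputable def rightDeriv (p : ℝ → ℝ) (a b : ℝ) (W : ℝ → ℝ → ℝ) (x ξ : ℝ) : ℝ :=
  a / 2 * p (ξ / 2) * (primitive p (ξ / 2) - primitive p x) +
    a / 2 * primitive p (ξ / 2) * p (ξ / 2) - b / 2 * corr p x (ξ / 2) -
    1 / 2 * rightInt p (coneCut (waveDeriv p W)) x ξ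

lemma hasDerivAt_rightInt_coneCut_snd (hW : IsKernel p a b W) (hp : Integrable p)
    (hp2 : MemLp p 2) {x ξ : ℝ} (h0 : 0 < ξ) (hx : x < ξ / 2) (hpξ : ContinuousAt p (ξ / 2)) :
    HasDerivAt (fun ζ => rightInt p (coneCut W) x ζ) (rightDeriv p a b W x ξ) ξ := by
  have hcx : Continuous (corr p x) := continuous_slice (continuous_corr hp2) x
  have dz : HasDerivAt (fun ζ : ℝ => ζ / 2) (1 / 2) ξ := (hasDerivAt_id ξ).div_const 2
  have dP : HasDerivAt (fun ζ => primitive p (ζ / 2)) (p (ξ / 2) * (1 / 2)) ξ :=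
    HasDerivAt.comp (h₂ := primitive p) ξ (hasDerivAt_primitive hp hpξ) dz
  have dC : HasDerivAt (fun ζ => ∫ s in x..(ζ / 2), corr p x s) (corr p x (ξ / 2) * (1 / 2)) ξ :=
    HasDerivAt.comp (h₂ := fun u => ∫ s in x..u, corr p x s) ξ
      (intervalIntegral.integral_hasDerivAt_right (hcx.intervalIntegrable _ _)
        (hcx.stronglyMeasurableAtFilter _ _) hcx.continuousAt) dz
  have dD : HasDerivAt (fun ζ => rightInt p (waveInt p (conePrim W)) x ζ)
      (rightInt p (coneCut (waveDeriv p W)) x ξ) ξ := by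
    refine hasDerivAt_rightInt_snd hp (hW.lipBelowTime_waveInt hp)
      (hW.bddBelowTime_waveDeriv hp).meas ?_
    have hne : ξ - x ≠ |x| := (abs_lt.2 ⟨by linarith, by linarith⟩).ne'
    filter_upwards [ae_sub_abs_ne hne] with y hy hxy
    refine hW.hasDerivAt_waveInt_time hp ?_
    rw [abs_of_neg (sub_neg.2 hxy)] at hy
    intro h
    exact hy (by linarith)
  have := (((dP.const_mul a).mul (dP.sub_const (primitive p x))).sub (dC.const_mul b)).sub
    (dD.const_mul (1 / 2))
  refine (this.congr_of_eventuallyEq ?_).congr_deriv ?_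
  · filter_upwards [Ioi_mem_nhds h0, Ioi_mem_nhds (show 2 * x < ξ by linarith)] with ζ h1 h2
    exact hW.rightInt_coneCut_eq hp h1 (by linarith [mem_Ioi.1 h2])
  · rw [rightDeriv]; ring

lemma hasDerivAt_rightInt_coneCut_fst (hW : IsKernel p a b W) (hp : Integrable p) {x ξ : ℝ}
    (h : |x| < ξ - x) (hpx : ContinuousAt p x) :
    HasDerivAt (fun y => rightInt p (coneCut W) y ξ) (-(p x * W x (ξ - x))) x := by
  have := hasDerivAt_rightInt_fst hp hW.bddBelowTime_coneCut (ξ := ξ) hpx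
    (hW.continuousAt_coneCut h.ne')
  rwa [coneCut, if_pos h] at this

lemma isOpen_rightSet {O : Set ℝ} (hO : IsOpen O) :
    IsOpen {z : ℝ × ℝ | z.1 ∈ O ∧ z.2 / 2 ∈ O ∧ |z.1| < z.2 - z.1} :=
  (hO.preimage continuous_fst).inter
    ((hO.preimage (by fun_prop : Continuous fun z : ℝ × ℝ => z.2 / 2)).inter
      (isOpen_lt continuous_fst.abs (continuous_snd.sub continuous_fst)))

lemma isOpen_leftSet {O : Set ℝ} (hO : IsOpen O) :
    IsOpen {z : ℝ × ℝ | z.1 ∈ O ∧ -z.2 / 2 ∈ O ∧ |z.1| < z.2 + z.1} :=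
  (hO.preimage continuous_fst).inter
    ((hO.preimage (by fun_prop : Continuous fun z : ℝ × ℝ => -z.2 / 2)).inter
      (isOpen_lt continuous_fst.abs (continuous_snd.add continuous_fst)))

lemma contDiffOn_rightInt (hW : IsKernel p a b W) (hp : Integrable p) (hp2 : MemLp p 2)
    {O : Set ℝ} (hO : IsOpen O) (hpO : ContinuousOn p O) :
    ContDiffOn ℝ 1 (fun z : ℝ × ℝ => rightInt p (coneCut W) z.1 z.2)
      {z | z.1 ∈ O ∧ z.2 / 2 ∈ O ∧ |z.1| < z.2 - z.1} := by
  have hU : IsOpen {z : ℝ × ℝ | z.1 ∈ O ∧ z.2 / 2 ∈ O ∧ |z.1| < z.2 - z.1} :=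
      isOpen_rightSet hO
  refine contDiffOn_one_of_partials hU (a := fun x ξ => -(p x * W x (ξ - x)))
    (b := rightDeriv p a b W) ?_ ?_ ?_ ?_
  · rintro ⟨x, ξ⟩ ⟨h1, -, h3⟩
    exact hW.hasDerivAt_rightInt_coneCut_fst hp h3 (hpO.continuousAt (hO.mem_nhds h1))
  · rintro ⟨x, ξ⟩ ⟨-, h2, h3⟩
    have h4 := abs_lt.1 h3
    simp only at h4
    exact hW.hasDerivAt_rightInt_coneCut_snd hp hp2 (by linarith) (by linarith)
      (hpO.continuousAt (hO.mem_nhds h2))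
  · have c1 : ContinuousOn (fun z : ℝ × ℝ => p z.1)
        {z | z.1 ∈ O ∧ z.2 / 2 ∈ O ∧ |z.1| < z.2 - z.1} :=
      hpO.comp continuousOn_fst fun z hz => hz.1
    have c2 : Continuous (fun z : ℝ × ℝ => W z.1 (z.2 - z.1)) :=
      hW.cont.comp (by fun_prop : Continuous fun z : ℝ × ℝ => (z.1, z.2 - z.1))
    exact (c1.mul c2.continuousOn).neg
  · have c1 : ContinuousOn (fun z : ℝ × ℝ => p (z.2 / 2))
        {z | z.1 ∈ O ∧ z.2 / 2 ∈ O ∧ |z.1| < z.2 - z.1} :=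
      hpO.comp (f := fun z : ℝ × ℝ => z.2 / 2) (by fun_prop) fun z hz => hz.2.1
    have c2 := continuous_primitive hp
    have c2₁ : Continuous (fun z : ℝ × ℝ => primitive p (z.2 / 2)) := by fun_prop
    have c2₂ : Continuous (fun z : ℝ × ℝ => primitive p z.1) := by fun_prop
    have c3 : Continuous (fun z : ℝ × ℝ => corr p z.1 (z.2 / 2)) :=
      (continuous_corr hp2).comp (by fun_prop : Continuous fun z : ℝ × ℝ => (z.1, z.2 / 2))
    have c4 : ContinuousOn (fun z : ℝ × ℝ => rightInt p (coneCut (waveDeriv p W)) z.1 z.2)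
        {z | z.1 ∈ O ∧ z.2 / 2 ∈ O ∧ |z.1| < z.2 - z.1} := fun z hz =>
      (continuousAt_rightInt_coneCut hp (hW.bddBelowTime_waveDeriv hp)
        (hW.continuousOn_waveDeriv hp) hz.2.2.ne').continuousWithinAt
    exact ((((continuousOn_const.mul c1).mul (c2₁.sub c2₂).continuousOn).add
      ((continuous_const.mul c2₁).continuousOn.mul c1)).sub
      (continuous_const.mul c3).continuousOn).sub (continuousOn_const.mul c4)

lemma hasDerivAt_leftInt_coneCut_fst (hW : IsKernel p a b W) (hp : Integrable p) {x η : ℝ}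
    (h : |x| < η + x) (hpx : ContinuousAt p x) :
    HasDerivAt (fun y => leftInt p (coneCut W) y η) (p x * W x (η + x)) x := by
  have := hasDerivAt_leftInt_fst hp hW.bddBelowTime_coneCut (η := η) hpx
    (hW.continuousAt_coneCut h.ne')
  rwa [coneCut, if_pos h] at this

lemma contDiffOn_leftInt (hW : IsKernel p a b W) (hp : Integrable p) (hp2 : MemLp p 2)
    {O : Set ℝ} (hO : IsOpen O) (hpO : ContinuousOn p O) :
    ContDiffOn ℝ 1 (fun z : ℝ × ℝ => leftInt p (coneCut W) z.1 z.2)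
      {z | z.1 ∈ O ∧ -z.2 / 2 ∈ O ∧ |z.1| < z.2 + z.1} := by
  have hcut : (fun y => coneCut W (-y)) = coneCut fun y => W (-y) := by
    funext y s
    simp [coneCut]
  simp only [leftInt_eq_rightInt, hcut]
  have := hW.reflect.contDiffOn_rightInt hp.comp_neg
    (hp2.comp_measurePreserving (Measure.measurePreserving_neg (volume : Measure ℝ)))
    (O := (fun y => -y) ⁻¹' O) (hO.preimage continuous_neg)
    (hpO.comp continuousOn_neg fun y hy => hy)
  refine this.comp (f := fun z : ℝ × ℝ => (-z.1, z.2)) (by fun_prop) fun z hz => ?_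
  refine ⟨by simpa using hz.1, ?_, by simpa using hz.2.2⟩
  show -(z.2 / 2) ∈ O
  rw [← neg_div]
  exact hz.2.1

/-- The kernel is `C²` where the potential is `C¹` at the point and at the feet of its
characteristics. -/
lemma contDiffOn_two (hW : IsKernel p a b W) (hp : Integrable p) (hp2 : MemLp p 2)
    {O : Set ℝ} (hO : IsOpen O) (hpO : ContDiffOn ℝ 1 p O) :
    ContDiffOn ℝ 2 (fun z : ℝ × ℝ => W z.1 z.2) (regSet O ∩ {z | z.1 ∈ O}) := by
  have c1 : ContDiffOn ℝ 1 (fun z : ℝ × ℝ => p ((z.2 + z.1) / 2)) (regSet O ∩ {z | z.1 ∈ O}) :=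
    hpO.comp (f := fun z : ℝ × ℝ => (z.2 + z.1) / 2) (by fun_prop) fun z hz => hz.1.2.1
  have c2 : ContDiffOn ℝ 1 (fun z : ℝ × ℝ => p ((z.1 - z.2) / 2)) (regSet O ∩ {z | z.1 ∈ O}) :=
    hpO.comp (f := fun z : ℝ × ℝ => (z.1 - z.2) / 2) (by fun_prop) fun z hz => hz.1.2.2
  have c3 : ContDiffOn ℝ 1 (fun z : ℝ × ℝ => rightInt p (coneCut W) z.1 (z.2 + z.1))
      (regSet O ∩ {z | z.1 ∈ O}) :=
    (hW.contDiffOn_rightInt hp hp2 hO hpO.continuousOn).comp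
      (f := fun z : ℝ × ℝ => (z.1, z.2 + z.1)) (by fun_prop)
      fun z hz => ⟨hz.2, hz.1.2.1, by simpa using hz.1.1⟩
  have c4 : ContDiffOn ℝ 1 (fun z : ℝ × ℝ => leftInt p (coneCut W) z.1 (z.2 - z.1))
      (regSet O ∩ {z | z.1 ∈ O}) :=
    (hW.contDiffOn_leftInt hp hp2 hO hpO.continuousOn).comp
      (f := fun z : ℝ × ℝ => (z.1, z.2 - z.1)) (by fun_prop)
      fun z hz => ⟨hz.2, by simpa using hz.1.2.2, by simpa using hz.1.1⟩
  refine contDiffOn_two_of_hasFDerivAt ((isOpen_regSet hO).inter (hO.preimage continuous_fst))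
    (a := fun z => derivX p a b W z.1 z.2) (b := fun z => derivT p a b W z.1 z.2)
    (fun z hz => hW.hasFDerivAt hp hz.1.1.ne'
      (hpO.continuousOn.continuousAt (hO.mem_nhds hz.1.2.1))
      (hpO.continuousOn.continuousAt (hO.mem_nhds hz.1.2.2))) ?_ ?_
  · exact ((contDiffOn_const.mul c1).add (contDiffOn_const.mul c2)).sub
      (contDiffOn_const.mul (c3.sub c4))
  · exact ((contDiffOn_const.mul c1).sub (contDiffOn_const.mul c2)).sub
      (contDiffOn_const.mul (c3.add c4))

/-- The kernel satisfies the wave equation classically where it is `C²`. -/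
lemma waveOp_eq_zero (hW : IsKernel p a b W) (hp : Integrable p) (hp2 : MemLp p 2)
    {O : Set ℝ} (hO : IsOpen O) (hpO : ContDiffOn ℝ 1 p O) {x t : ℝ}
    (hz : (x, t) ∈ regSet O ∩ {z | z.1 ∈ O}) : waveOp p W x t = 0 := by
  have hcone : |x| < t := hz.1.1
  have hxO : x ∈ O := hz.2
  have hcont : ContinuousAt p x := hpO.continuousOn.continuousAt (hO.mem_nhds hxO)
  have hR : HasFDerivAt (fun w : ℝ × ℝ => rightInt p (coneCut W) w.1 w.2)
      (fderiv ℝ (fun w : ℝ × ℝ => rightInt p (coneCut W) w.1 w.2) (x, t + x)) (x, t + x) := by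
    have hmem : (x, t + x) ∈ {z : ℝ × ℝ | z.1 ∈ O ∧ z.2 / 2 ∈ O ∧ |z.1| < z.2 - z.1} :=
      ⟨hxO, hz.1.2.1, by simpa using hcone⟩
    have hU : IsOpen {z : ℝ × ℝ | z.1 ∈ O ∧ z.2 / 2 ∈ O ∧ |z.1| < z.2 - z.1} :=
      isOpen_rightSet hO
    exact (((hW.contDiffOn_rightInt hp hp2 hO hpO.continuousOn).differentiableOn
      one_ne_zero).differentiableAt (hU.mem_nhds hmem)).hasFDerivAt
  have hL : HasFDerivAt (fun w : ℝ × ℝ => leftInt p (coneCut W) w.1 w.2)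
      (fderiv ℝ (fun w : ℝ × ℝ => leftInt p (coneCut W) w.1 w.2) (x, t - x)) (x, t - x) := by
    have hmem : (x, t - x) ∈ {z : ℝ × ℝ | z.1 ∈ O ∧ -z.2 / 2 ∈ O ∧ |z.1| < z.2 + z.1} :=
      ⟨hxO, by simpa using hz.1.2.2, by simpa using hcone⟩
    have hU : IsOpen {z : ℝ × ℝ | z.1 ∈ O ∧ -z.2 / 2 ∈ O ∧ |z.1| < z.2 + z.1} :=
      isOpen_leftSet hO
    exact (((hW.contDiffOn_leftInt hp hp2 hO hpO.continuousOn).differentiableOn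
      one_ne_zero).differentiableAt (hU.mem_nhds hmem)).hasFDerivAt
  set FR := fderiv ℝ (fun w : ℝ × ℝ => rightInt p (coneCut W) w.1 w.2) (x, t + x)
  set FL := fderiv ℝ (fun w : ℝ × ℝ => leftInt p (coneCut W) w.1 w.2) (x, t - x)
  have hR1 : FR (1, 0) = -(p x * W x t) := by
    have h1 := hR.comp_hasDerivAt (f := fun y : ℝ => (y, t + x)) x
      ((hasDerivAt_id x).prodMk (hasDerivAt_const x (t + x)))
    have h2 := hW.hasDerivAt_rightInt_coneCut_fst hp (ξ := t + x) (by simpa using hcone) hcont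
    rw [add_sub_cancel_right] at h2
    exact h1.unique h2
  have hL1 : FL (1, 0) = p x * W x t := by
    have h1 := hL.comp_hasDerivAt (f := fun y : ℝ => (y, t - x)) x
      ((hasDerivAt_id x).prodMk (hasDerivAt_const x (t - x)))
    have h2 := hW.hasDerivAt_leftInt_coneCut_fst hp (η := t - x) (by simpa using hcone) hcont
    rw [sub_add_cancel] at h2
    exact h1.unique h2
  obtain ⟨d₁, hd₁⟩ : ∃ d, HasDerivAt p d ((t + x) / 2) :=
    ⟨_, ((hpO.differentiableOn one_ne_zero).differentiableAt (hO.mem_nhds hz.1.2.1)).hasDerivAt⟩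
  obtain ⟨d₂, hd₂⟩ : ∃ d, HasDerivAt p d ((x - t) / 2) :=
    ⟨_, ((hpO.differentiableOn one_ne_zero).differentiableAt (hO.mem_nhds hz.1.2.2)).hasDerivAt⟩
  have hev : ∀ᶠ z in 𝓝 (x, t), HasFDerivAt (fun z : ℝ × ℝ => W z.1 z.2)
      (linForm (derivX p a b W z.1 z.2) (derivT p a b W z.1 z.2)) z := by
    filter_upwards [(isOpen_regSet hO).mem_nhds hz.1] with z hz
    exact hW.hasFDerivAt hp hz.1.ne' (hpO.continuousOn.continuousAt (hO.mem_nhds hz.2.1))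
      (hpO.continuousOn.continuousAt (hO.mem_nhds hz.2.2))
  have split : ∀ (F : ℝ × ℝ →L[ℝ] ℝ) (u v : ℝ), F (u, v) = u * F (1, 0) + v * F (0, 1) := by
    intro F u v
    have : (u, v) = u • ((1 : ℝ), (0 : ℝ)) + v • ((0 : ℝ), (1 : ℝ)) := by simp
    rw [this, map_add, map_smul, map_smul, smul_eq_mul, smul_eq_mul]
  have ha : HasDerivAt (fun y => derivX p a b W y t) (a / 2 * (d₁ * (1 / 2)) +
      b / 2 * (d₂ * (1 / 2)) - 1 / 2 * (FR (1, 1) - FL (1, -1))) x := by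
    have e1 := (HasDerivAt.comp x hd₁ (((hasDerivAt_id x).const_add t).div_const 2)).const_mul
      (a / 2)
    have e2 := (HasDerivAt.comp x hd₂ (((hasDerivAt_id x).sub_const t).div_const 2)).const_mul
      (b / 2)
    have e3 := hR.comp_hasDerivAt (f := fun y : ℝ => (y, t + y)) x
      ((hasDerivAt_id x).prodMk ((hasDerivAt_id x).const_add t))
    have e4 := hL.comp_hasDerivAt (f := fun y : ℝ => (y, t - y)) x
      ((hasDerivAt_id x).prodMk ((hasDerivAt_id x).const_sub t))
    exact (e1.add e2).sub ((e3.sub e4).const_mul (1 / 2))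
  have hb : HasDerivAt (fun s => derivT p a b W x s) (a / 2 * (d₁ * (1 / 2)) -
      b / 2 * (d₂ * (-1 / 2)) - 1 / 2 * (FR (0, 1) + FL (0, 1))) t := by
    have e1 := (HasDerivAt.comp t hd₁ (((hasDerivAt_id t).add_const x).div_const 2)).const_mul
      (a / 2)
    have e2 := (HasDerivAt.comp t hd₂ (((hasDerivAt_id t).const_sub x).div_const 2)).const_mul
      (b / 2)
    have e3 := hR.comp_hasDerivAt (f := fun s : ℝ => (x, s + x)) t
      ((hasDerivAt_const t x).prodMk ((hasDerivAt_id t).add_const x))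
    have e4 := hL.comp_hasDerivAt (f := fun s : ℝ => (x, s - x)) t
      ((hasDerivAt_const t x).prodMk ((hasDerivAt_id t).sub_const x))
    exact (e1.sub e2).sub ((e3.add e4).const_mul (1 / 2))
  rw [waveOp_eq hev ha hb, split FR 1 1, split FL 1 (-1), hR1, hL1]
  ring

end IsKernel

/-! ### The equation in the sense of distributions -/

/-- The wave operator in terms of the second Fréchet derivative. -/
lemma waveOp_eq_fderiv (q : ℝ → ℝ) {w : ℝ → ℝ → ℝ} {x t : ℝ}
    (h : ContDiffAt ℝ 2 (fun z : ℝ × ℝ => w z.1 z.2) (x, t)) :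
    waveOp q w x t =
      fderiv ℝ (fderiv ℝ (fun z : ℝ × ℝ => w z.1 z.2)) (x, t) (0, 1) (0, 1) -
        fderiv ℝ (fderiv ℝ (fun z : ℝ × ℝ => w z.1 z.2)) (x, t) (1, 0) (1, 0) + q x * w x t := by
  set Φ : ℝ × ℝ → ℝ := fun z => w z.1 z.2
  have h1 : ∀ᶠ z in 𝓝 (x, t), HasFDerivAt Φ (linForm (fderiv ℝ Φ z (1, 0)) (fderiv ℝ Φ z (0, 1))) z := by
    filter_upwards [h.eventually (by simp)] with z hz
    refine (hz.differentiableAt two_ne_zero).hasFDerivAt.congr_fderiv ?_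
    ext <;> simp
  have h2 : HasFDerivAt (fderiv ℝ Φ) (fderiv ℝ (fderiv ℝ Φ) (x, t)) (x, t) :=
    ((h.fderiv_right (m := 1) (by norm_num)).differentiableAt one_ne_zero).hasFDerivAt
  refine waveOp_eq (a := fun x t => fderiv ℝ Φ (x, t) (1, 0))
    (b := fun x t => fderiv ℝ Φ (x, t) (0, 1)) h1 ?_ ?_
  · have := h2.comp_hasDerivAt (f := fun y : ℝ => (y, t)) x
      ((hasDerivAt_id x).prodMk (hasDerivAt_const x t))
    simpa using this.clm_apply (hasDerivAt_const x ((1 : ℝ), (0 : ℝ)))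
  · have := h2.comp_hasDerivAt (f := fun s : ℝ => (x, s)) t
      ((hasDerivAt_const t x).prodMk (hasDerivAt_id t))
    simpa using this.clm_apply (hasDerivAt_const t ((0 : ℝ), (1 : ℝ)))

lemma exists_forall_abs_lt_of_hasCompactSupport {G : ℝ × ℝ → ℝ} (hG : HasCompactSupport G) :
    ∃ R : ℝ, 0 < R ∧ ∀ z, G z ≠ 0 → |z.1| < R ∧ |z.2| < R := by
  obtain ⟨R, hR0, hR⟩ := hG.isCompact.isBounded.subset_ball_lt 0 0
  refine ⟨R, hR0, fun z hz => ?_⟩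
  have := hR (subset_tsupport _ hz)
  rw [mem_ball_zero_iff, Prod.norm_def] at this
  exact ⟨(le_max_left _ _).trans_lt this, (le_max_right _ _).trans_lt this⟩

lemma integrable_mul_of_hasCompactSupport {p : ℝ → ℝ} (hp : Integrable p) {G : ℝ × ℝ → ℝ}
    (hG : Continuous G) (hcs : HasCompactSupport G) : Integrable (fun z : ℝ × ℝ => p z.1 * G z) := by
  obtain ⟨R, hR0, hR⟩ := exists_forall_abs_lt_of_hasCompactSupport hcs
  obtain ⟨C, hC⟩ := hcs.exists_bound_of_continuous hG
  have hind : Integrable ((Icc (-R) R).indicator fun _ : ℝ => C) :=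
    (integrable_indicator_iff measurableSet_Icc).2
      (integrableOn_const (by simp))
  refine (hp.abs.mul_prod hind).mono' (hp.1.comp_fst.mul hG.aestronglyMeasurable)
    (ae_of_all _ fun z => ?_)
  rw [norm_mul, Real.norm_eq_abs]
  refine mul_le_mul_of_nonneg_left ?_ (abs_nonneg _)
  by_cases hz : G z = 0
  · rw [hz, norm_zero]
    exact indicator_nonneg (fun _ _ => (norm_nonneg (G z)).trans (hC z)) _
  · rw [indicator_of_mem (show z.2 ∈ Icc (-R) R from abs_le.1 (hR z hz).2.le)]
    exact hC z

/-- Integration of a compactly supported derivative, off a countable set. -/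
lemma integral_eq_zero_of_hasDerivAt_off_countable {m m' : ℝ → ℝ} {N : Set ℝ} (hN : N.Countable)
    (hm : Continuous m) (hd : ∀ x ∉ N, HasDerivAt m (m' x) x) {R : ℝ} (hR : 0 < R)
    (h0 : ∀ x, R ≤ |x| → m x = 0) (h0' : ∀ x, R ≤ |x| → m' x = 0)
    (hi : IntervalIntegrable m' volume (-R) R) : ∫ x, m' x = 0 := by
  rw [← intervalIntegral.integral_eq_integral_of_support_subset (a := -R) (b := R),
    integral_eq_of_hasDerivAt_off_countable_of_le m m' (by linarith) hN hm.continuousOn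
      (fun x hx => hd x hx.2) hi, h0 R (le_abs_self R), h0 (-R) (by simpa using le_abs_self R),
    sub_zero]
  intro x hx
  have : |x| < R := not_le.1 fun h => hx (h0' x h)
  exact ⟨(abs_lt.1 this).1, (abs_lt.1 this).2.le⟩

lemma measurePreserving_shear {σ : ℝ} (hσ : σ = 1 ∨ σ = -1) :
    MeasurePreserving (fun z : ℝ × ℝ => (z.1, z.2 + σ * z.1)) := by
  rcases hσ with rfl | rfl
  · convert measurePreserving_prod_add (volume : Measure ℝ) (volume : Measure ℝ) using 3 with z
    · ring
    all_goals rfl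
  · convert measurePreserving_prod_neg_add (volume : Measure ℝ) (volume : Measure ℝ) using 3 with z
    · ring
    all_goals rfl

/-- Integration by parts along the characteristics `t + σ x = const`, `σ = ±1`. -/
lemma integral_characteristic_by_parts {p : ℝ → ℝ} (hp : Integrable p) {O : Set ℝ}
    (hO : Oᶜ.Countable) {σ : ℝ} (hσ : σ = 1 ∨ σ = -1) {S g : ℝ → ℝ → ℝ}
    (hS : Continuous (fun z : ℝ × ℝ => S z.1 z.2)) (hg : Continuous (fun z : ℝ × ℝ => g z.1 z.2))
    (hd : ∀ x ∈ O, ∀ ξ, HasDerivAt (fun y => S y ξ) (p x * g x (ξ - σ * x)) x)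
    {ψ : ℝ × ℝ → ℝ} (hψ : ContDiff ℝ 1 ψ) (hcs : HasCompactSupport ψ) :
    ∫ z : ℝ × ℝ, S z.1 (z.2 + σ * z.1) * fderiv ℝ ψ z (-1, σ) =
      ∫ z : ℝ × ℝ, p z.1 * (g z.1 z.2 * ψ z) := by
  have hψ' : Continuous (fderiv ℝ ψ) := hψ.continuous_fderiv one_ne_zero
  have hcs' : HasCompactSupport (fderiv ℝ ψ) := hcs.fderiv ℝ
  have hmp := measurePreserving_shear hσ
  have hemb : MeasurableEmbedding (fun z : ℝ × ℝ => (z.1, z.2 + σ * z.1)) := by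
    refine Continuous.measurableEmbedding (by fun_prop) ?_
    rintro ⟨x, t⟩ ⟨x', t'⟩ h
    simp only [Prod.mk.injEq] at h
    obtain ⟨rfl, h⟩ := h
    simpa using h
  set F : ℝ × ℝ → ℝ := fun z => S z.1 z.2 * fderiv ℝ ψ (z.1, z.2 - σ * z.1) (-1, σ) with hF
  set G : ℝ × ℝ → ℝ := fun z =>
    p z.1 * (g z.1 (z.2 - σ * z.1) * ψ (z.1, z.2 - σ * z.1)) with hG
  have hFs : (fun z : ℝ × ℝ => F (z.1, z.2 + σ * z.1)) =
      fun z => S z.1 (z.2 + σ * z.1) * fderiv ℝ ψ z (-1, σ) := by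
    funext z; simp [hF]
  have hGs : (fun z : ℝ × ℝ => G (z.1, z.2 + σ * z.1)) =
      fun z => p z.1 * (g z.1 z.2 * ψ z) := by
    funext z; simp [hG]
  have hFi : Integrable F := by
    refine (hmp.integrable_comp_emb hemb).1 ?_
    show Integrable fun z : ℝ × ℝ => F (z.1, z.2 + σ * z.1)
    rw [hFs]
    refine Continuous.integrable_of_hasCompactSupport ?_ ?_
    · exact (hS.comp (by fun_prop : Continuous fun z : ℝ × ℝ => (z.1, z.2 + σ * z.1))).mul
        (hψ'.clm_apply continuous_const)
    · refine hcs'.mono fun z hz => ?_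
      rw [Function.mem_support] at hz ⊢
      intro h
      simp [h] at hz
  have hGi : Integrable G := by
    refine (hmp.integrable_comp_emb hemb).1 ?_
    show Integrable fun z : ℝ × ℝ => G (z.1, z.2 + σ * z.1)
    rw [hGs]
    exact integrable_mul_of_hasCompactSupport hp (hg.mul hψ.continuous) hcs.mul_left
  have e1 := hmp.integral_comp hemb F
  have e2 := hmp.integral_comp hemb G
  rw [← hFs, ← hGs, e1, e2, ← sub_eq_zero, ← integral_sub hFi hGi]
  have hFG : Integrable (fun z => F z - G z) := hFi.sub hGi
  rw [Measure.volume_eq_prod] at hFG ⊢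
  rw [integral_prod_symm _ hFG]
  refine integral_eq_zero_of_ae (ae_of_all _ fun ξ => ?_)
  simp only [Pi.zero_apply]
  obtain ⟨R, hR0, hR⟩ := exists_forall_abs_lt_of_hasCompactSupport hcs
  have hz1 : ∀ x, R ≤ |x| → ∀ t, ψ (x, t) = 0 := fun x hx t => by
    by_contra h
    exact not_lt.2 hx (hR _ h).1
  have hz2 : ∀ x, R < |x| → ∀ t, fderiv ℝ ψ (x, t) = 0 := fun x hx t => by
    have : ψ =ᶠ[𝓝 (x, t)] fun _ => 0 := by
      filter_upwards [(isOpen_lt continuous_const continuous_fst.abs).mem_nhds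
        (show (x, t) ∈ {z : ℝ × ℝ | R < |z.1|} from hx)] with z hz
      exact hz1 z.1 (le_of_lt hz) z.2
    rw [this.fderiv_eq]
    simp
  have hcont : Continuous fun x => S x ξ := hS.comp (Continuous.prodMk_left ξ)
  have hψc : Continuous fun x => ψ (x, ξ - σ * x) := hψ.continuous.comp (by fun_prop)
  have hgc : Continuous fun x => g x (ξ - σ * x) :=
    hg.comp (by fun_prop : Continuous fun x : ℝ => (x, ξ - σ * x))
  have hψd : ∀ x, HasDerivAt (fun y => ψ (y, ξ - σ * y))
      (-(fderiv ℝ ψ (x, ξ - σ * x) (-1, σ))) x := fun x => by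
    have h1 : HasDerivAt (fun y : ℝ => (y, ξ - σ * y)) ((1 : ℝ), -σ) x := by
      have := (hasDerivAt_id x).prodMk (((hasDerivAt_id x).const_mul σ).const_sub ξ)
      simpa using this
    have := ((hψ.differentiable one_ne_zero) (x, ξ - σ * x)).hasFDerivAt.comp_hasDerivAt x h1
    rw [← map_neg]
    simpa [Function.comp_def] using this
  have key := integral_eq_zero_of_hasDerivAt_off_countable (m := fun x => S x ξ * ψ (x, ξ - σ * x))
    (m' := fun x => G (x, ξ) - F (x, ξ)) hO (hcont.mul hψc) (fun x hx => ?_) (R := R + 1)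
    (by linarith) (fun x hx => ?_) (fun x hx => ?_) ?_
  · rw [← neg_eq_zero, ← integral_neg]
    simpa using key
  · refine ((hd x (not_not.1 hx) ξ).mul (hψd x)).congr_deriv ?_
    simp only [hF, hG]
    ring
  · rw [hz1 x (by linarith), mul_zero]
  · simp [hF, hG, hz1 x (by linarith), hz2 x (by linarith)]
  · refine IntervalIntegrable.sub ?_ ?_
    · exact hp.intervalIntegrable.mul_continuousOn (hgc.mul hψc).continuousOn
    · have h1 : Continuous fun x => fderiv ℝ ψ (x, ξ - σ * x) (-1, σ) :=
        (hψ'.comp (by fun_prop : Continuous fun x : ℝ => (x, ξ - σ * x))).clm_apply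
          continuous_const
      exact (hcont.mul h1).intervalIntegrable _ _

namespace IsKernel

variable {p : ℝ → ℝ} {a b : ℝ} {W : ℝ → ℝ → ℝ}

/-- The kernel solves the wave equation in the sense of distributions in the cone. -/
theorem weak (hW : IsKernel p a b W) (hp : Integrable p) {O : Set ℝ} (hO : IsOpen O)
    (hOc : Oᶜ.Countable) (hpO : ContinuousOn p O) {φ : ℝ → ℝ → ℝ}
    (hφ : ContDiff ℝ ∞ (fun z : ℝ × ℝ => φ z.1 z.2))
    (hcs : HasCompactSupport (fun z : ℝ × ℝ => φ z.1 z.2))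
    (hsupp : tsupport (fun z : ℝ × ℝ => φ z.1 z.2) ⊆ {z | |z.1| < z.2}) :
    ∫ z : ℝ × ℝ, W z.1 z.2 * waveOp p φ z.1 z.2 = 0 := by
  set Φ : ℝ × ℝ → ℝ := fun z => φ z.1 z.2 with hΦ
  have hK := continuous_conePrim hW.cont
  have hKb := hW.lipBelowTime_conePrim.toBddBelowTime
  have hP := continuous_primitive hp
  have hφ2 : ContDiff ℝ 2 Φ := contDiff_infty.1 hφ 2
  have hf1 : ContDiff ℝ 1 (fderiv ℝ Φ) := hφ2.fderiv_right (by norm_num)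
  have hff : Continuous (fderiv ℝ (fderiv ℝ Φ)) := hf1.continuous_fderiv one_ne_zero
  have hcs1 : HasCompactSupport (fderiv ℝ Φ) := hcs.fderiv ℝ
  have hcs2 : HasCompactSupport (fderiv ℝ (fderiv ℝ Φ)) := hcs1.fderiv ℝ
  have hdir : ∀ v : ℝ × ℝ, ContDiff ℝ 1 (fun z => fderiv ℝ Φ z v) ∧
      HasCompactSupport (fun z => fderiv ℝ Φ z v) ∧
      ∀ z u, fderiv ℝ (fun z => fderiv ℝ Φ z v) z u = fderiv ℝ (fderiv ℝ Φ) z u v := fun v => by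
    refine ⟨hf1.clm_apply contDiff_const, hcs1.mono fun z hz => ?_, fun z u => ?_⟩
    · rw [Function.mem_support] at hz ⊢
      intro h
      simp [h] at hz
    · have h2 := ((hf1.differentiable one_ne_zero) z).hasFDerivAt.clm_apply
        (hasFDerivAt_const v z)
      rw [h2.fderiv]
      simp
  have symm : ∀ z, fderiv ℝ (fderiv ℝ Φ) z (1, 0) (0, 1) = fderiv ℝ (fderiv ℝ Φ) z (0, 1) (1, 0) :=
    fun z => (hφ2.contDiffAt.isSymmSndFDerivAt (by simp)).eq _ _
  set B : ℝ × ℝ → ℝ := fun z => fderiv ℝ (fderiv ℝ Φ) z (0, 1) (0, 1) -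
    fderiv ℝ (fderiv ℝ Φ) z (1, 0) (1, 0) with hB
  have hBc : Continuous B :=
    ((hff.clm_apply continuous_const).clm_apply continuous_const).sub
      ((hff.clm_apply continuous_const).clm_apply continuous_const)
  have hBs : HasCompactSupport B := hcs2.mono fun z hz => by
    rw [Function.mem_support] at hz ⊢
    intro h
    simp [hB, h] at hz
  have hsplit : ∀ F : ℝ × ℝ →L[ℝ] ℝ × ℝ →L[ℝ] ℝ, ∀ s r s' r' : ℝ, F (s, r) (s', r') =
      s * s' * F (1, 0) (1, 0) + s * r' * F (1, 0) (0, 1) + r * s' * F (0, 1) (1, 0) +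
        r * r' * F (0, 1) (0, 1) := by
    intro F s r s' r'
    have e1 : (s, r) = s • ((1 : ℝ), (0 : ℝ)) + r • ((0 : ℝ), (1 : ℝ)) := by simp
    have e2 : (s', r') = s' • ((1 : ℝ), (0 : ℝ)) + r' • ((0 : ℝ), (1 : ℝ)) := by simp
    rw [e1, e2]
    simp only [map_add, map_smul, add_apply, smul_apply, smul_eq_mul]
    ring
  -- `W = S₊(x, t + x) + S₋(x, t - x)`, and `S±` is differentiable along one family of
  -- characteristics.
  set Sp : ℝ → ℝ → ℝ := fun x ξ => a * primitive p (ξ / 2) - 1 / 2 * rightInt p (conePrim W) x ξ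
  set Sm : ℝ → ℝ → ℝ := fun x η => b * primitive p (-η / 2) - 1 / 2 * leftInt p (conePrim W) x η
  have hWS : ∀ z : ℝ × ℝ, W z.1 z.2 = Sp z.1 (z.2 + 1 * z.1) + Sm z.1 (z.2 + -1 * z.1) := fun z => by
    rw [hW.eqn, waveInt_eq_add hp hKb, goursatData]
    simp only [Sp, Sm]
    rw [one_mul, neg_one_mul, ← sub_eq_add_neg, show -(z.2 - z.1) / 2 = (z.1 - z.2) / 2 by ring]
    ring
  have hSpc : Continuous (fun z : ℝ × ℝ => Sp z.1 z.2) := by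
    have h1 : Continuous (fun z : ℝ × ℝ => rightInt p (conePrim W) z.1 z.2) :=
      continuous_iff_continuousAt.2 fun z => continuousAt_rightInt hp hKb
        (ae_of_all _ fun y _ => (continuous_slice hK y).continuousAt)
    show Continuous (fun z : ℝ × ℝ => a * primitive p (z.2 / 2) -
      1 / 2 * rightInt p (conePrim W) z.1 z.2)
    fun_prop
  have hSmc : Continuous (fun z : ℝ × ℝ => Sm z.1 z.2) := by
    have h1 : Continuous (fun z : ℝ × ℝ => leftInt p (conePrim W) z.1 z.2) :=
      continuous_iff_continuousAt.2 fun z => continuousAt_leftInt hp hKb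
        (ae_of_all _ fun y _ => (continuous_slice hK y).continuousAt)
    show Continuous (fun z : ℝ × ℝ => b * primitive p (-z.2 / 2) -
      1 / 2 * leftInt p (conePrim W) z.1 z.2)
    fun_prop
  have hb1 := integral_characteristic_by_parts hp hOc (σ := 1) (Or.inl rfl) hSpc
    (g := fun x t => 1 / 2 * conePrim W x t) (continuous_const.mul hK) (fun x hx ξ => by
      have := (hasDerivAt_rightInt_fst hp hKb (ξ := ξ) (hpO.continuousAt (hO.mem_nhds hx))
        hK.continuousAt).const_mul (1 / 2)
      refine (this.const_sub (a * primitive p (ξ / 2))).congr_deriv ?_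
      rw [one_mul]; ring) (hdir (1, 1)).1 (hdir (1, 1)).2.1
  have hb2 := integral_characteristic_by_parts hp hOc (σ := -1) (Or.inr rfl) hSmc
    (g := fun x t => -1 / 2 * conePrim W x t) (continuous_const.mul hK) (fun x hx η => by
      have := (hasDerivAt_leftInt_fst hp hKb (η := η) (hpO.continuousAt (hO.mem_nhds hx))
        hK.continuousAt).const_mul (1 / 2)
      refine (this.const_sub (b * primitive p (-η / 2))).congr_deriv ?_
      rw [neg_one_mul, sub_neg_eq_add]; ring) (hdir (-1, 1)).1 (hdir (-1, 1)).2.1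
  have hB1 : ∀ z, fderiv ℝ (fun z => fderiv ℝ Φ z (1, 1)) z (-1, 1) = B z := fun z => by
    rw [(hdir (1, 1)).2.2, hsplit, symm]; simp only [hB]; ring
  have hB2 : ∀ z, fderiv ℝ (fun z => fderiv ℝ Φ z (-1, 1)) z (-1, -1) = -B z := fun z => by
    rw [(hdir (-1, 1)).2.2, hsplit, symm]; simp only [hB]; ring
  simp only [hB1] at hb1
  simp only [hB2, mul_neg, integral_neg] at hb2
  have hWΦ : ∀ z : ℝ × ℝ, W z.1 z.2 * Φ z = coneCut W z.1 z.2 * Φ z := fun z => by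
    by_cases hz : Φ z = 0
    · simp [hz]
    · rw [coneCut, if_pos (show |z.1| < z.2 from hsupp (subset_tsupport _ hz))]
  have iS : ∀ {V : ℝ × ℝ → ℝ}, Continuous V → Integrable (fun z => V z * B z) := fun hV =>
    (hV.mul hBc).integrable_of_hasCompactSupport hBs.mul_left
  have iW : Integrable (fun z : ℝ × ℝ => p z.1 * (W z.1 z.2 * Φ z)) :=
    integrable_mul_of_hasCompactSupport hp (hW.cont.mul hφ2.continuous) hcs.mul_left
  have iK : ∀ v, Integrable (fun z : ℝ × ℝ => p z.1 * (conePrim W z.1 z.2 * fderiv ℝ Φ z v)) :=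
    fun v => integrable_mul_of_hasCompactSupport hp (hK.mul (hdir v).1.continuous)
      (hdir v).2.1.mul_left
  have e1 : ∫ z : ℝ × ℝ, W z.1 z.2 * waveOp p φ z.1 z.2 =
      (∫ z : ℝ × ℝ, Sp z.1 (z.2 + 1 * z.1) * B z) + (∫ z : ℝ × ℝ, Sm z.1 (z.2 + -1 * z.1) * B z) +
        ∫ z : ℝ × ℝ, p z.1 * (W z.1 z.2 * Φ z) := by
    have c1 : Continuous fun z : ℝ × ℝ => Sp z.1 (z.2 + 1 * z.1) :=
      hSpc.comp (by fun_prop : Continuous fun z : ℝ × ℝ => (z.1, z.2 + 1 * z.1))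
    have c2 : Continuous fun z : ℝ × ℝ => Sm z.1 (z.2 + -1 * z.1) :=
      hSmc.comp (by fun_prop : Continuous fun z : ℝ × ℝ => (z.1, z.2 + -1 * z.1))
    have c12 : Integrable fun z : ℝ × ℝ =>
        Sp z.1 (z.2 + 1 * z.1) * B z + Sm z.1 (z.2 + -1 * z.1) * B z := (iS c1).add (iS c2)
    rw [← integral_add (iS c1) (iS c2), ← integral_add c12 iW]
    congr 1
    funext z
    rw [waveOp_eq_fderiv p (x := z.1) (t := z.2) hφ2.contDiffAt, ← add_mul, ← hWS]
    simp only [hB, hΦ]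
    ring
  have e2 : (∫ z : ℝ × ℝ, Sp z.1 (z.2 + 1 * z.1) * B z) +
      (∫ z : ℝ × ℝ, Sm z.1 (z.2 + -1 * z.1) * B z) =
      ∫ z : ℝ × ℝ, p z.1 * (conePrim W z.1 z.2 * fderiv ℝ Φ z (0, 1)) := by
    rw [hb1, ← neg_neg (∫ z : ℝ × ℝ, Sm z.1 (z.2 + -1 * z.1) * B z), hb2, ← integral_neg,
      ← integral_add]
    · congr 1
      funext z
      have l1 : fderiv ℝ Φ z (1, 1) = fderiv ℝ Φ z (1, 0) + fderiv ℝ Φ z (0, 1) := by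
        rw [← map_add]; simp
      have l2 : fderiv ℝ Φ z (-1, 1) = -fderiv ℝ Φ z (1, 0) + fderiv ℝ Φ z (0, 1) := by
        rw [← map_neg, ← map_add]; simp
      rw [l1, l2]
      ring
    · refine ((iK (1, 1)).const_mul (1 / 2)).congr (ae_of_all _ fun z => ?_)
      ring
    · refine ((iK (-1, 1)).const_mul (1 / 2)).congr (ae_of_all _ fun z => ?_)
      ring
  rw [e1, e2, ← integral_add (iK _) iW]
  have hint := (iK (0, 1)).add iW
  rw [Measure.volume_eq_prod] at hint ⊢
  refine (integral_prod _ hint).trans (integral_eq_zero_of_ae (ae_of_all _ fun x => ?_))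
  simp only [Pi.zero_apply, Pi.add_apply, ← mul_add]
  rw [integral_const_mul]
  obtain ⟨R, hR0, hR⟩ := exists_forall_abs_lt_of_hasCompactSupport hcs
  have hz1 : ∀ t, R ≤ |t| → Φ (x, t) = 0 := fun t ht => by
    by_contra h
    exact not_lt.2 ht (hR _ h).2
  have hΦd : ∀ t, HasDerivAt (fun s => Φ (x, s)) (fderiv ℝ Φ (x, t) (0, 1)) t := fun t =>
    ((hφ2.differentiable two_ne_zero) (x, t)).hasFDerivAt.comp_hasDerivAt t
      ((hasDerivAt_const t x).prodMk (hasDerivAt_id t))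
  have hz2 : ∀ t, R + 1 ≤ |t| → fderiv ℝ Φ (x, t) (0, 1) = 0 := fun t ht => by
    have : (fun s => Φ (x, s)) =ᶠ[𝓝 t] fun _ => 0 := by
      filter_upwards [(isOpen_lt continuous_const continuous_abs).mem_nhds
        (show t ∈ {s : ℝ | R < |s|} from (by linarith : R < |t|))] with s hs
      exact hz1 s (le_of_lt hs)
    exact (hΦd t).unique ((hasDerivAt_const t (0 : ℝ)).congr_of_eventuallyEq this)
  have hsl : Continuous fun t : ℝ => (x, t) := Continuous.prodMk_right x
  have key := integral_eq_zero_of_hasDerivAt_off_countable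
    (m := fun t => conePrim W x t * Φ (x, t))
    (m' := fun t => conePrim W x t * fderiv ℝ Φ (x, t) (0, 1) + W x t * Φ (x, t))
    (countable_singleton |x|) ((continuous_slice hK x).mul (hφ2.continuous.comp hsl))
    (fun t ht => ?_) (R := R + 1) (by linarith) (fun t ht => ?_) (fun t ht => ?_) ?_
  · simp only [key, mul_zero]
  · refine ((hW.hasDerivAt_conePrim (mem_singleton_iff.not.1 ht)).mul (hΦd t)).congr_deriv ?_
    rw [hWΦ (x, t)]
    ring
  · rw [hz1 t (by linarith), mul_zero]
  · rw [hz1 t (by linarith), hz2 t ht, mul_zero, mul_zero, add_zero]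
  · exact (((continuous_slice hK x).mul ((hdir (0, 1)).1.continuous.comp hsl)).add
      ((continuous_slice hW.cont x).mul (hφ2.continuous.comp hsl))).intervalIntegrable _ _

end IsKernel

/-! ### Causal signals and their convolution with the kernel -/

/-- A smooth signal on the line that vanishes for nonpositive times. -/
structure IsCausal (g : ℝ → ℝ) : Prop where
  smooth : ContDiff ℝ ∞ g
  zero : ∀ s ≤ 0, g s = 0

namespace IsCausal

variable {g : ℝ → ℝ}

lemma hasDerivAt (hg : IsCausal g) (s : ℝ) : HasDerivAt g (deriv g s) s :=
  (hg.smooth.differentiable (by simp)).differentiableAt.hasDerivAt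

lemma continuous (hg : IsCausal g) : Continuous g := hg.smooth.continuous

lemma deriv (hg : IsCausal g) : IsCausal (deriv g) := by
  have hsm : ContDiff ℝ ∞ (_root_.deriv g) := (contDiff_infty_iff_deriv.1 hg.smooth).2
  have hneg : ∀ s < 0, _root_.deriv g s = 0 := fun s hs => by
    have : g =ᶠ[𝓝 s] fun _ => (0 : ℝ) := by
      filter_upwards [Iio_mem_nhds hs] with r hr
      exact hg.zero r (le_of_lt hr)
    rw [this.deriv_eq, deriv_const]
  refine ⟨hsm, fun s hs => ?_⟩
  have hcl : s ∈ closure (Iio (0 : ℝ)) := by simpa using hs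
  exact closure_minimal (s := Iio (0 : ℝ)) (t := {r | _root_.deriv g r = 0}) hneg
    (isClosed_eq hsm.continuous continuous_const) hcl

lemma hasDerivAt_primitive (hg : IsCausal g) (s : ℝ) : HasDerivAt (primitive g) (g s) s :=
  intervalIntegral.integral_hasDerivAt_right (hg.continuous.intervalIntegrable _ _)
    (hg.continuous.stronglyMeasurableAtFilter _ _) hg.continuous.continuousAt

lemma primitive (hg : IsCausal g) : IsCausal (primitive g) := by
  refine ⟨contDiff_infty_iff_deriv.2
    ⟨fun s => (hg.hasDerivAt_primitive s).differentiableAt, ?_⟩, fun s hs => ?_⟩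
  · have : _root_.deriv (PeriodicWave.primitive g) = g :=
      funext fun s => (hg.hasDerivAt_primitive s).deriv
    rw [this]
    exact hg.smooth
  · rw [PeriodicWave.primitive, intervalIntegral.integral_symm,
      intervalIntegral.integral_congr (g := fun _ => (0 : ℝ)), intervalIntegral.integral_zero, neg_zero]
    intro r hr
    rw [uIcc_of_le hs] at hr
    exact hg.zero r hr.2

lemma deriv_primitive (hg : IsCausal g) : _root_.deriv (PeriodicWave.primitive g) = g :=
  funext fun s => (hg.hasDerivAt_primitive s).deriv

lemma exists_bound (hg : IsCausal g) (T : ℝ) : ∃ C : ℝ, 0 ≤ C ∧ ∀ s ≤ T, |g s| ≤ C := by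
  obtain ⟨C, hC⟩ := (isCompact_Icc (a := (0 : ℝ)) (b := T)).exists_bound_of_continuousOn
    hg.continuous.continuousOn
  refine ⟨|C|, abs_nonneg C, fun s hs => ?_⟩
  rcases le_total s 0 with h | h
  · rw [hg.zero s h, abs_zero]
    exact abs_nonneg C
  · exact (hC s ⟨h, hs⟩).trans (le_abs_self C)

end IsCausal

lemma IsSmoothControl.isCausal {f : ℝ → ℝ} (hf : IsSmoothControl f) : IsCausal f :=
  ⟨hf.smooth, fun _ hs => image_eq_zero_of_notMem_tsupport fun h => not_lt.2 hs (hf.supp h)⟩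

/-- The convolution in time of the kernel, cut off to the cone `|x| < t`, with a signal. -/
noncomputable def conv (W : ℝ → ℝ → ℝ) (g : ℝ → ℝ) (x t : ℝ) : ℝ :=
  ∫ s in |x|..(max |x| t), W x s * g (t - s)

section conv

variable {W : ℝ → ℝ → ℝ} {g : ℝ → ℝ}

lemma conv_of_le (W : ℝ → ℝ → ℝ) (g : ℝ → ℝ) {x t : ℝ} (h : t ≤ |x|) : conv W g x t = 0 := by
  rw [conv, max_eq_left h, intervalIntegral.integral_same]

lemma continuous_conv_integrand (hW : Continuous (fun z : ℝ × ℝ => W z.1 z.2)) (hg : Continuous g)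
    (x t : ℝ) : Continuous fun s => W x s * g (t - s) :=
  (continuous_slice hW x).mul (hg.comp (by fun_prop))

/-- The upper limit of the convolution may be moved up, and the cut-off may be dropped. -/
lemma integral_eq_conv (hW : Continuous (fun z : ℝ × ℝ => W z.1 z.2)) (hg : IsCausal g) {x t N : ℝ}
    (h : t ≤ N) : ∫ s in |x|..N, W x s * g (t - s) = conv W g x t := by
  have hz : ∫ s in (max |x| t)..N, W x s * g (t - s) = 0 := by
    rw [intervalIntegral.integral_congr (g := fun _ => (0 : ℝ)), intervalIntegral.integral_zero]
    intro s hs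
    have : t ≤ s := (le_min (le_max_right _ _) h).trans hs.1
    simp [hg.zero (t - s) (by linarith)]
  have hc := continuous_conv_integrand hW hg.continuous x t
  rw [← intervalIntegral.integral_add_adjacent_intervals (hc.intervalIntegrable |x| (max |x| t))
    (hc.intervalIntegrable _ N), hz, add_zero, conv]

lemma continuous_conv (hW : Continuous (fun z : ℝ × ℝ => W z.1 z.2)) (hg : IsCausal g) :
    Continuous (fun z : ℝ × ℝ => conv W g z.1 z.2) := by
  have hc : Continuous (Function.uncurry fun (z : ℝ × ℝ) (s : ℝ) => W z.1 s * g (z.2 - s)) :=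
    (hW.comp ((continuous_fst.comp continuous_fst).prodMk continuous_snd)).mul
      (hg.continuous.comp (by fun_prop))
  have h1 : Continuous fun z : ℝ × ℝ => ∫ s in (0 : ℝ)..(max |z.1| z.2), W z.1 s * g (z.2 - s) :=
    intervalIntegral.continuous_parametric_intervalIntegral_of_continuous hc (by fun_prop)
  have h2 : Continuous fun z : ℝ × ℝ => ∫ s in (0 : ℝ)..|z.1|, W z.1 s * g (z.2 - s) :=
    intervalIntegral.continuous_parametric_intervalIntegral_of_continuous hc (by fun_prop)
  refine (h1.sub h2).congr fun z => ?_
  have hi := continuous_conv_integrand hW hg.continuous z.1 z.2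
  rw [conv]
  exact intervalIntegral.integral_interval_sub_left
    (hi.intervalIntegrable _ _) (hi.intervalIntegrable _ _)

lemma hasDerivAt_conv (hW : Continuous (fun z : ℝ × ℝ => W z.1 z.2)) (hg : IsCausal g) (x t : ℝ) :
    HasDerivAt (conv W g x) (conv W (deriv g) x t) t := by
  obtain ⟨C, hC0, hC⟩ := hg.deriv.exists_bound (t + 1 - (min |x| (t + 1)))
  have key := (intervalIntegral.hasDerivAt_integral_of_dominated_loc_of_deriv_le (μ := volume)
    (a := |x|) (b := t + 1) (F := fun τ s => W x s * g (τ - s))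
    (F' := fun τ s => W x s * deriv g (τ - s)) (x₀ := t) (s := Iio (t + 1))
    (bound := fun s => |W x s| * C) (Iio_mem_nhds (by linarith)) ?_ ?_ ?_ ?_ ?_ ?_).2
  · rw [integral_eq_conv hW hg.deriv (by linarith)] at key
    refine key.congr_of_eventuallyEq ?_
    filter_upwards [Iio_mem_nhds (show t < t + 1 by linarith)] with τ hτ
    exact (integral_eq_conv hW hg (le_of_lt hτ)).symm
  · exact Eventually.of_forall fun τ =>
      (continuous_conv_integrand hW hg.continuous x τ).aestronglyMeasurable
  · exact (continuous_conv_integrand hW hg.continuous x t).intervalIntegrable _ _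
  · exact (continuous_conv_integrand hW hg.deriv.continuous x t).aestronglyMeasurable
  · refine ae_of_all _ fun s hs τ hτ => ?_
    rw [Real.norm_eq_abs, abs_mul]
    refine mul_le_mul_of_nonneg_left (hC _ ?_) (abs_nonneg _)
    have h1 := hs.1
    have h2 := mem_Iio.1 hτ
    linarith
  · exact (((continuous_slice hW x).abs).mul continuous_const).intervalIntegrable _ _
  · refine ae_of_all _ fun s _ τ _ => ?_
    have h1 : HasDerivAt (fun τ => g (τ - s)) (deriv g (τ - s)) τ := by
      simpa using (hg.hasDerivAt (τ - s)).comp_sub_const τ s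
    exact h1.const_mul _

end conv

/-- The profile of the wave that the signal `f` sends out from the origin in both directions,
with a jump there: the free wave plus the convolution with the kernel. -/
noncomputable def field (a b : ℝ) (W : ℝ → ℝ → ℝ) (f : ℝ → ℝ) (y τ : ℝ) : ℝ :=
  -2 * (if 0 < y then a else -b) * f (τ - |y|) + conv W f y τ

lemma field_of_le (a b : ℝ) (W : ℝ → ℝ → ℝ) {f : ℝ → ℝ} (hf : IsCausal f) {y τ : ℝ} (h : τ ≤ |y|) :
    field a b W f y τ = 0 := by
  rw [field, conv_of_le W f h, hf.zero _ (by linarith)]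
  simp

lemma hasDerivAt_field (a b : ℝ) {W : ℝ → ℝ → ℝ} (hW : Continuous (fun z : ℝ × ℝ => W z.1 z.2))
    {f : ℝ → ℝ} (hf : IsCausal f) (y τ : ℝ) :
    HasDerivAt (field a b W f y) (field a b W (deriv f) y τ) τ := by
  have h1 : HasDerivAt (fun τ => f (τ - |y|)) (deriv f (τ - |y|)) τ := by
    simpa using (hf.hasDerivAt (τ - |y|)).comp_sub_const τ |y|
  exact (h1.const_mul _).add (hasDerivAt_conv hW hf y τ)

lemma continuousAt_field (a b : ℝ) {W : ℝ → ℝ → ℝ} (hW : Continuous (fun z : ℝ × ℝ => W z.1 z.2))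
    {f : ℝ → ℝ} (hf : IsCausal f) {z : ℝ × ℝ} (hz : z.1 ≠ 0) :
    ContinuousAt (fun z : ℝ × ℝ => field a b W f z.1 z.2) z := by
  have hk : ContinuousAt (fun w : ℝ × ℝ => if 0 < w.1 then a else -b) z := by
    rcases lt_or_gt_of_ne hz with h | h
    · refine (continuousAt_const (y := -b)).congr ?_
      filter_upwards [(isOpen_lt continuous_fst continuous_const).mem_nhds
        (show z ∈ {w : ℝ × ℝ | w.1 < 0} from h)] with w hw
      exact (if_neg (not_lt.2 (le_of_lt hw))).symm
    · refine (continuousAt_const (y := a)).congr ?_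
      filter_upwards [(isOpen_lt continuous_const continuous_fst).mem_nhds
        (show z ∈ {w : ℝ × ℝ | 0 < w.1} from h)] with w hw
      exact (if_pos hw).symm
  have hf' : Continuous (fun w : ℝ × ℝ => f (w.2 - |w.1|)) := hf.continuous.comp (by fun_prop)
  exact ((continuousAt_const.mul hk).mul hf'.continuousAt).add (continuous_conv hW hf).continuousAt

namespace IsKernel

variable {p : ℝ → ℝ} {a b : ℝ} {W : ℝ → ℝ → ℝ} {f : ℝ → ℝ}

lemma bddBelowTime_conv (hW : IsKernel p a b W) (hf : IsCausal f) : BddBelowTime (conv W f) := by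
  refine ⟨(continuous_conv hW.cont hf).measurable, fun T => ?_⟩
  obtain ⟨C, hC0, hC⟩ := hW.bdd T
  obtain ⟨D, hD0, hD⟩ := hf.exists_bound T
  refine ⟨C * D * |T|, by positivity, fun y τ hτ => ?_⟩
  rcases le_total τ |y| with h | h
  · rw [conv_of_le W f h, abs_zero]
    positivity
  · rw [conv, max_eq_right h, ← Real.norm_eq_abs]
    refine (intervalIntegral.norm_integral_le_of_norm_le_const (C := C * D) fun s hs => ?_).trans ?_
    · rw [uIoc_of_le h] at hs
      have h0 : 0 < s := (abs_nonneg y).trans_lt hs.1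
      rw [Real.norm_eq_abs, abs_mul]
      exact mul_le_mul (hC _ _ (by rw [abs_of_pos h0]; exact hs.2.trans hτ)) (hD _ (by linarith))
        (abs_nonneg _) hC0
    · refine mul_le_mul_of_nonneg_left ?_ (by positivity)
      rw [abs_of_nonneg (sub_nonneg.2 h)]
      linarith [abs_nonneg y, le_abs_self T]

lemma bddBelowTime_field (hW : IsKernel p a b W) (hf : IsCausal f) :
    BddBelowTime (field a b W f) := by
  have hm : Measurable (fun z : ℝ × ℝ => if 0 < z.1 then a else -b) :=
    Measurable.ite (measurableSet_lt measurable_const measurable_fst) measurable_const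
      measurable_const
  have hf' : Measurable (fun w : ℝ × ℝ => f (w.2 - |w.1|)) :=
    (hf.continuous.comp (by fun_prop)).measurable
  refine ⟨((measurable_const.mul hm).mul hf').add (hW.bddBelowTime_conv hf).meas, fun T => ?_⟩
  obtain ⟨C, hC0, hC⟩ := (hW.bddBelowTime_conv hf).bdd T
  obtain ⟨D, hD0, hD⟩ := hf.exists_bound T
  refine ⟨2 * (|a| + |b|) * D + C, by positivity, fun y τ hτ => ?_⟩
  refine (abs_add_le _ _).trans (add_le_add ?_ (hC y τ hτ))
  rw [abs_mul, abs_mul]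
  refine mul_le_mul ?_ (hD _ (by linarith [abs_nonneg y])) (abs_nonneg _) (by positivity)
  have : |(if 0 < y then a else -b)| ≤ |a| + |b| := by
    split_ifs
    · linarith [abs_nonneg b]
    · rw [abs_neg]
      linarith [abs_nonneg a]
  simpa using this

lemma lipBelowTime_field (hW : IsKernel p a b W) (hf : IsCausal f) :
    LipBelowTime (field a b W f) :=
  .of_hasDerivAt (hW.bddBelowTime_field hf) (hW.bddBelowTime_field hf.deriv)
    fun y τ => hasDerivAt_field a b hW.cont hf y τ

/-- The data of the kernel as an integral of the potential over the segment cut out by the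
characteristics. -/
lemma goursatData_eq (hp : Integrable p) (a b : ℝ) {x s : ℝ} (h : |x| < s) :
    goursatData p a b x s =
      ∫ y, p y * (if |y| < s - |x - y| then (if 0 < y then a else -b) else 0) := by
  have hx := abs_lt.1 h
  have e : (fun y => p y * (if |y| < s - |x - y| then (if 0 < y then a else -b) else 0)) =
      (Ioo ((x - s) / 2) ((x + s) / 2)).indicator fun y => p y * (if 0 < y then a else -b) := by
    funext y
    have : |y| < s - |x - y| ↔ y ∈ Ioo ((x - s) / 2) ((x + s) / 2) := by
      rw [mem_Ioo]
      constructor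
      · intro h1
        constructor
        · linarith [neg_abs_le y, le_abs_self (x - y)]
        · linarith [le_abs_self y, neg_abs_le (x - y)]
      · rintro ⟨h1, h2⟩
        rcases abs_cases y with ⟨e1, _⟩ | ⟨e1, _⟩ <;> rcases abs_cases (x - y) with ⟨e2, _⟩ | ⟨e2, _⟩ <;>
          rw [e1, e2] <;> linarith
    by_cases hy : |y| < s - |x - y|
    · rw [if_pos hy, indicator_of_mem (this.1 hy)]
    · rw [if_neg hy, mul_zero, indicator_of_notMem (mt this.2 hy)]
  have hi : Integrable fun y => p y * (if 0 < y then a else -b) := by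
    refine hp.mul_bdd (c := |a| + |b|) (Measurable.ite measurableSet_Ioi measurable_const
      measurable_const).aestronglyMeasurable (ae_of_all _ fun y => ?_)
    rw [Real.norm_eq_abs]
    split_ifs
    · linarith [abs_nonneg b]
    · rw [abs_neg]
      linarith [abs_nonneg a]
  rw [e, integral_indicator measurableSet_Ioo, ← integral_Ioc_eq_integral_Ioo,
    ← intervalIntegral.integral_of_le (by linarith),
    ← intervalIntegral.integral_add_adjacent_intervals (b := 0) hi.intervalIntegrable
      hi.intervalIntegrable, goursatData, primitive, primitive]
  have h1 : ∫ y in ((x - s) / 2)..0, p y * (if 0 < y then a else -b) =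
      ∫ y in ((x - s) / 2)..0, p y * (-b) := by
    refine intervalIntegral.integral_congr fun y hy => ?_
    rw [uIcc_of_le (by linarith)] at hy
    simp only [if_neg (not_lt.2 hy.2)]
  have h2 : ∫ y in (0 : ℝ)..((x + s) / 2), p y * (if 0 < y then a else -b) =
      ∫ y in (0 : ℝ)..((x + s) / 2), p y * a := by
    refine intervalIntegral.integral_congr_ae (ae_of_all _ fun y hy => ?_)
    rw [uIoc_of_le (by linarith)] at hy
    simp only [if_pos hy.1]
  rw [h1, h2, intervalIntegral.integral_mul_const, intervalIntegral.integral_mul_const,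
    intervalIntegral.integral_symm 0 ((x - s) / 2), add_comm s x]
  ring

end IsKernel

/-! ### The waves generated at the vertex -/

/-- Integration by parts in time: the primitive of the kernel against `f` is the kernel against
the primitive of `f`. -/
lemma integral_conePrim_mul {W : ℝ → ℝ → ℝ} (hW : Continuous (fun z : ℝ × ℝ => W z.1 z.2))
    {f : ℝ → ℝ} (hf : IsCausal f) {y τ : ℝ} (h : |y| ≤ τ) :
    ∫ s in |y|..τ, conePrim W y s * f (τ - s) = conv W (primitive f) y τ := by
  have hc := continuous_slice hW y
  have hu : ∀ s ∈ uIcc |y| τ, HasDerivAt (fun s => ∫ r in |y|..s, W y r) (W y s) s := fun s _ =>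
    intervalIntegral.integral_hasDerivAt_right (hc.intervalIntegrable _ _)
      (hc.stronglyMeasurableAtFilter _ _) hc.continuousAt
  have hv : ∀ s ∈ uIcc |y| τ, HasDerivAt (fun s => -primitive f (τ - s)) (f (τ - s)) s := by
    intro s _
    have := ((hf.hasDerivAt_primitive (τ - s)).comp_const_sub τ s).fun_neg
    simpa using this
  have key := intervalIntegral.integral_mul_deriv_eq_deriv_mul hu hv
    (hc.intervalIntegrable _ _) ((hf.continuous.comp (by fun_prop)).intervalIntegrable _ _)
  have e : ∫ s in |y|..τ, conePrim W y s * f (τ - s) =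
      ∫ s in |y|..τ, (∫ r in |y|..s, W y r) * f (τ - s) := by
    refine intervalIntegral.integral_congr fun s hs => ?_
    rw [uIcc_of_le h] at hs
    simp only [conePrim_of_ge W hs.1]
  rw [e, key, conv, max_eq_right h, hf.primitive.zero (τ - τ) (by simp)]
  simp [intervalIntegral.integral_neg]

namespace IsKernel

variable {p : ℝ → ℝ} {a b : ℝ} {W : ℝ → ℝ → ℝ} {f : ℝ → ℝ}

/-- Superposition in time of the integral equation of the kernel: the convolution of the kernel with
`f` is the retarded potential of the density `p · field`. This turns the integral equation for the
kernel into the wave equation for the waves it generates. -/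
lemma conv_eq_waveInt (hW : IsKernel p a b W) (hp : Integrable p) (hf : IsCausal f) (x t : ℝ) :
    conv W f x t = -(1 / 2) * waveInt p (field a b W (primitive f)) x t := by
  rcases le_or_gt t |x| with h | h
  · rw [conv_of_le W f h, waveInt_eq_zero p (fun y τ hτ => field_of_le a b W hf.primitive hτ) h,
      mul_zero]
  set Om : ℝ → ℝ → ℝ := fun y σ =>
    (if |y| < σ then (if 0 < y then a else -b) else 0) - 1 / 2 * conePrim W y σ with hOm
  have hOmB : BddBelowTime Om := by
    refine ⟨?_, fun T => ?_⟩
    · refine Measurable.sub (Measurable.ite (measurableSet_lt (by fun_prop) (by fun_prop))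
        (Measurable.ite (measurableSet_lt measurable_const measurable_fst) measurable_const
          measurable_const) measurable_const)
        ((continuous_conePrim hW.cont).measurable.const_mul _)
    · obtain ⟨C, hC0, hC⟩ := hW.lipBelowTime_conePrim.bdd T
      refine ⟨|a| + |b| + C, by positivity, fun y τ hτ => ?_⟩
      have h1 := hC y τ hτ
      refine (abs_sub _ _).trans (add_le_add ?_ ?_)
      · split_ifs
        · linarith [abs_nonneg b]
        · rw [abs_neg]
          linarith [abs_nonneg a]
        · rw [abs_zero]
          positivity
      · rw [abs_mul, abs_of_pos (by norm_num : (0 : ℝ) < 1 / 2)]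
        linarith [abs_nonneg (conePrim W y τ)]
  have hker : ∀ s, |x| < s → W x s = ∫ y, p y * Om y (s - |x - y|) := by
    intro s hs
    have hi1 : Integrable fun y => p y * Om y (s - |x - y|) := integrable_waveInt hp hOmB x s
    have hi2 : Integrable fun y => p y * conePrim W y (s - |x - y|) :=
      integrable_waveInt hp hW.lipBelowTime_conePrim.toBddBelowTime x s
    rw [hW.eqn, goursatData_eq hp a b hs, waveInt, ← integral_const_mul, ← integral_sub _
      (hi2.const_mul _)]
    · congr 1
      funext y
      simp only [hOm]
      ring
    · refine (hi1.add (hi2.const_mul (1 / 2))).congr (ae_of_all _ fun y => ?_)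
      simp only [hOm, Pi.add_apply]
      ring
  obtain ⟨C, hC0, hC⟩ := hOmB.bdd t
  obtain ⟨D, hD0, hD⟩ := hf.exists_bound (t - |x|)
  have hprod : Integrable (fun z : ℝ × ℝ => f (t - z.1) * (p z.2 * Om z.2 (z.1 - |x - z.2|)))
      ((volume.restrict (Ioc |x| t)).prod volume) := by
    have hpm : AEStronglyMeasurable (fun z : ℝ × ℝ => p z.2)
        ((volume.restrict (Ioc |x| t)).prod volume) := hp.aestronglyMeasurable.comp_snd
    have hfm : Measurable (fun z : ℝ × ℝ => f (t - z.1)) :=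
      (hf.continuous.comp (by fun_prop)).measurable
    have hOmm : Measurable (fun z : ℝ × ℝ => Om z.2 (z.1 - |x - z.2|)) :=
      hOmB.meas.comp (f := fun z : ℝ × ℝ => (z.2, z.1 - |x - z.2|)) (by fun_prop)
    refine Integrable.mono' (g := fun z : ℝ × ℝ => D * (|p z.2| * C)) ?_
      (hfm.aestronglyMeasurable.mul (hpm.mul hOmm.aestronglyMeasurable)) ?_
    · exact Integrable.mul_prod (f := fun _ : ℝ => D) (g := fun y => |p y| * C)
        (integrable_const D) (hp.abs.mul_const C)
    · have hae : ∀ᵐ z ∂((volume.restrict (Ioc |x| t)).prod (volume : Measure ℝ)),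
          z.1 ∈ Ioc |x| t :=
        Measure.quasiMeasurePreserving_fst.ae (ae_restrict_mem measurableSet_Ioc)
      filter_upwards [hae] with z hz
      rw [Real.norm_eq_abs, abs_mul, abs_mul]
      refine mul_le_mul (hD _ (by linarith [hz.1])) (mul_le_mul_of_nonneg_left (hC _ _ ?_)
        (abs_nonneg _)) (by positivity) hD0
      linarith [hz.2, abs_nonneg (x - z.2)]
  have hinner : ∀ y, ∫ s in Ioc |x| t, f (t - s) * (p y * Om y (s - |x - y|)) =
      -(1 / 2) * (p y * field a b W (primitive f) y (t - |x - y|)) := by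
    intro y
    have e1 : ∫ s in Ioc |x| t, f (t - s) * (p y * Om y (s - |x - y|)) =
        p y * ∫ s in |x|..t, f ((t - |x - y|) - (s - |x - y|)) * Om y (s - |x - y|) := by
      rw [intervalIntegral.integral_of_le h.le, ← integral_const_mul]
      congr 1
      funext s
      rw [sub_sub_sub_cancel_right]
      ring
    set τ := t - |x - y| with hτ
    have e2 : ∫ s in |x|..t, f (τ - (s - |x - y|)) * Om y (s - |x - y|) =
        ∫ σ in (|x| - |x - y|)..τ, f (τ - σ) * Om y σ :=
      intervalIntegral.integral_comp_sub_right (fun σ => f (τ - σ) * Om y σ) _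
    have hOm0 : ∀ σ ≤ |y|, Om y σ = 0 := fun σ hσ => by
      simp only [hOm, conePrim_of_le W hσ, if_neg (not_lt.2 hσ)]
      ring
    have hlow : |x| - |x - y| ≤ |y| := by linarith [abs_sub_abs_le_abs_sub x y]
    have e3 : ∫ σ in (|x| - |x - y|)..τ, f (τ - σ) * Om y σ =
        -(1 / 2) * field a b W (primitive f) y τ := by
      rcases le_total τ |y| with hy | hy
      · rw [field_of_le a b W hf.primitive hy, mul_zero,
          intervalIntegral.integral_congr (g := fun _ => (0 : ℝ)), intervalIntegral.integral_zero]
        intro σ hσ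
        rw [uIcc_of_le (by rw [hτ]; linarith)] at hσ
        simp only [hOm0 σ (hσ.2.trans hy), mul_zero]
      · have hfi : Continuous fun σ => f (τ - σ) := hf.continuous.comp (by fun_prop)
        have hcp : Continuous (conePrim W y) := continuous_slice (continuous_conePrim hW.cont) y
        have c1 : IntervalIntegrable (fun σ => f (τ - σ) * Om y σ) volume (|x| - |x - y|) |y| := by
          refine (intervalIntegrable_const (c := (0 : ℝ))).congr fun σ hσ => ?_
          rw [uIoc_of_le hlow] at hσ
          simp only [hOm0 σ hσ.2, mul_zero]
        have e4 : EqOn (fun σ => f (τ - σ) * (if 0 < y then a else -b)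
            - 1 / 2 * (conePrim W y σ * f (τ - σ))) (fun σ => f (τ - σ) * Om y σ) (uIoc |y| τ) := by
          intro σ hσ
          rw [uIoc_of_le hy] at hσ
          simp only [hOm, if_pos hσ.1]
          ring
        have c3 : IntervalIntegrable (fun σ => f (τ - σ) * (if 0 < y then a else -b)) volume |y| τ :=
          (hfi.mul continuous_const).intervalIntegrable _ _
        have c4 : IntervalIntegrable (fun σ => 1 / 2 * (conePrim W y σ * f (τ - σ))) volume |y| τ :=
          (continuous_const.mul (hcp.mul hfi)).intervalIntegrable _ _
        have c2 : IntervalIntegrable (fun σ => f (τ - σ) * Om y σ) volume |y| τ :=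
          (c3.sub c4).congr e4
        have e5 : ∫ σ in (|x| - |x - y|)..|y|, f (τ - σ) * Om y σ = 0 := by
          rw [intervalIntegral.integral_congr (g := fun _ => (0 : ℝ)),
            intervalIntegral.integral_zero]
          intro σ hσ
          rw [uIcc_of_le hlow] at hσ
          simp only [hOm0 σ hσ.2, mul_zero]
        have e6 : ∫ σ in |y|..τ, f (τ - σ) = primitive f (τ - |y|) := by
          rw [intervalIntegral.integral_comp_sub_left (fun σ => f σ) τ, sub_self, primitive]
        rw [← intervalIntegral.integral_add_adjacent_intervals c1 c2, e5, zero_add,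
          ← intervalIntegral.integral_congr_ae (ae_of_all _ e4), intervalIntegral.integral_sub c3 c4,
          intervalIntegral.integral_mul_const, intervalIntegral.integral_const_mul, e6,
          integral_conePrim_mul hW.cont hf hy, field]
        ring
    rw [e1, e2, e3]
    ring
  rw [conv, max_eq_right h.le, intervalIntegral.integral_of_le h.le, waveInt, ← integral_const_mul]
  have e0 : ∫ s in Ioc |x| t, W x s * f (t - s) =
      ∫ s in Ioc |x| t, ∫ y, f (t - s) * (p y * Om y (s - |x - y|)) := by
    refine setIntegral_congr_fun measurableSet_Ioc fun s hs => ?_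
    simp only [integral_const_mul, ← hker s hs.1]
    ring
  rw [e0, integral_integral_swap hprod]
  exact integral_congr_ae (ae_of_all _ hinner)

/-- The convolution of the kernel with a signal is `C¹` in the whole plane, across `x = 0` and
without any continuity of the potential. -/
lemma hasFDerivAt_conv (hW : IsKernel p a b W) (hp : Integrable p) (hf : IsCausal f) (x t : ℝ) :
    HasFDerivAt (fun z : ℝ × ℝ => conv W f z.1 z.2)
      (linForm (-(1 / 2) * (rightInt p (field a b W f) x (t + x)
          - leftInt p (field a b W f) x (t - x)))
        (-(1 / 2) * (rightInt p (field a b W f) x (t + x)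
          + leftInt p (field a b W f) x (t - x)))) (x, t) := by
  have h := hasFDerivAt_waveInt hp (hW.lipBelowTime_field hf.primitive)
    (hW.bddBelowTime_field hf).meas (x := x) (t := t) (ae_of_all _ fun y => by
      have := hasDerivAt_field a b hW.cont hf.primitive y (t - |x - y|)
      rwa [hf.deriv_primitive] at this)
  have h2 := h.const_mul (-(1 / 2) : ℝ)
  have e : (fun z : ℝ × ℝ => conv W f z.1 z.2) =
      fun z : ℝ × ℝ => -(1 / 2) * waveInt p (field a b W (primitive f)) z.1 z.2 :=
    funext fun z => hW.conv_eq_waveInt hp hf z.1 z.2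
  rw [e]
  refine h2.congr_fderiv (ContinuousLinearMap.ext fun v => ?_)
  simp only [smul_apply, smul_eq_mul, linForm_apply]
  ring

lemma continuous_rightInt_field (hW : IsKernel p a b W) (hp : Integrable p) (hf : IsCausal f) :
    Continuous (fun z : ℝ × ℝ => rightInt p (field a b W f) z.1 z.2) :=
  continuous_iff_continuousAt.2 fun _ => continuousAt_rightInt hp (hW.bddBelowTime_field hf)
    (ae_of_all _ fun y _ => (hasDerivAt_field a b hW.cont hf y _).continuousAt)

lemma continuous_leftInt_field (hW : IsKernel p a b W) (hp : Integrable p) (hf : IsCausal f) :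
    Continuous (fun z : ℝ × ℝ => leftInt p (field a b W f) z.1 z.2) :=
  continuous_iff_continuousAt.2 fun _ => continuousAt_leftInt hp (hW.bddBelowTime_field hf)
    (ae_of_all _ fun y _ => (hasDerivAt_field a b hW.cont hf y _).continuousAt)

lemma contDiff_conv (hW : IsKernel p a b W) (hp : Integrable p) (hf : IsCausal f) :
    ContDiff ℝ 1 (fun z : ℝ × ℝ => conv W f z.1 z.2) := by
  have cR : Continuous (fun z : ℝ × ℝ => rightInt p (field a b W f) z.1 (z.2 + z.1)) :=
    (hW.continuous_rightInt_field hp hf).comp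
      (by fun_prop : Continuous fun z : ℝ × ℝ => (z.1, z.2 + z.1))
  have cL : Continuous (fun z : ℝ × ℝ => leftInt p (field a b W f) z.1 (z.2 - z.1)) :=
    (hW.continuous_leftInt_field hp hf).comp
      (by fun_prop : Continuous fun z : ℝ × ℝ => (z.1, z.2 - z.1))
  rw [← contDiffOn_univ]
  exact contDiffOn_one_of_hasFDerivAt isOpen_univ
    (fun z _ => hW.hasFDerivAt_conv hp hf z.1 z.2)
    (continuous_const.mul (cR.sub cL)).continuousOn (continuous_const.mul (cR.add cL)).continuousOn

/-- Away from the jump of the field at `x = 0`, the two parts of the gradient of the convolution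
are differentiable wherever the potential is continuous. -/
lemma hasFDerivAt_rightInt_field (hW : IsKernel p a b W) (hp : Integrable p) (hf : IsCausal f)
    {O : Set ℝ} (hO : IsOpen O) (hpO : ContinuousOn p O) {x ξ : ℝ} (hx : x ∈ O) (h0 : x ≠ 0) :
    HasFDerivAt (fun z : ℝ × ℝ => rightInt p (field a b W f) z.1 z.2)
      (linForm (-(p x * field a b W f x (ξ - x))) (rightInt p (field a b W (deriv f)) x ξ))
      (x, ξ) := by
  have hU : IsOpen {z : ℝ × ℝ | z.1 ∈ O ∧ z.1 ≠ 0} :=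
    (hO.preimage continuous_fst).inter (isOpen_ne_fun continuous_fst continuous_const)
  have hmem : (x, ξ) ∈ {z : ℝ × ℝ | z.1 ∈ O ∧ z.1 ≠ 0} := ⟨hx, h0⟩
  have cf : ∀ z : ℝ × ℝ, z.1 ≠ 0 →
      ContinuousAt (fun z : ℝ × ℝ => field a b W f z.1 (z.2 - z.1)) z := fun z hz =>
    ContinuousAt.comp (f := fun z : ℝ × ℝ => (z.1, z.2 - z.1))
      (g := fun z : ℝ × ℝ => field a b W f z.1 z.2) (continuousAt_field a b hW.cont hf hz)
      (by fun_prop)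
  refine hasFDerivAt_of_partials (z := (x, ξ))
    (a := fun x ξ => -(p x * field a b W f x (ξ - x)))
    (b := fun x ξ => rightInt p (field a b W (deriv f)) x ξ) ?_ ?_ ?_ ?_
  · filter_upwards [hU.mem_nhds hmem] with z hz
    exact hasDerivAt_rightInt_fst hp (hW.bddBelowTime_field hf)
      (hpO.continuousAt (hO.mem_nhds hz.1)) (continuousAt_field a b hW.cont hf hz.2)
  · exact Eventually.of_forall fun z => hasDerivAt_rightInt_snd hp (hW.lipBelowTime_field hf)
      (hW.bddBelowTime_field hf.deriv).meas
      (ae_of_all _ fun y _ => hasDerivAt_field a b hW.cont hf y _)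
  · exact ((ContinuousAt.comp (f := fun z : ℝ × ℝ => z.1) (g := p)
      (hpO.continuousAt (hO.mem_nhds hx)) continuousAt_fst).mul (cf (x, ξ) h0)).neg
  · exact (hW.continuous_rightInt_field hp hf.deriv).continuousAt

lemma hasFDerivAt_leftInt_field (hW : IsKernel p a b W) (hp : Integrable p) (hf : IsCausal f)
    {O : Set ℝ} (hO : IsOpen O) (hpO : ContinuousOn p O) {x η : ℝ} (hx : x ∈ O) (h0 : x ≠ 0) :
    HasFDerivAt (fun z : ℝ × ℝ => leftInt p (field a b W f) z.1 z.2)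
      (linForm (p x * field a b W f x (η + x)) (leftInt p (field a b W (deriv f)) x η))
      (x, η) := by
  have hU : IsOpen {z : ℝ × ℝ | z.1 ∈ O ∧ z.1 ≠ 0} :=
    (hO.preimage continuous_fst).inter (isOpen_ne_fun continuous_fst continuous_const)
  have hmem : (x, η) ∈ {z : ℝ × ℝ | z.1 ∈ O ∧ z.1 ≠ 0} := ⟨hx, h0⟩
  have cf : ∀ z : ℝ × ℝ, z.1 ≠ 0 →
      ContinuousAt (fun z : ℝ × ℝ => field a b W f z.1 (z.2 + z.1)) z := fun z hz =>
    ContinuousAt.comp (f := fun z : ℝ × ℝ => (z.1, z.2 + z.1))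
      (g := fun z : ℝ × ℝ => field a b W f z.1 z.2) (continuousAt_field a b hW.cont hf hz)
      (by fun_prop)
  refine hasFDerivAt_of_partials (z := (x, η))
    (a := fun x η => p x * field a b W f x (η + x))
    (b := fun x η => leftInt p (field a b W (deriv f)) x η) ?_ ?_ ?_ ?_
  · filter_upwards [hU.mem_nhds hmem] with z hz
    exact hasDerivAt_leftInt_fst hp (hW.bddBelowTime_field hf)
      (hpO.continuousAt (hO.mem_nhds hz.1)) (continuousAt_field a b hW.cont hf hz.2)
  · exact Eventually.of_forall fun z => hasDerivAt_leftInt_snd hp (hW.lipBelowTime_field hf)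
      (hW.bddBelowTime_field hf.deriv).meas
      (ae_of_all _ fun y _ => hasDerivAt_field a b hW.cont hf y _)
  · exact (ContinuousAt.comp (f := fun z : ℝ × ℝ => z.1) (g := p)
      (hpO.continuousAt (hO.mem_nhds hx)) continuousAt_fst).mul (cf (x, η) h0)
  · exact (hW.continuous_leftInt_field hp hf.deriv).continuousAt

end IsKernel

namespace IsKernel

variable {p : ℝ → ℝ} {a b : ℝ} {W : ℝ → ℝ → ℝ} {f : ℝ → ℝ}

lemma contDiffOn_conv (hW : IsKernel p a b W) (hp : Integrable p) (hf : IsCausal f)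
    {O : Set ℝ} (hO : IsOpen O) (hpO : ContinuousOn p O) :
    ContDiffOn ℝ 2 (fun z : ℝ × ℝ => conv W f z.1 z.2) {z | z.1 ∈ O ∧ z.1 ≠ 0} := by
  have hU : IsOpen {z : ℝ × ℝ | z.1 ∈ O ∧ z.1 ≠ 0} :=
    (hO.preimage continuous_fst).inter (isOpen_ne_fun continuous_fst continuous_const)
  have cp : ContinuousOn (fun z : ℝ × ℝ => p z.1) {z : ℝ × ℝ | z.1 ∈ O ∧ z.1 ≠ 0} :=
    hpO.comp continuousOn_fst fun z hz => hz.1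
  have cf : ∀ σ : ℝ, ContinuousOn (fun z : ℝ × ℝ => field a b W f z.1 (z.2 + σ * z.1))
      {z : ℝ × ℝ | z.1 ∈ O ∧ z.1 ≠ 0} := fun σ z hz =>
    (ContinuousAt.comp (f := fun z : ℝ × ℝ => (z.1, z.2 + σ * z.1))
      (g := fun z : ℝ × ℝ => field a b W f z.1 z.2) (continuousAt_field a b hW.cont hf hz.2)
      (by fun_prop)).continuousWithinAt
  have cR : ContDiffOn ℝ 1 (fun z : ℝ × ℝ => rightInt p (field a b W f) z.1 (z.2 + z.1))
      {z : ℝ × ℝ | z.1 ∈ O ∧ z.1 ≠ 0} := by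
    refine ContDiffOn.comp (g := fun z : ℝ × ℝ => rightInt p (field a b W f) z.1 z.2)
      (f := fun z : ℝ × ℝ => (z.1, z.2 + z.1)) (contDiffOn_one_of_hasFDerivAt hU
      (fun z hz => hW.hasFDerivAt_rightInt_field hp hf hO hpO hz.1 hz.2) ?_
      (hW.continuous_rightInt_field hp hf.deriv).continuousOn) (by fun_prop) fun z hz => hz
    exact (cp.mul ((cf (-1)).congr fun z _ => by simp [sub_eq_add_neg])).neg
  have cL : ContDiffOn ℝ 1 (fun z : ℝ × ℝ => leftInt p (field a b W f) z.1 (z.2 - z.1))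
      {z : ℝ × ℝ | z.1 ∈ O ∧ z.1 ≠ 0} := by
    refine ContDiffOn.comp (g := fun z : ℝ × ℝ => leftInt p (field a b W f) z.1 z.2)
      (f := fun z : ℝ × ℝ => (z.1, z.2 - z.1)) (contDiffOn_one_of_hasFDerivAt hU
      (fun z hz => hW.hasFDerivAt_leftInt_field hp hf hO hpO hz.1 hz.2) ?_
      (hW.continuous_leftInt_field hp hf.deriv).continuousOn) (by fun_prop) fun z hz => hz
    exact cp.mul ((cf 1).congr fun z _ => by simp)
  exact contDiffOn_two_of_hasFDerivAt hU (fun z _ => hW.hasFDerivAt_conv hp hf z.1 z.2)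
    (contDiffOn_const.mul (cR.sub cL)) (contDiffOn_const.mul (cR.add cL))

/-- The convolution with the kernel solves the wave equation with the source `-p · field`. -/
lemma waveOp_conv (hW : IsKernel p a b W) (hp : Integrable p) (hf : IsCausal f)
    {O : Set ℝ} (hO : IsOpen O) (hpO : ContinuousOn p O) {x : ℝ} (hx : x ∈ O) (h0 : x ≠ 0) (t : ℝ) :
    waveOp p (conv W f) x t = -(p x * field a b W f x t) + p x * conv W f x t := by
  have hR := hW.hasFDerivAt_rightInt_field hp hf hO hpO (ξ := t + x) hx h0
  have hL := hW.hasFDerivAt_leftInt_field hp hf hO hpO (η := t - x) hx h0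
  rw [add_sub_cancel_right] at hR
  rw [sub_add_cancel] at hL
  set r := rightInt p (field a b W (deriv f)) x (t + x)
  set l := leftInt p (field a b W (deriv f)) x (t - x)
  set v := p x * field a b W f x t
  have dRx : HasDerivAt (fun y => rightInt p (field a b W f) y (t + y)) (-v + r) x := by
    have := hR.comp_hasDerivAt (f := fun y : ℝ => (y, t + y)) x
      ((hasDerivAt_id x).prodMk ((hasDerivAt_id x).const_add t))
    simpa [Function.comp_def] using this
  have dLx : HasDerivAt (fun y => leftInt p (field a b W f) y (t - y)) (v - l) x := by
    have := hL.comp_hasDerivAt (f := fun y : ℝ => (y, t - y)) x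
      ((hasDerivAt_id x).prodMk ((hasDerivAt_id x).const_sub t))
    simpa [Function.comp_def, sub_eq_add_neg] using this
  have dRt : HasDerivAt (fun s => rightInt p (field a b W f) x (s + x)) r t := by
    have := hR.comp_hasDerivAt (f := fun s : ℝ => (x, s + x)) t
      ((hasDerivAt_const t x).prodMk ((hasDerivAt_id t).add_const x))
    simpa [Function.comp_def] using this
  have dLt : HasDerivAt (fun s => leftInt p (field a b W f) x (s - x)) l t := by
    have := hL.comp_hasDerivAt (f := fun s : ℝ => (x, s - x)) t
      ((hasDerivAt_const t x).prodMk ((hasDerivAt_id t).sub_const x))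
    simpa [Function.comp_def] using this
  rw [waveOp_eq
    (a := fun x t => -(1 / 2) * (rightInt p (field a b W f) x (t + x)
      - leftInt p (field a b W f) x (t - x)))
    (b := fun x t => -(1 / 2) * (rightInt p (field a b W f) x (t + x)
      + leftInt p (field a b W f) x (t - x)))
    (Eventually.of_forall fun z => hW.hasFDerivAt_conv hp hf z.1 z.2)
    ((dRx.fun_sub dLx).const_mul _) ((dRt.fun_add dLt).const_mul _)]
  ring

end IsKernel

/-! ### Classical solutions of the wave equation near a point -/

/-- `w` is of class `C²` near `(x, t)` and satisfies the wave equation there. -/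
structure SolvesAt (q : ℝ → ℝ) (w : ℝ → ℝ → ℝ) (x t : ℝ) : Prop where
  contDiffAt : ContDiffAt ℝ 2 (fun z : ℝ × ℝ => w z.1 z.2) (x, t)
  waveOp_eq_zero : waveOp q w x t = 0

lemma waveOp_add {q : ℝ → ℝ} {v w : ℝ → ℝ → ℝ} {x t : ℝ}
    (hv : ContDiffAt ℝ 2 (fun z : ℝ × ℝ => v z.1 z.2) (x, t))
    (hw : ContDiffAt ℝ 2 (fun z : ℝ × ℝ => w z.1 z.2) (x, t)) :
    waveOp q (fun x t => v x t + w x t) x t = waveOp q v x t + waveOp q w x t := by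
  have s1 : ∀ {u : ℝ → ℝ → ℝ}, ContDiffAt ℝ 2 (fun z : ℝ × ℝ => u z.1 z.2) (x, t) →
      ContDiffAt ℝ (2 : ℕ) (fun s => u x s) t := fun h =>
    ContDiffAt.comp (f := fun s : ℝ => (x, s)) (g := fun z : ℝ × ℝ => _) t h (by fun_prop)
  have s2 : ∀ {u : ℝ → ℝ → ℝ}, ContDiffAt ℝ 2 (fun z : ℝ × ℝ => u z.1 z.2) (x, t) →
      ContDiffAt ℝ (2 : ℕ) (fun y => u y t) x := fun h =>
    ContDiffAt.comp (f := fun y : ℝ => (y, t)) (g := fun z : ℝ × ℝ => _) x h (by fun_prop)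
  simp only [waveOp]
  rw [iteratedDeriv_fun_add (s1 hv) (s1 hw), iteratedDeriv_fun_add (s2 hv) (s2 hw)]
  ring

namespace SolvesAt

variable {q : ℝ → ℝ} {v w : ℝ → ℝ → ℝ} {x t : ℝ}

lemma add (hv : SolvesAt q v x t) (hw : SolvesAt q w x t) :
    SolvesAt q (fun x t => v x t + w x t) x t :=
  ⟨hv.contDiffAt.add hw.contDiffAt, by
    rw [waveOp_add hv.contDiffAt hw.contDiffAt, hv.waveOp_eq_zero, hw.waveOp_eq_zero, add_zero]⟩

lemma sum {ι : Type*} {s : Finset ι} {u : ι → ℝ → ℝ → ℝ} (h : ∀ i ∈ s, SolvesAt q (u i) x t) :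
    SolvesAt q (fun x t => ∑ i ∈ s, u i x t) x t := by
  classical
  induction s using Finset.induction_on with
  | empty => exact ⟨by simpa using contDiffAt_const, by simp [waveOp]⟩
  | insert i s hi ih =>
    simp only [Finset.sum_insert hi]
    exact (h i (Finset.mem_insert_self i s)).add
      (ih fun j hj => h j (Finset.mem_insert_of_mem hj))

lemma translate {p : ℝ → ℝ} {c d : ℝ} (h : SolvesAt p w (x + c) (t + d)) (hpq : p (x + c) = q x) :
    SolvesAt q (fun x t => w (x + c) (t + d)) x t := by
  refine ⟨ContDiffAt.comp (f := fun z : ℝ × ℝ => (z.1 + c, z.2 + d))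
    (g := fun z : ℝ × ℝ => w z.1 z.2) (x, t) h.contDiffAt (by fun_prop), ?_⟩
  have := h.waveOp_eq_zero
  simp only [waveOp] at this ⊢
  rw [iteratedDeriv_comp_add_const 2 (fun s => w (x + c) s) d,
    iteratedDeriv_comp_add_const 2 (fun y => w y (t + d)) c, ← hpq, this]

end SolvesAt

lemma waveOp_dAlembert {f : ℝ → ℝ} (hf : ContDiff ℝ 2 f) {σ : ℝ} (hσ : σ ^ 2 = 1) (q : ℝ → ℝ)
    (m x t : ℝ) :
    waveOp q (fun x t => m * f (t - σ * x)) x t = q x * (m * f (t - σ * x)) := by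
  have h1 : ∀ s, HasDerivAt f (deriv f s) s := fun s =>
    (hf.differentiable (by simp)).differentiableAt.hasDerivAt
  have h2 : ∀ s, HasDerivAt (deriv f) (deriv (deriv f) s) s := fun s =>
    ((contDiff_succ_iff_deriv (n := 1).1 hf).2.2.differentiable (by simp)).differentiableAt.hasDerivAt
  have hx : ∀ y : ℝ, HasDerivAt (fun y => t - σ * y) (-σ) y := fun y => by
    simpa using ((hasDerivAt_id y).const_mul σ).const_sub t
  have ht : ∀ s : ℝ, HasDerivAt (fun s => s - σ * x) 1 s := fun s =>
    (hasDerivAt_id s).sub_const _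
  have e1 : iteratedDeriv 2 (fun s => m * f (s - σ * x)) t = m * deriv (deriv f) (t - σ * x) :=
    iteratedDeriv_two_eq (g' := fun s => m * deriv f (s - σ * x))
      (Eventually.of_forall fun s => by
        simpa using (HasDerivAt.comp (h₂ := f) s (h1 _) (ht s)).const_mul m)
      (by simpa using (HasDerivAt.comp (h₂ := deriv f) t (h2 _) (ht t)).const_mul m)
  have e2 : iteratedDeriv 2 (fun y => m * f (t - σ * y)) x = m * deriv (deriv f) (t - σ * x) := by
    refine iteratedDeriv_two_eq (g' := fun y => m * (deriv f (t - σ * y) * -σ))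
      (Eventually.of_forall fun y => (HasDerivAt.comp (h₂ := f) y (h1 _) (hx y)).const_mul m) ?_
    have := ((HasDerivAt.comp (h₂ := deriv f) x (h2 _) (hx x)).mul_const (-σ)).const_mul m
    refine this.congr_deriv ?_
    linear_combination m * deriv (deriv f) (t - σ * x) * hσ
  rw [waveOp, e1, e2]
  ring

/-! ### Pairs of waves leaving the vertex to the right and to the left -/

/-- The free wave `m f(t - σ x)` completed by the convolution of `f` with the kernel. -/
noncomputable def outWave (σ m : ℝ) (W : ℝ → ℝ → ℝ) (f : ℝ → ℝ) (x t : ℝ) : ℝ :=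
  m * f (t - σ * x) + conv W f x t

namespace IsKernel

variable {p : ℝ → ℝ} {a b : ℝ} {W : ℝ → ℝ → ℝ} {f : ℝ → ℝ}

lemma contDiff_outWave (hW : IsKernel p a b W) (hp : Integrable p) (hf : IsCausal f) (σ m : ℝ) :
    ContDiff ℝ 1 (fun z : ℝ × ℝ => outWave σ m W f z.1 z.2) :=
  (contDiff_const.mul ((contDiff_infty.1 hf.smooth 1).comp (by fun_prop))).add
    (hW.contDiff_conv hp hf)

lemma solvesAt_outWave (hW : IsKernel p a b W) (hp : Integrable p) (hf : IsCausal f)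
    {O : Set ℝ} (hO : IsOpen O) (hpO : ContinuousOn p O) {σ m x : ℝ} (hσ : σ ^ 2 = 1) (hx : x ∈ O)
    (h0 : x ≠ 0) {t : ℝ} (hfield : field a b W f x t = outWave σ m W f x t) :
    SolvesAt p (outWave σ m W f) x t := by
  have hU : IsOpen {z : ℝ × ℝ | z.1 ∈ O ∧ z.1 ≠ 0} :=
    (hO.preimage continuous_fst).inter (isOpen_ne_fun continuous_fst continuous_const)
  have c1 : ContDiffAt ℝ 2 (fun z : ℝ × ℝ => conv W f z.1 z.2) (x, t) :=
    (hW.contDiffOn_conv hp hf hO hpO).contDiffAt (hU.mem_nhds ⟨hx, h0⟩)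
  have hf2 : ContDiff ℝ 2 f := contDiff_infty.1 hf.smooth 2
  have c2 : ContDiffAt ℝ 2 (fun z : ℝ × ℝ => m * f (z.2 - σ * z.1)) (x, t) :=
    (contDiff_const.mul (hf2.comp (by fun_prop))).contDiffAt
  refine ⟨c2.add c1, ?_⟩
  have e : outWave σ m W f = fun x t => (fun x t => m * f (t - σ * x)) x t + conv W f x t := rfl
  rw [e, waveOp_add (v := fun x t => m * f (t - σ * x)) c2 c1, waveOp_dAlembert hf2 hσ,
    hW.waveOp_conv hp hf hO hpO hx h0, hfield, outWave]
  ring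

end IsKernel

/-- Two waves of class `C¹` in the plane that solve the wave equation for `x > 0` and for `x < 0`,
respectively, at the points of `O`, leave the vertex at time zero, and have the jumps `α` and `β` of
the values and of the `x`-derivatives at `x = 0`. -/
structure WavePair (p : ℝ → ℝ) (O : Set ℝ) (α β : ℝ → ℝ) (R L : ℝ → ℝ → ℝ) : Prop where
  contDiff_right : ContDiff ℝ 1 (fun z : ℝ × ℝ => R z.1 z.2)
  contDiff_left : ContDiff ℝ 1 (fun z : ℝ × ℝ => L z.1 z.2)
  solves_right : ∀ x ∈ O, 0 < x → ∀ t, SolvesAt p R x t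
  solves_left : ∀ x ∈ O, x < 0 → ∀ t, SolvesAt p L x t
  zero_right : ∀ x t, 0 ≤ x → t ≤ x → R x t = 0
  zero_left : ∀ x t, x ≤ 0 → t ≤ -x → L x t = 0
  jump : ∀ t, R 0 t - L 0 t = α t
  jump_deriv : ∀ t, deriv (fun x => R x t) 0 - deriv (fun x => L x t) 0 = β t

lemma differentiableAt_slice {R : ℝ → ℝ → ℝ} (h : ContDiff ℝ 1 (fun z : ℝ × ℝ => R z.1 z.2))
    (x t : ℝ) : DifferentiableAt ℝ (fun x => R x t) x :=
  ((h.comp (by fun_prop : ContDiff ℝ 1 fun x : ℝ => (x, t))).differentiable (by simp)) x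

lemma WavePair.add {p : ℝ → ℝ} {O : Set ℝ} {α β α' β' : ℝ → ℝ} {R L R' L' : ℝ → ℝ → ℝ}
    (h : WavePair p O α β R L) (h' : WavePair p O α' β' R' L') :
    WavePair p O (fun t => α t + α' t) (fun t => β t + β' t) (fun x t => R x t + R' x t)
      (fun x t => L x t + L' x t) where
  contDiff_right := h.contDiff_right.add h'.contDiff_right
  contDiff_left := h.contDiff_left.add h'.contDiff_left
  solves_right x hx h0 t := (h.solves_right x hx h0 t).add (h'.solves_right x hx h0 t)
  solves_left x hx h0 t := (h.solves_left x hx h0 t).add (h'.solves_left x hx h0 t)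
  zero_right x t hx ht := by rw [h.zero_right x t hx ht, h'.zero_right x t hx ht, add_zero]
  zero_left x t hx ht := by rw [h.zero_left x t hx ht, h'.zero_left x t hx ht, add_zero]
  jump t := by rw [← h.jump, ← h'.jump]; ring
  jump_deriv t := by
    rw [deriv_fun_add (differentiableAt_slice h.contDiff_right 0 t)
      (differentiableAt_slice h'.contDiff_right 0 t),
      deriv_fun_add (differentiableAt_slice h.contDiff_left 0 t)
      (differentiableAt_slice h'.contDiff_left 0 t), ← h.jump_deriv, ← h'.jump_deriv]
    ring

/-- The two waves emitted by the vertex. The convolution part has no jump there. -/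
lemma IsKernel.wavePair {p : ℝ → ℝ} {a b : ℝ} {W : ℝ → ℝ → ℝ} {f : ℝ → ℝ}
    (hW : IsKernel p a b W) (hp : Integrable p) (hf : IsCausal f) {O : Set ℝ} (hO : IsOpen O)
    (hpO : ContinuousOn p O) :
    WavePair p O (fun t => (-2 * a - 2 * b) * f t) (fun t => (2 * a - 2 * b) * deriv f t)
      (outWave 1 (-2 * a) W f) (outWave (-1) (2 * b) W f) where
  contDiff_right := hW.contDiff_outWave hp hf _ _
  contDiff_left := hW.contDiff_outWave hp hf _ _
  solves_right x hx h0 t := hW.solvesAt_outWave hp hf hO hpO (by norm_num) hx h0.ne' (by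
    rw [field, outWave, if_pos h0, abs_of_pos h0, one_mul])
  solves_left x hx h0 t := hW.solvesAt_outWave hp hf hO hpO (by norm_num) hx h0.ne (by
    rw [field, outWave, if_neg (not_lt.2 h0.le), abs_of_neg h0]
    ring_nf)
  zero_right x t hx ht := by
    rw [outWave, conv_of_le W f (by rwa [abs_of_nonneg hx]), hf.zero _ (by linarith)]
    simp
  zero_left x t hx ht := by
    rw [outWave, conv_of_le W f (by rwa [abs_of_nonpos hx]), hf.zero _ (by linarith)]
    simp
  jump t := by
    simp only [outWave, mul_zero, sub_zero]
    ring
  jump_deriv t := by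
    have hd := HasFDerivAt.partial_fst (hW.hasFDerivAt_conv hp hf 0 t)
    have hfree : ∀ σ m : ℝ, HasDerivAt (fun x => m * f (t - σ * x)) (m * (deriv f t * -σ)) 0 := by
      intro σ m
      have h1 : HasDerivAt (fun y : ℝ => t - σ * y) (-σ) 0 := by
        simpa using ((hasDerivAt_id (0 : ℝ)).const_mul σ).const_sub t
      have h2 := (HasDerivAt.comp (h₂ := f) (0 : ℝ) (hf.hasDerivAt _) h1).const_mul m
      simpa using h2
    have e : ∀ σ m : ℝ, deriv (fun x => outWave σ m W f x t) 0 = _ := fun σ m =>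
      ((hfree σ m).add hd).deriv
    rw [e, e]
    ring

/-! ### Winding the waves around the interval -/

/-- The sum of the first `n` rightgoing and the first `n` leftgoing pieces of a pair of waves, each
folded back to the interval `[0, 2π]`. -/
noncomputable def waveSum (R L : ℝ → ℝ → ℝ) (n : ℕ) (x t : ℝ) : ℝ :=
  ∑ k ∈ Finset.Icc 1 n, (R (x + 2 * ((k : ℝ) - 1) * π) t + L (x - 2 * (k : ℝ) * π) t)

/-- Consecutive pieces match across the endpoints, so that only the vertex and the far ends
contribute. -/
lemma sum_telescope (r l : ℝ → ℝ) (n : ℕ) :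
    ∑ k ∈ Finset.Icc 1 n, (r (0 + 2 * ((k : ℝ) - 1) * π) + l (0 - 2 * (k : ℝ) * π)) -
      ∑ k ∈ Finset.Icc 1 n, (r (2 * π + 2 * ((k : ℝ) - 1) * π) + l (2 * π - 2 * (k : ℝ) * π)) =
    r 0 - r (2 * n * π) + l (-(2 * n * π)) - l 0 := by
  induction n with
  | zero => simp
  | succ n ih =>
    rw [Finset.sum_Icc_succ_top (by omega), Finset.sum_Icc_succ_top (by omega),
      add_sub_add_comm, ih]
    have e1 : (0 : ℝ) + 2 * (((n + 1 : ℕ) : ℝ) - 1) * π = 2 * n * π := by push_cast; ring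
    have e2 : 2 * π + 2 * (((n + 1 : ℕ) : ℝ) - 1) * π = 2 * (n + 1 : ℕ) * π := by push_cast; ring
    have e3 : (0 : ℝ) - 2 * ((n + 1 : ℕ) : ℝ) * π = -(2 * (n + 1 : ℕ) * π) := by ring
    have e4 : 2 * π - 2 * ((n + 1 : ℕ) : ℝ) * π = -(2 * n * π) := by push_cast; ring
    rw [e1, e2, e3, e4]
    ring

namespace WavePair

variable {p : ℝ → ℝ} {O : Set ℝ} {α β : ℝ → ℝ} {R L : ℝ → ℝ → ℝ}

lemma contDiff_waveSum (h : WavePair p O α β R L) (n : ℕ) :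
    ContDiff ℝ 1 (fun z : ℝ × ℝ => waveSum R L n z.1 z.2) := by
  refine ContDiff.sum fun k _ => ContDiff.add ?_ ?_
  · exact h.contDiff_right.comp
      (by fun_prop : ContDiff ℝ 1 fun z : ℝ × ℝ => (z.1 + 2 * ((k : ℝ) - 1) * π, z.2))
  · exact h.contDiff_left.comp
      (by fun_prop : ContDiff ℝ 1 fun z : ℝ × ℝ => (z.1 - 2 * (k : ℝ) * π, z.2))

lemma waveSum_eq_zero (h : WavePair p O α β R L) (n : ℕ) {x t : ℝ} (hx : x ∈ Icc 0 (2 * π))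
    (h1 : t ≤ x) (h2 : t ≤ 2 * π - x) : waveSum R L n x t = 0 := by
  refine Finset.sum_eq_zero fun k hk => ?_
  have hk1 : (1 : ℝ) ≤ k := by exact_mod_cast (Finset.mem_Icc.1 hk).1
  have h3 : 0 ≤ 2 * ((k : ℝ) - 1) * π :=
    mul_nonneg (mul_nonneg zero_le_two (by linarith)) Real.pi_pos.le
  have h4 : 2 * π ≤ 2 * (k : ℝ) * π := by nlinarith
  rw [h.zero_right _ _ (by linarith [hx.1]) (by linarith),
    h.zero_left _ _ (by linarith [hx.2]) (by linarith), add_zero]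

lemma solvesAt_waveSum (h : WavePair p O α β R L) {q : ℝ → ℝ} (hper : Function.Periodic q (2 * π))
    {n : ℕ} (hpq : ∀ x, |x| < 2 * n * π → p x = q x)
    (hO : ∀ x, |x| < 2 * n * π → (∀ k : ℤ, x ≠ 2 * π * k) → x ∈ O) {x : ℝ}
    (hx : x ∈ Ioo 0 (2 * π)) (t : ℝ) : SolvesAt q (waveSum R L n) x t := by
  have hne : ∀ k m : ℤ, x + 2 * π * k ≠ 2 * π * m := by
    intro k m hkm
    have hp := Real.pi_pos
    have h1 : 0 < 2 * π * ((m : ℝ) - k) := by have := hx.1; linarith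
    have h2 : 2 * π * ((m : ℝ) - k) < 2 * π * 1 := by have := hx.2; linarith
    have h3 : (0 : ℝ) < m - k := pos_of_mul_pos_right h1 (by positivity)
    have h4 : (m : ℝ) - k < 1 := lt_of_mul_lt_mul_left h2 (by positivity)
    have h5 : 0 < m - k := by exact_mod_cast h3
    have h6 : m - k < 1 := by exact_mod_cast h4
    omega
  refine SolvesAt.sum fun k hk => ?_
  have hk1 : (1 : ℝ) ≤ k := by exact_mod_cast (Finset.mem_Icc.1 hk).1
  have hk2 : (k : ℝ) ≤ n := by exact_mod_cast (Finset.mem_Icc.1 hk).2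
  have hπ := Real.pi_pos
  have h3 : 0 ≤ 2 * ((k : ℝ) - 1) * π :=
    mul_nonneg (mul_nonneg zero_le_two (by linarith)) Real.pi_pos.le
  have h4 : 2 * π ≤ 2 * (k : ℝ) * π := by nlinarith
  have h5 : 2 * (k : ℝ) * π ≤ 2 * n * π := by nlinarith
  have hR : |x + 2 * ((k : ℝ) - 1) * π| < 2 * n * π := by
    rw [abs_of_nonneg (by linarith [hx.1])]
    linarith [hx.2]
  have hL : |x - 2 * (k : ℝ) * π| < 2 * n * π := by
    rw [abs_of_nonpos (by linarith [hx.2])]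
    linarith [hx.1]
  have eR : x + 2 * ((k : ℝ) - 1) * π = x + 2 * π * ((k - 1 : ℤ) : ℝ) := by push_cast; ring
  have eL : x - 2 * (k : ℝ) * π = x + 2 * π * ((-k : ℤ) : ℝ) := by push_cast; ring
  have qR : q (x + 2 * ((k : ℝ) - 1) * π) = q x := by
    rw [eR, mul_comm (2 * π)]
    exact hper.int_mul _ x
  have qL : q (x - 2 * (k : ℝ) * π) = q x := by
    rw [eL, mul_comm (2 * π)]
    exact hper.int_mul _ x
  refine SolvesAt.add ?_ ?_
  · have := h.solves_right (x + 2 * ((k : ℝ) - 1) * π)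
      (hO _ hR fun m => by rw [eR]; exact hne _ m) (by linarith [hx.1]) (t + 0)
    simpa using this.translate ((hpq _ hR).trans qR)
  · have := h.solves_left (x + -(2 * (k : ℝ) * π))
      (hO _ hL fun m => by rw [← sub_eq_add_neg, eL]; exact hne _ m) (by linarith [hx.2]) (t + 0)
    simpa [sub_eq_add_neg] using this.translate ((hpq _ hL).trans qL)

lemma deriv_waveSum (h : WavePair p O α β R L) (n : ℕ) (x t : ℝ) :
    deriv (fun x => waveSum R L n x t) x =
      ∑ k ∈ Finset.Icc 1 n, (deriv (fun x => R x t) (x + 2 * ((k : ℝ) - 1) * π) +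
        deriv (fun x => L x t) (x - 2 * (k : ℝ) * π)) := by
  refine HasDerivAt.deriv (HasDerivAt.fun_sum fun k _ => HasDerivAt.add ?_ ?_)
  · exact HasDerivAt.comp_add_const x _ (differentiableAt_slice h.contDiff_right _ t).hasDerivAt
  · exact HasDerivAt.comp_sub_const x _ (differentiableAt_slice h.contDiff_left _ t).hasDerivAt

/-- As long as the waves have not wound around the interval `n` times, their sum over the first `n`
windings solves the boundary value problem. -/
theorem isSolution_waveSum {f₁ f₂ : ℝ → ℝ} (h : WavePair p O f₁ (deriv f₂) R L) {q : ℝ → ℝ}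
    (hper : Function.Periodic q (2 * π)) {n : ℕ} (hpq : ∀ x, |x| < 2 * n * π → p x = q x)
    (hO : ∀ x, |x| < 2 * n * π → (∀ k : ℤ, x ≠ 2 * π * k) → x ∈ O) {T : ℝ}
    (hT : T ≤ 2 * n * π) : IsSolution q f₁ f₂ T (waveSum R L n) where
  c2 z hz := (h.solvesAt_waveSum hper hpq hO hz.1 z.2).contDiffAt.contDiffWithinAt
  c1 := (h.contDiff_waveSum n).contDiffOn
  pde x hx t _ := (h.solvesAt_waveSum hper hpq hO hx t).waveOp_eq_zero
  boundary t ht := by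
    have hs : ContDiff ℝ 1 (fun x => waveSum R L n x t) :=
      (h.contDiff_waveSum n).comp (by fun_prop : ContDiff ℝ 1 fun x : ℝ => (x, t))
    have hc := hs.continuous
    have hd := hs.continuous_deriv (by simp)
    have hlt : t < 2 * n * π := ht.2.trans_le hT
    have hnn : (0 : ℝ) ≤ 2 * n * π := by positivity
    refine ⟨_, _, _, _, hc.continuousWithinAt, hc.continuousWithinAt, hd.continuousWithinAt,
      hd.continuousWithinAt, ?_, ?_⟩
    · have := sum_telescope (fun x => R x t) (fun x => L x t) n
      simp only [waveSum]
      rw [this, h.zero_right _ _ hnn hlt.le, h.zero_left _ _ (by linarith) (by linarith), sub_zero,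
        add_zero, h.jump]
    · have := sum_telescope (deriv fun x => R x t) (deriv fun x => L x t) n
      rw [h.deriv_waveSum, h.deriv_waveSum, this]
      have z1 : deriv (fun x => R x t) (2 * n * π) = 0 := by
        have : (fun x => R x t) =ᶠ[𝓝 (2 * n * π)] fun _ => 0 := by
          filter_upwards [Ioi_mem_nhds hlt] with x hx
          exact h.zero_right _ _ (ht.1.le.trans (le_of_lt hx)) (le_of_lt hx)
        rw [this.deriv_eq, deriv_const]
      have z2 : deriv (fun x => L x t) (-(2 * n * π)) = 0 := by
        have : (fun x => L x t) =ᶠ[𝓝 (-(2 * n * π))] fun _ => 0 := by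
          filter_upwards [Iio_mem_nhds (neg_lt_neg hlt)] with x hx
          have := mem_Iio.1 hx
          exact h.zero_left _ _ (by linarith [ht.1]) (by linarith)
        rw [this.deriv_eq, deriv_const]
      rw [z1, z2, sub_zero, add_zero, h.jump_deriv]
  initial x hx := by
    have hz : ∀ t ≤ min x (2 * π - x), waveSum R L n x t = 0 := fun t ht =>
      h.waveSum_eq_zero n ⟨hx.1.le, hx.2.le⟩ (ht.trans (min_le_left _ _))
        (ht.trans (min_le_right _ _))
    have hpos : 0 < min x (2 * π - x) := lt_min hx.1 (by linarith [hx.2])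
    refine ⟨hz 0 hpos.le, HasDerivAt.hasDerivWithinAt ?_⟩
    refine (hasDerivAt_const (0 : ℝ) (0 : ℝ)).congr_of_eventuallyEq ?_
    filter_upwards [Iio_mem_nhds hpos] with t ht
    exact hz t (le_of_lt ht)

end WavePair

/-! ### Uniqueness of the solution -/

/-- Transport along the characteristics `x + t = const` in a strip of width `ℓ` with periodic
boundary values: a function that starts from zero and has the derivative `q d` along the
characteristics is controlled by a bound for `d` at earlier times. -/
lemma abs_le_of_hasDerivAt_characteristic {q : ℝ → ℝ} {d P : ℝ → ℝ → ℝ} {l T : ℝ} (hl : 0 < l)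
    (hq : IntegrableOn q (Ioo 0 l))
    (hP : ContinuousOn (fun z : ℝ × ℝ => P z.1 z.2) (Icc 0 l ×ˢ Ico 0 T))
    (hd : ContinuousOn (fun z : ℝ × ℝ => d z.1 z.2) (Icc 0 l ×ˢ Ico 0 T))
    (h0 : ∀ x ∈ Icc 0 l, P x 0 = 0) (hper : ∀ t ∈ Ioo 0 T, P 0 t = P l t)
    (hchar : ∀ x ∈ Ioo 0 l, ∀ t ∈ Ioo 0 T,
      HasDerivAt (fun σ => P (x + σ) (t - σ)) (q x * d x t) 0)
    {n : ℕ} {x t B : ℝ} (hx : x ∈ Icc 0 l) (ht : t ∈ Ico 0 T) (htn : t ≤ n * l) (hB : 0 ≤ B)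
    (hdB : ∀ y ∈ Ioo 0 l, ∀ s ∈ Icc 0 t, |d y s| ≤ B) :
    |P x t| ≤ (n + 1) * ((∫ y in Ioo 0 l, |q y|) * B) := by
  set Q := ∫ y in Ioo 0 l, |q y| with hQ
  have hQ0 : 0 ≤ Q := integral_nonneg fun _ => abs_nonneg _
  have hQB : 0 ≤ Q * B := mul_nonneg hQ0 hB
  have step : ∀ x ∈ Icc 0 l, ∀ s ∈ Icc 0 t, ∀ m ≥ 0, m ≤ s → x + m ≤ l →
      |P x s| ≤ |P (x + m) (s - m)| + Q * B := by
    intro x hx s hs m hm hms hml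
    have hmaps : ∀ σ ∈ Icc 0 m, (x + σ, s - σ) ∈ Icc 0 l ×ˢ Ico 0 T := fun σ hσ =>
      ⟨⟨by linarith [hx.1, hσ.1], by linarith [hσ.2]⟩, by linarith [hσ.2],
        by linarith [hσ.1, hs.2, ht.2]⟩
    have hpath : ContinuousOn (fun σ : ℝ => (x + σ, s - σ)) (Icc 0 m) := by fun_prop
    have hcont : ContinuousOn (fun σ => P (x + σ) (s - σ)) (Icc 0 m) :=
      hP.comp (f := fun σ : ℝ => (x + σ, s - σ)) hpath hmaps
    have hcont' : ContinuousOn (fun σ => d (x + σ) (s - σ)) (Icc 0 m) :=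
      hd.comp (f := fun σ : ℝ => (x + σ, s - σ)) hpath hmaps
    have hq' : IntegrableOn (fun σ => q (x + σ)) (Ioo 0 m) := by
      have h1 : IntegrableOn q (Ioo (x + 0) (x + m)) :=
        hq.mono_set (Ioo_subset_Ioo (by linarith [hx.1]) hml)
      have h2 := ((measurePreserving_add_left (volume : Measure ℝ) x).integrableOn_comp_preimage
        (measurableEmbedding_addLeft x)).2 h1
      simpa [Function.comp_def] using h2
    have hint : IntegrableOn (fun σ => q (x + σ) * d (x + σ) (s - σ)) (Ioo 0 m) := by
      refine Integrable.mono' (g := fun σ => |q (x + σ)| * B) (hq'.abs.mul_const B)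
        (hq'.aestronglyMeasurable.mul ((hcont'.mono Ioo_subset_Icc_self).aestronglyMeasurable
          measurableSet_Ioo)) ?_
      refine (ae_restrict_iff' measurableSet_Ioo).2 (ae_of_all _ fun σ hσ => ?_)
      rw [Real.norm_eq_abs, abs_mul]
      exact mul_le_mul_of_nonneg_left (hdB _ ⟨by linarith [hx.1, hσ.1], by linarith [hσ.2]⟩ _
        ⟨by linarith [hσ.2], by linarith [hσ.1, hs.2]⟩) (abs_nonneg _)
    have key := intervalIntegral.integral_eq_sub_of_hasDerivAt_of_le hm hcont
      (f' := fun σ => q (x + σ) * d (x + σ) (s - σ)) (fun σ hσ => by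
        have h1 := hchar (x + σ) ⟨by linarith [hx.1, hσ.1], by linarith [hσ.2]⟩ (s - σ)
          ⟨by linarith [hσ.2], by linarith [hσ.1, hs.2, ht.2]⟩
        rw [← sub_self σ] at h1
        have h2 := HasDerivAt.comp_sub_const σ σ h1
        simpa using h2)
      ((intervalIntegrable_iff_integrableOn_Ioo_of_le hm).2 hint)
    have hbound : |∫ σ in (0 : ℝ)..m, q (x + σ) * d (x + σ) (s - σ)| ≤ Q * B := by
      rw [intervalIntegral.integral_of_le hm, integral_Ioc_eq_integral_Ioo]
      have h1 : |∫ σ in Ioo 0 m, q (x + σ) * d (x + σ) (s - σ)| ≤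
          ∫ σ in Ioo 0 m, |q (x + σ)| * B := by
        rw [← Real.norm_eq_abs]
        refine norm_integral_le_of_norm_le (hq'.abs.mul_const B) ?_
        refine (ae_restrict_iff' measurableSet_Ioo).2 (ae_of_all _ fun σ hσ => ?_)
        rw [Real.norm_eq_abs, abs_mul]
        exact mul_le_mul_of_nonneg_left (hdB _ ⟨by linarith [hx.1, hσ.1], by linarith [hσ.2]⟩ _
          ⟨by linarith [hσ.2], by linarith [hσ.1, hs.2]⟩) (abs_nonneg _)
      refine h1.trans ?_
      rw [integral_mul_const]
      refine mul_le_mul_of_nonneg_right ?_ hB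
      have h2 : ∫ σ in Ioo 0 m, |q (x + σ)| = ∫ y in Ioo (x + 0) (x + m), |q y| := by
        have h3 := (measurePreserving_add_left (volume : Measure ℝ) x).setIntegral_preimage_emb
          (measurableEmbedding_addLeft x) (fun y => |q y|) (Ioo (x + 0) (x + m))
        simpa using h3
      rw [h2]
      exact setIntegral_mono_set hq.abs (ae_of_all _ fun _ => abs_nonneg _)
        (Ioo_subset_Ioo (by linarith [hx.1]) hml).eventuallyLE
    simp only [add_zero, sub_zero] at key
    have h3 : P x s = P (x + m) (s - m) - ∫ σ in (0 : ℝ)..m, q (x + σ) * d (x + σ) (s - σ) := by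
      rw [key]; ring
    rw [h3]
    exact (abs_sub _ _).trans (by linarith)
  have edge : ∀ k : ℕ, ∀ s ∈ Icc 0 t, s ≤ k * l → |P 0 s| ≤ k * (Q * B) := by
    intro k
    induction k with
    | zero =>
      intro s hs hsk
      have : s = 0 := le_antisymm (by simpa using hsk) hs.1
      rw [this, h0 0 ⟨le_rfl, hl.le⟩]
      simp
    | succ k ih =>
      intro s hs hsk
      push_cast at hsk ⊢
      rcases le_or_gt s l with h | h
      · have h1 := step 0 ⟨le_rfl, hl.le⟩ s hs s hs.1 le_rfl (by linarith)
        rw [sub_self, h0 _ ⟨by linarith [hs.1], by linarith⟩, abs_zero, zero_add] at h1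
        nlinarith [(Nat.cast_nonneg k : (0 : ℝ) ≤ k)]
      · have h1 := step 0 ⟨le_rfl, hl.le⟩ s hs l hl.le h.le (by linarith)
        rw [zero_add, ← hper (s - l) ⟨by linarith, by linarith [hs.2, ht.2]⟩] at h1
        have h2 := ih (s - l) ⟨by linarith, by linarith [hs.2]⟩ (by linarith)
        linarith
  have hn : (0 : ℝ) ≤ n * (Q * B) := by positivity
  rcases le_or_gt t (l - x) with h | h
  · have h1 := step x hx t ⟨ht.1, le_rfl⟩ t ht.1 le_rfl (by linarith)
    rw [sub_self, h0 _ ⟨by linarith [hx.1, ht.1], by linarith⟩, abs_zero, zero_add] at h1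
    linarith
  · have h1 := step x hx t ⟨ht.1, le_rfl⟩ (l - x) (by linarith [hx.2]) h.le (by linarith)
    rw [add_sub_cancel, ← hper (t - (l - x)) ⟨by linarith, by linarith [hx.2, ht.2]⟩] at h1
    have h2 := edge n (t - (l - x)) ⟨by linarith, by linarith [hx.2]⟩ (by linarith [hx.2])
    linarith

namespace IsSolution

variable {q f₁ f₂ : ℝ → ℝ} {T : ℝ} {u : ℝ → ℝ → ℝ}

/-- The gradient of a solution, as a linear form, up to the boundary of the strip. -/
noncomputable def grad (u : ℝ → ℝ → ℝ) (T : ℝ) (z : ℝ × ℝ) : ℝ × ℝ →L[ℝ] ℝ :=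
  fderivWithin ℝ (fun p : ℝ × ℝ => u p.1 p.2) (Icc 0 (2 * π) ×ˢ Ico 0 T) z

lemma uniqueDiffOn_strip (T : ℝ) :
    UniqueDiffOn ℝ (Icc 0 (2 * π) ×ˢ Ico 0 T : Set (ℝ × ℝ)) :=
  (uniqueDiffOn_Icc Real.two_pi_pos).prod (uniqueDiffOn_Ico 0 T)

lemma continuousOn_grad (hu : IsSolution q f₁ f₂ T u) :
    ContinuousOn (grad u T) (Icc 0 (2 * π) ×ˢ Ico 0 T) :=
  hu.c1.continuousOn_fderivWithin (uniqueDiffOn_strip T) (by simp)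

lemma hasFDerivWithinAt (hu : IsSolution q f₁ f₂ T u) {x t : ℝ} (hx : x ∈ Icc 0 (2 * π))
    (ht : t ∈ Ico 0 T) :
    HasFDerivWithinAt (fun p : ℝ × ℝ => u p.1 p.2) (grad u T (x, t))
      (Icc 0 (2 * π) ×ˢ Ico 0 T) (x, t) :=
  ((hu.c1.differentiableOn (by simp)) (x, t) ⟨hx, ht⟩).hasFDerivWithinAt

lemma hasDerivWithinAt_time (hu : IsSolution q f₁ f₂ T u) {x t : ℝ} (hx : x ∈ Icc 0 (2 * π))
    (ht : t ∈ Ico 0 T) : HasDerivWithinAt (fun s => u x s) (grad u T (x, t) (0, 1)) (Ico 0 T) t :=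
  (hu.hasFDerivWithinAt hx ht).comp_hasDerivWithinAt (f := fun s : ℝ => (x, s)) t
    ((hasDerivWithinAt_const t _ x).prodMk (hasDerivWithinAt_id t _)) fun _ hs => ⟨hx, hs⟩

lemma hasDerivWithinAt_space (hu : IsSolution q f₁ f₂ T u) {x t : ℝ} (hx : x ∈ Icc 0 (2 * π))
    (ht : t ∈ Ico 0 T) :
    HasDerivWithinAt (fun y => u y t) (grad u T (x, t) (1, 0)) (Icc 0 (2 * π)) x :=
  (hu.hasFDerivWithinAt hx ht).comp_hasDerivWithinAt (f := fun y : ℝ => (y, t)) x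
    ((hasDerivWithinAt_id x _).prodMk (hasDerivWithinAt_const x _ t)) fun _ hy => ⟨hy, ht⟩

lemma hasDerivWithinAt_right (hu : IsSolution q f₁ f₂ T u) {x t : ℝ} (hx : x ∈ Icc 0 (2 * π))
    (ht : t ∈ Ico 0 T) : HasDerivWithinAt (fun s => u x s) (grad u T (x, t) (0, 1)) (Ici t) t :=
  (hu.hasDerivWithinAt_time hx ht).mono_of_mem_nhdsWithin
    (mem_of_superset (Ico_mem_nhdsGE ht.2) (Ico_subset_Ico_left ht.1))

lemma grad_apply (z v : ℝ × ℝ) : grad u T z v = v.1 * grad u T z (1, 0) + v.2 * grad u T z (0, 1) := by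
  have : v = v.1 • ((1, 0) : ℝ × ℝ) + v.2 • ((0, 1) : ℝ × ℝ) := by ext <;> simp
  conv_lhs => rw [this, map_add, map_smul, map_smul]
  rfl

/-- The boundary conditions for the one-sided gradients at the two ends. -/
lemma grad_boundary (hu : IsSolution q f₁ f₂ T u) {t : ℝ} (ht : t ∈ Ioo 0 T) (v : ℝ × ℝ) :
    grad u T (0, t) v - grad u T (2 * π, t) v = v.1 * deriv f₂ t + v.2 * deriv f₁ t := by
  have m0 : (0 : ℝ) ∈ Icc 0 (2 * π) := ⟨le_rfl, Real.two_pi_pos.le⟩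
  have m2 : 2 * π ∈ Icc 0 (2 * π) := ⟨Real.two_pi_pos.le, le_rfl⟩
  have n0 : Ioo 0 (2 * π) ∈ 𝓝[>] (0 : ℝ) := Ioo_mem_nhdsGT Real.two_pi_pos
  have n2 : Ioo 0 (2 * π) ∈ 𝓝[<] (2 * π) := Ioo_mem_nhdsLT Real.two_pi_pos
  have t' : ∀ s ∈ Ioo 0 T, s ∈ Ico 0 T := fun s hs => ⟨hs.1.le, hs.2⟩
  have toEdge : ∀ {e : ℝ} {F : Filter ℝ}, e ∈ Icc 0 (2 * π) → F ≤ 𝓝 e → Ioo 0 (2 * π) ∈ F →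
      ∀ s ∈ Ioo 0 T, Tendsto (fun x => (x, s)) F (𝓝[Icc 0 (2 * π) ×ˢ Ico 0 T] (e, s)) := by
    intro e F _ hF hFm s hs
    refine tendsto_nhdsWithin_iff.2 ⟨((Continuous.prodMk_left s).tendsto e).mono_left hF, ?_⟩
    filter_upwards [hFm] with x hx
    exact ⟨⟨hx.1.le, hx.2.le⟩, t' s hs⟩
  have hval : ∀ s ∈ Ioo 0 T, u 0 s - u (2 * π) s = f₁ s := by
    intro s hs
    obtain ⟨w0, w2, d0, d2, h0, h2, -, -, h, -⟩ := hu.boundary s hs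
    have k0 : Tendsto (fun x => u x s) (𝓝[>] 0) (𝓝 (u 0 s)) :=
      (hu.c1.continuousOn (0, s) ⟨m0, t' s hs⟩).tendsto.comp (toEdge m0 nhdsWithin_le_nhds n0 s hs)
    have k2 : Tendsto (fun x => u x s) (𝓝[<] (2 * π)) (𝓝 (u (2 * π) s)) :=
      (hu.c1.continuousOn (2 * π, s) ⟨m2, t' s hs⟩).tendsto.comp
        (toEdge m2 nhdsWithin_le_nhds n2 s hs)
    rw [tendsto_nhds_unique k0 h0, tendsto_nhds_unique k2 h2, h]
  have hspace : grad u T (0, t) (1, 0) - grad u T (2 * π, t) (1, 0) = deriv f₂ t := by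
    obtain ⟨w0, w2, d0, d2, -, -, h0, h2, -, h⟩ := hu.boundary t ht
    have hd : ∀ x ∈ Ioo 0 (2 * π), deriv (fun y => u y t) x = grad u T (x, t) (1, 0) := fun x hx =>
      ((hu.hasDerivWithinAt_space ⟨hx.1.le, hx.2.le⟩ (t' t ht)).hasDerivAt
        (Icc_mem_nhds hx.1 hx.2)).deriv
    have hg : ContinuousOn (fun z => grad u T z (1, 0)) (Icc 0 (2 * π) ×ˢ Ico 0 T) :=
      hu.continuousOn_grad.clm_apply continuousOn_const
    have k0 : Tendsto (deriv fun x => u x t) (𝓝[>] 0) (𝓝 (grad u T (0, t) (1, 0))) := by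
      refine ((hg (0, t) ⟨m0, t' t ht⟩).tendsto.comp
        (toEdge m0 nhdsWithin_le_nhds n0 t ht)).congr' ?_
      filter_upwards [n0] with x hx
      exact (hd x hx).symm
    have k2 : Tendsto (deriv fun x => u x t) (𝓝[<] (2 * π)) (𝓝 (grad u T (2 * π, t) (1, 0))) := by
      refine ((hg (2 * π, t) ⟨m2, t' t ht⟩).tendsto.comp
        (toEdge m2 nhdsWithin_le_nhds n2 t ht)).congr' ?_
      filter_upwards [n2] with x hx
      exact (hd x hx).symm
    rw [tendsto_nhds_unique k0 h0, tendsto_nhds_unique k2 h2, h]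
  have htime : grad u T (0, t) (0, 1) - grad u T (2 * π, t) (0, 1) = deriv f₁ t := by
    have hT : Ico 0 T ∈ 𝓝 t := Ico_mem_nhds ht.1 ht.2
    have h := ((hu.hasDerivWithinAt_time m0 (t' t ht)).hasDerivAt hT).sub
      ((hu.hasDerivWithinAt_time m2 (t' t ht)).hasDerivAt hT)
    refine (h.congr_of_eventuallyEq ?_).deriv.symm
    filter_upwards [Ioo_mem_nhds ht.1 ht.2] with s hs
    exact (hval s hs).symm
  rw [grad_apply, grad_apply (z := (2 * π, t)), ← hspace, ← htime]
  ring

lemma grad_initial (hu : IsSolution q f₁ f₂ T u) (hT : 0 < T) {x : ℝ} (hx : x ∈ Icc 0 (2 * π))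
    (v : ℝ × ℝ) : grad u T (x, 0) v = 0 := by
  have h0 : (0 : ℝ) ∈ Ico 0 T := ⟨le_rfl, hT⟩
  have hin : ∀ x ∈ Ioo 0 (2 * π), grad u T (x, 0) v = 0 := by
    intro x hx
    have hx' : x ∈ Icc 0 (2 * π) := ⟨hx.1.le, hx.2.le⟩
    have h1 : grad u T (x, 0) (0, 1) = 0 :=
      (uniqueDiffWithinAt_Ici 0).eq_deriv _ (hu.hasDerivWithinAt_right hx' h0) (hu.initial x hx).2
    have h2 : grad u T (x, 0) (1, 0) = 0 := by
      have h3 := (hu.hasDerivWithinAt_space hx' h0).hasDerivAt (Icc_mem_nhds hx.1 hx.2)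
      refine h3.unique ((hasDerivAt_const x (0 : ℝ)).congr_of_eventuallyEq ?_)
      filter_upwards [Ioo_mem_nhds hx.1 hx.2] with y hy
      exact (hu.initial y hy).1
    rw [grad_apply, h1, h2]
    simp
  have hc : ContinuousOn (fun x => grad u T (x, 0) v) (Icc 0 (2 * π)) :=
    (hu.continuousOn_grad.comp (f := fun x : ℝ => (x, (0 : ℝ))) (by fun_prop)
      fun x hx => ⟨hx, h0⟩).clm_apply continuousOn_const
  exact EqOn.of_subset_closure (f := fun x => grad u T (x, 0) v) (g := fun _ => (0 : ℝ)) hin hc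
    continuousOn_const Ioo_subset_Icc_self (by rw [closure_Ioo Real.two_pi_pos.ne]) hx

/-- In terms of second derivatives, `(∂_t - σ ∂_x)(∂_t + σ ∂_x) = ∂_t² - ∂_x²` for `σ = ±1`. -/
lemma hasDerivAt_fderiv_characteristic {u : ℝ → ℝ → ℝ} {x t σ : ℝ} (hσ : σ ^ 2 = 1)
    (hc : ContDiffAt ℝ 2 (fun p : ℝ × ℝ => u p.1 p.2) (x, t)) :
    HasDerivAt (fun s => fderiv ℝ (fun p : ℝ × ℝ => u p.1 p.2) (x + σ * s, t - s) (σ, 1))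
      (q x * u x t - waveOp q u x t) 0 := by
  rw [waveOp_eq_fderiv q hc]
  have hsymm : IsSymmSndFDerivAt ℝ (fun p : ℝ × ℝ => u p.1 p.2) (x, t) :=
    hc.isSymmSndFDerivAt (by simp)
  have hs := hsymm (1, 0) (0, 1)
  have hd : HasFDerivAt (fderiv ℝ (fun p : ℝ × ℝ => u p.1 p.2))
      (fderiv ℝ (fderiv ℝ (fun p : ℝ × ℝ => u p.1 p.2)) (x, t)) (x, t) :=
    ((hc.fderiv_right (m := 1) (by norm_num)).differentiableAt (by simp)).hasFDerivAt
  generalize fderiv ℝ (fderiv ℝ (fun p : ℝ × ℝ => u p.1 p.2)) (x, t) = A at hs hd ⊢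
  generalize fderiv ℝ (fun p : ℝ × ℝ => u p.1 p.2) = G at hd ⊢
  have hpath : HasDerivAt (fun s : ℝ => (x + σ * s, t - s)) (σ, -1) 0 := by
    refine HasDerivAt.prodMk ?_ ?_
    · simpa using ((hasDerivAt_id (0 : ℝ)).const_mul σ).const_add x
    · simpa using (hasDerivAt_id (0 : ℝ)).const_sub t
  have e0 : (x, t) = (x + σ * 0, t - 0) := by simp
  rw [e0] at hd
  have h1 : HasDerivAt (fun s : ℝ => G (x + σ * s, t - s)) (A (σ, -1)) 0 :=
    hd.comp_hasDerivAt (f := fun s : ℝ => (x + σ * s, t - s)) (0 : ℝ) hpath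
  have h2 := h1.clm_apply (hasDerivAt_const (0 : ℝ) ((σ, 1) : ℝ × ℝ))
  refine h2.congr_deriv ?_
  have e1 : ((σ, -1) : ℝ × ℝ) = σ • ((1, 0) : ℝ × ℝ) - ((0, 1) : ℝ × ℝ) := by ext <;> simp
  have e2 : ((σ, 1) : ℝ × ℝ) = σ • ((1, 0) : ℝ × ℝ) + ((0, 1) : ℝ × ℝ) := by ext <;> simp
  rw [map_zero, add_zero, e1, e2]
  simp only [map_sub, map_smul, map_add, sub_apply, smul_apply, smul_eq_mul]
  rw [hs]
  linear_combination A (1, 0) (1, 0) * hσ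

/-- The wave equation says that `u_t + u_x` has the derivative `q u` backwards along
`x + t = const`, and `u_t - u_x` along `x - t = const`. -/
lemma hasDerivAt_grad_characteristic (hu : IsSolution q f₁ f₂ T u) {x t σ : ℝ} (hσ : σ ^ 2 = 1)
    (hx : x ∈ Ioo 0 (2 * π)) (ht : t ∈ Ioo 0 T) :
    HasDerivAt (fun s => grad u T (x + σ * s, t - s) (σ, 1)) (q x * u x t) 0 := by
  have hopen : IsOpen (Ioo 0 (2 * π) ×ˢ Ioo 0 T : Set (ℝ × ℝ)) := isOpen_Ioo.prod isOpen_Ioo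
  have h := hasDerivAt_fderiv_characteristic (q := q) hσ
    (hu.c2.contDiffAt (hopen.mem_nhds ⟨hx, ht⟩))
  rw [hu.pde x hx t ht, sub_zero] at h
  refine h.congr_of_eventuallyEq ?_
  have hpath : ContinuousAt (fun s : ℝ => (x + σ * s, t - s)) 0 := by fun_prop
  have hev := hpath.eventually (hopen.mem_nhds (by simpa using And.intro hx ht))
  filter_upwards [hev] with s hs
  rw [grad, fderivWithin_of_mem_nhds (mem_of_superset (hopen.mem_nhds hs)
    (prod_mono Ioo_subset_Icc_self Ioo_subset_Ico_self))]

/-- Uniqueness: the difference of two solutions satisfies `|d| ≤ M (K t)^k / k!` for all `k`, by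
integrating the transport estimate in time. -/
theorem unique (hq : IntegrableOn q (Ioo 0 (2 * π))) {u' : ℝ → ℝ → ℝ}
    (hu : IsSolution q f₁ f₂ T u) (hu' : IsSolution q f₁ f₂ T u') {x t : ℝ}
    (hx : x ∈ Ioo 0 (2 * π)) (ht : t ∈ Ioo 0 T) : u x t = u' x t := by
  have hT : 0 < T := ht.1.trans ht.2
  set S : Set (ℝ × ℝ) := Icc 0 (2 * π) ×ˢ Ico 0 T with hS
  set d : ℝ → ℝ → ℝ := fun x t => u x t - u' x t with hd
  set g : ℝ × ℝ → ℝ × ℝ →L[ℝ] ℝ := fun z => grad u T z - grad u' T z with hg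
  have hdc : ContinuousOn (fun z : ℝ × ℝ => d z.1 z.2) S :=
    hu.c1.continuousOn.sub hu'.c1.continuousOn
  have hgc : ContinuousOn g S := hu.continuousOn_grad.sub hu'.continuousOn_grad
  have hgper : ∀ s ∈ Ioo 0 T, ∀ v, g (0, s) v = g (2 * π, s) v := by
    intro s hs v
    simp only [hg, sub_apply]
    linarith [hu.grad_boundary hs v, hu'.grad_boundary hs v]
  have hg0 : ∀ x ∈ Icc 0 (2 * π), ∀ v, g (x, 0) v = 0 := fun x hx v => by
    simp only [hg, sub_apply, hu.grad_initial hT hx, hu'.grad_initial hT hx, sub_zero]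
  have hgchar : ∀ {σ : ℝ}, σ ^ 2 = 1 → ∀ x ∈ Ioo 0 (2 * π), ∀ s ∈ Ioo 0 T,
      HasDerivAt (fun r => g (x + σ * r, s - r) (σ, 1)) (q x * d x s) 0 := fun hσ x hx s hs =>
    ((hu.hasDerivAt_grad_characteristic hσ hx hs).sub
      (hu'.hasDerivAt_grad_characteristic hσ hx hs)).congr_deriv (by simp only [hd]; ring)
  obtain ⟨M, hM⟩ := ((isCompact_Icc (a := (0 : ℝ)) (b := 2 * π)).prod
    (isCompact_Icc (a := (0 : ℝ)) (b := t))).exists_bound_of_continuousOn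
    (hdc.mono (prod_mono_right fun s hs => ⟨hs.1, hs.2.trans_lt ht.2⟩))
  obtain ⟨n, hn⟩ := exists_nat_ge (t / (2 * π))
  have hn' : t ≤ n * (2 * π) := (div_le_iff₀ Real.two_pi_pos).1 hn
  set K := (n + 1) * ∫ y in Ioo 0 (2 * π), |q y| with hK
  have hK0 : 0 ≤ K := mul_nonneg (by positivity) (integral_nonneg fun _ => abs_nonneg _)
  have hM0 : 0 ≤ M := (norm_nonneg _).trans (hM (x, t) ⟨⟨hx.1.le, hx.2.le⟩, ht.1.le, le_rfl⟩)
  -- the bound for the gradient in terms of the bound for the difference at earlier times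
  have hgrad : ∀ B ≥ 0, ∀ s ∈ Icc 0 t, (∀ y ∈ Ioo 0 (2 * π), ∀ r ∈ Icc 0 s, |d y r| ≤ B) →
      ∀ y ∈ Ioo 0 (2 * π), |g (y, s) (0, 1)| ≤ K * B := by
    intro B hB s hs hb y hy
    have hsT : s ∈ Ico 0 T := ⟨hs.1, hs.2.trans_lt ht.2⟩
    have hsn : s ≤ n * (2 * π) := hs.2.trans hn'
    have b1 := abs_le_of_hasDerivAt_characteristic (P := fun x t => g (x, t) (1, 1))
      Real.two_pi_pos hq (hgc.clm_apply continuousOn_const) hdc (fun x hx => hg0 x hx _)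
      (fun r hr => hgper r hr _) (fun x hx r hr => by
        simpa using hgchar (σ := 1) (by norm_num) x hx r hr)
      (Ioo_subset_Icc_self hy) hsT hsn hB hb
    have href : ∀ z ∈ S, (2 * π - z.1, z.2) ∈ S := fun z hz =>
      ⟨⟨by linarith [hz.1.2], by linarith [hz.1.1]⟩, hz.2⟩
    have hq' : IntegrableOn (fun x => q (2 * π - x)) (Ioo 0 (2 * π)) := by
      have h2 := ((Measure.measurePreserving_sub_left (volume : Measure ℝ)
        (2 * π)).integrableOn_comp_preimage (Homeomorph.subLeft (2 * π)).measurableEmbedding).2 hq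
      simpa [Function.comp_def] using h2
    have hQ' : ∫ x in Ioo 0 (2 * π), |q (2 * π - x)| = ∫ x in Ioo 0 (2 * π), |q x| := by
      rw [← (Measure.measurePreserving_sub_left (volume : Measure ℝ)
        (2 * π)).setIntegral_preimage_emb (Homeomorph.subLeft (2 * π)).measurableEmbedding]
      simp
    have b2 := abs_le_of_hasDerivAt_characteristic (q := fun x => q (2 * π - x))
      (d := fun x t => d (2 * π - x) t) (P := fun x t => g (2 * π - x, t) (-1, 1))
      Real.two_pi_pos hq'
      ((hgc.comp (f := fun z : ℝ × ℝ => (2 * π - z.1, z.2)) (by fun_prop) href).clm_apply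
        continuousOn_const)
      (hdc.comp (f := fun z : ℝ × ℝ => (2 * π - z.1, z.2)) (by fun_prop) href)
      (fun x hx => hg0 _ ⟨by linarith [hx.2], by linarith [hx.1]⟩ _)
      (fun r hr => by simpa using (hgper r hr _).symm) (fun x hx r hr => by
        have := hgchar (σ := -1) (by norm_num) (2 * π - x)
          ⟨by linarith [hx.2], by linarith [hx.1]⟩ r hr
        simpa [sub_eq_add_neg, add_assoc, add_comm, add_left_comm] using this)
      (x := 2 * π - y) ⟨by linarith [hy.2], by linarith [hy.1]⟩ hsT hsn hB
      (fun y hy r hr => hb _ ⟨by linarith [hy.2], by linarith [hy.1]⟩ r hr)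
    rw [hQ'] at b2
    simp only [sub_sub_cancel] at b2
    have e : g (y, s) (0, 1) = 1 / 2 * (g (y, s) (1, 1) + g (y, s) (-1, 1)) := by
      rw [← map_add]
      have : ((1, 1) : ℝ × ℝ) + (-1, 1) = (2 : ℝ) • ((0, 1) : ℝ × ℝ) := by ext <;> norm_num
      rw [this, map_smul, smul_eq_mul]
      ring
    rw [e, abs_mul, abs_of_pos (by norm_num : (0 : ℝ) < 1 / 2), hK, mul_assoc]
    linarith [abs_add_le (g (y, s) (1, 1)) (g (y, s) (-1, 1))]
  have iter : ∀ k : ℕ, ∀ s ∈ Icc 0 t, ∀ y ∈ Ioo 0 (2 * π),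
      |d y s| ≤ M * ((K * s) ^ k / k.factorial) := by
    intro k
    induction k with
    | zero =>
      intro s hs y hy
      simpa using hM (y, s) ⟨⟨hy.1.le, hy.2.le⟩, hs⟩
    | succ k ih =>
      intro s hs y hy
      have hy' : y ∈ Icc 0 (2 * π) := ⟨hy.1.le, hy.2.le⟩
      have hder : ∀ r : ℝ, HasDerivAt (fun r => M * ((K * r) ^ (k + 1) / (k + 1).factorial))
          (K * (M * ((K * r) ^ k / k.factorial))) r := by
        intro r
        have h1 := ((((hasDerivAt_id r).const_mul K).fun_pow (k + 1)).div_const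
          ((k + 1).factorial : ℝ)).const_mul M
        refine h1.congr_deriv ?_
        rw [Nat.factorial_succ]
        push_cast
        have h2 : (k.factorial : ℝ) ≠ 0 := by positivity
        have h3 : (k : ℝ) + 1 ≠ 0 := by positivity
        simp only [id]
        field_simp
      refine image_norm_le_of_norm_deriv_right_le_deriv_boundary (f := fun r => d y r)
        (f' := fun r => g (y, r) (0, 1)) (a := 0) (b := t)
        (hdc.comp (f := fun r : ℝ => (y, r)) (by fun_prop)
          fun r hr => ⟨hy', hr.1, hr.2.trans_lt ht.2⟩) ?_ ?_ hder ?_ hs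
      · intro r hr
        have hrT : r ∈ Ico 0 T := ⟨hr.1, hr.2.trans ht.2⟩
        exact (hu.hasDerivWithinAt_right hy' hrT).sub (hu'.hasDerivWithinAt_right hy' hrT)
      · simp [hd, (hu.initial y hy).1, (hu'.initial y hy).1]
      · intro r hr
        refine hgrad _ ?_ r ⟨hr.1, hr.2.le⟩ ?_ y hy
        · have := hr.1
          positivity
        · intro y' hy' r' hr'
          refine (ih r' ⟨hr'.1, hr'.2.trans hr.2.le⟩ y' hy').trans ?_
          have := hr'.1
          have := hr'.2
          gcongr
  have hlim : Tendsto (fun k : ℕ => M * ((K * t) ^ k / k.factorial)) atTop (𝓝 0) := by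
    simpa using (FloorSemiring.tendsto_pow_div_factorial_atTop (K * t)).const_mul M
  have hzero : |d x t| ≤ 0 :=
    ge_of_tendsto' hlim fun k => iter k t ⟨ht.1.le, le_rfl⟩ x hx
  exact sub_eq_zero.1 (abs_nonpos_iff.1 hzero)

end IsSolution

/-! ### Truncation of the periodic potential -/

/-- `p` is an integrable and square integrable potential on the line that agrees with `q` on
`(-τ, τ)` and is `C¹` on the open set `O` with countable complement; within `(-τ, τ)`, the points of
`2π ℤ` are outside `O` only if `q` is not `C¹`. -/
structure IsTruncation (q : ℝ → ℝ) (τ : ℝ) (p : ℝ → ℝ) (O : Set ℝ) : Prop where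
  integrable : Integrable p
  memLp : MemLp p 2
  isOpen : IsOpen O
  countable : Oᶜ.Countable
  contDiffOn : ContDiffOn ℝ 1 p O
  eq : ∀ x, |x| < τ → p x = q x
  mem : ∀ x, |x| < τ → (ContDiff ℝ 1 q ∨ ∀ k : ℤ, x ≠ 2 * π * k) → x ∈ O

lemma contDiffAt_of_periodic {q : ℝ → ℝ} (hper : Function.Periodic q (2 * π))
    (hC2 : ContDiffOn ℝ 2 q (Ioo 0 (2 * π))) {x : ℝ} (hx : ∀ k : ℤ, x ≠ 2 * π * k) :
    ContDiffAt ℝ 1 q x := by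
  set k := toIcoDiv Real.two_pi_pos 0 x with hk
  have hmem : x - k * (2 * π) ∈ Ico 0 (2 * π) := by
    have := toIcoMod_mem_Ico' Real.two_pi_pos x
    rwa [← self_sub_toIcoDiv_zsmul, zsmul_eq_mul] at this
  have hmem' : x - k * (2 * π) ∈ Ioo 0 (2 * π) :=
    ⟨hmem.1.lt_of_ne fun h => hx k (by linarith), hmem.2⟩
  have e : q = fun y => q (y - k * (2 * π)) := funext fun y => (hper.sub_int_mul_eq k).symm
  rw [e]
  exact ContDiffAt.comp (g := q) x
    ((hC2.contDiffAt (isOpen_Ioo.mem_nhds hmem')).of_le (by norm_num)) (by fun_prop)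

theorem exists_isTruncation {q : ℝ → ℝ} (hper : Function.Periodic q (2 * π))
    (hC2 : ContDiffOn ℝ 2 q (Ioo 0 (2 * π))) (hL2 : MemLp q 2 (volume.restrict (Ioo 0 (2 * π))))
    (τ : ℝ) : ∃ p O, IsTruncation q τ p O := by
  have hq1 : IntegrableOn q (Ioo 0 (2 * π)) := hL2.integrable (by norm_num)
  have hq2 : IntegrableOn (fun x => q x ^ 2) (Ioo 0 (2 * π)) := hL2.integrable_sq
  have toIcc : ∀ {g : ℝ → ℝ}, Function.Periodic g (2 * π) → IntegrableOn g (Ioo 0 (2 * π)) →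
      IntegrableOn g (Icc (-τ) τ) := by
    intro g hg hgi
    have h := hg.intervalIntegrable₀ Real.two_pi_pos.ne'
      ((intervalIntegrable_iff_integrableOn_Ioo_of_le Real.two_pi_pos.le).2 hgi) (-τ) τ
    rcases le_total (-τ) τ with h1 | h1
    · exact (intervalIntegrable_iff_integrableOn_Icc_of_le h1).1 h
    · refine IntegrableOn.mono_set (t := Icc τ (-τ) ∪ {τ}) ?_ fun x hx => ?_
      · exact ((intervalIntegrable_iff_integrableOn_Icc_of_le h1).1 h.symm).union
          (integrableOn_singleton (hx := by simp))
      · exact Or.inr (le_antisymm hx.2 (h1.trans hx.1))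
  have hp1 : Integrable ((Icc (-τ) τ).indicator q) :=
    (integrable_indicator_iff measurableSet_Icc).2 (toIcc hper hq1)
  have hp2 : Integrable fun x => (Icc (-τ) τ).indicator q x ^ 2 := by
    have h := (integrable_indicator_iff measurableSet_Icc).2
      (toIcc (g := fun x => q x ^ 2) (fun x => by simp only [hper x]) hq2)
    refine h.congr (ae_of_all _ fun x => ?_)
    by_cases hx : x ∈ Icc (-τ) τ <;> simp [hx]
  have heq : ∀ x, |x| < τ → (Icc (-τ) τ).indicator q x = q x := fun x hx =>
    indicator_of_mem (show x ∈ Icc (-τ) τ from ⟨(abs_lt.1 hx).1.le, (abs_lt.1 hx).2.le⟩) q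
  refine ⟨(Icc (-τ) τ).indicator q,
    {x | |x| ≠ τ} ∩ {x | ContDiff ℝ 1 q ∨ ∀ k : ℤ, x ≠ 2 * π * k}, hp1,
    (memLp_two_iff_integrable_sq hp1.aestronglyMeasurable).2 hp2, ?_, ?_, ?_, heq,
    fun x hx h => ⟨hx.ne, h⟩⟩
  · refine (isOpen_ne_fun continuous_abs continuous_const).inter ?_
    by_cases hq : ContDiff ℝ 1 q
    · simp [hq]
    · have h1 := (Int.isClosedEmbedding_coe_real.isClosed_range.preimage
        (by fun_prop : Continuous fun x : ℝ => x / (2 * π))).isOpen_compl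
      convert h1 using 1
      ext x
      simp only [hq, false_or, mem_ofPred_eq, mem_compl_iff, mem_preimage, mem_range, not_exists]
      refine forall_congr' fun k => not_congr ?_
      rw [eq_div_iff Real.two_pi_pos.ne', mul_comm, eq_comm]
  · refine (((countable_singleton τ).union (countable_singleton (-τ))).union
      (countable_range fun k : ℤ => 2 * π * k)).mono fun x hx => ?_
    by_contra h
    simp only [mem_union, mem_singleton_iff, mem_range, not_or, not_exists] at h
    refine hx ⟨fun h1 => ?_, Or.inr fun k h1 => h.2 k h1.symm⟩
    rcases abs_choice x with h2 | h2
    · exact h.1.1 (h2 ▸ h1)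
    · exact h.1.2 (by
        have h3 : |x| = τ := h1
        linarith)
  · intro x hx
    refine ContDiffAt.contDiffWithinAt ?_
    rcases lt_or_gt_of_ne hx.1 with h | h
    · have hq : ContDiffAt ℝ 1 q x := hx.2.elim (fun h => h.contDiffAt)
        fun h => contDiffAt_of_periodic hper hC2 h
      refine hq.congr_of_eventuallyEq ?_
      filter_upwards [(isOpen_lt continuous_abs continuous_const).mem_nhds h] with y hy
      exact heq y hy
    · refine (contDiffAt_const (c := (0 : ℝ))).congr_of_eventuallyEq ?_
      filter_upwards [(isOpen_lt continuous_const continuous_abs).mem_nhds h] with y hy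
      exact indicator_of_notMem (show y ∉ Icc (-τ) τ from fun h1 => not_le.2 hy (abs_le.2 h1)) q

lemma IsTruncation.continuousAt {q : ℝ → ℝ} {τ : ℝ} {p : ℝ → ℝ} {O : Set ℝ}
    (h : IsTruncation q τ p O) {x : ℝ} (hx : x ∈ O) : ContinuousAt p x :=
  h.contDiffOn.continuousOn.continuousAt (h.isOpen.mem_nhds hx)

/-! ### The Goursat problem on the line -/

/-- The characteristics on which the kernel may fail to be `C¹` if the periodic potential is not
`C¹` across the points of `2π ℤ`. -/
def badLines (q : ℝ → ℝ) : Set (ℝ × ℝ) :=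
  {z | ¬ ContDiff ℝ 1 q ∧ ∃ k : ℤ, z.2 - z.1 = 4 * π * k ∨ z.2 + z.1 = 4 * π * k}

lemma IsTruncation.mem_regSet {q : ℝ → ℝ} {τ : ℝ} {p : ℝ → ℝ} {O : Set ℝ}
    (h : IsTruncation q τ p O) {z : ℝ × ℝ} (hz : |z.1| < z.2 ∧ z.2 < τ) (hN : z ∉ badLines q) :
    z ∈ IsKernel.regSet O := by
  have h1 := abs_lt.1 hz.1
  have hN' : ContDiff ℝ 1 q ∨ ∀ k : ℤ, z.2 - z.1 ≠ 4 * π * k ∧ z.2 + z.1 ≠ 4 * π * k := by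
    by_contra hcon
    push Not at hcon
    exact hN ⟨hcon.1, hcon.2.imp fun k hk => or_iff_not_imp_left.2 hk⟩
  refine ⟨hz.1, h.mem _ (abs_lt.2 ⟨by linarith, by linarith⟩) (hN'.imp id fun h k hk => ?_),
    h.mem _ (abs_lt.2 ⟨by linarith, by linarith⟩) (hN'.imp id fun h k hk => ?_)⟩
  · exact (h k).2 (by linarith)
  · exact (h (-k)).1 (by push_cast; linarith)

lemma waveOp_congr_potential {p q : ℝ → ℝ} {w : ℝ → ℝ → ℝ} {x t : ℝ}
    (h : w x t = 0 ∨ p x = q x) : waveOp p w x t = waveOp q w x t := by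
  rw [waveOp, waveOp]
  rcases h with h | h <;> rw [h]
  ring

namespace IsKernel

variable {p q : ℝ → ℝ} {a b τ : ℝ} {W : ℝ → ℝ → ℝ} {O : Set ℝ}

lemma contDiffOn_cone (hW : IsKernel p a b W) (ht : IsTruncation q τ p O) :
    ContDiffOn ℝ 1 (fun z : ℝ × ℝ => W z.1 z.2) ({z | |z.1| < z.2 ∧ z.2 < τ} \ badLines q) :=
  (hW.contDiffOn_one ht.integrable ht.isOpen ht.contDiffOn.continuousOn).mono
    fun _ hz => ht.mem_regSet hz.1 hz.2

/-- The kernel of a truncated potential solves the Goursat problem of the periodic one. -/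
theorem goursatLine (hW : IsKernel p a (-1 / 4) W) (ht : IsTruncation q τ p O) :
    GoursatLine q a τ W where
  cont := hW.cont.continuousOn
  corner := by rw [hW.eq_on_right]; simp [primitive]
  char_right x hx h := by
    have hlt : |x| < τ := by rw [abs_of_pos hx.1]; exact hx.2
    have := (hasDerivAt_primitive ht.integrable (ht.continuousAt (ht.mem x hlt h))).const_mul a
    rw [ht.eq x hlt] at this
    exact this.congr_of_eventuallyEq (Eventually.of_forall hW.eq_on_right)
  char_left x hx h := by
    have hlt : |x| < τ := by rw [abs_of_neg hx.2]; linarith [hx.1]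
    have := (hasDerivAt_primitive ht.integrable
      (ht.continuousAt (ht.mem x hlt h))).const_mul (-1 / 4 : ℝ)
    rw [ht.eq x hlt] at this
    exact this.congr_of_eventuallyEq (Eventually.of_forall hW.eq_on_left)
  eqn := by
    have hsub : ∀ z ∈ {z : ℝ × ℝ | |z.1| < z.2 ∧ z.2 < τ} \ {z | ¬ ContDiff ℝ 1 q ∧ ∃ k : ℤ,
        z.1 = 2 * π * k ∨ z.2 - z.1 = 4 * π * k ∨ z.2 + z.1 = 4 * π * k},
        z ∈ regSet O ∩ {z | z.1 ∈ O} := by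
      rintro z ⟨hz, hN⟩
      refine ⟨ht.mem_regSet hz fun hb => hN ⟨hb.1, hb.2.imp fun k hk => Or.inr hk⟩,
        ht.mem _ (hz.1.trans hz.2) ?_⟩
      by_contra hcon
      push Not at hcon
      exact hN ⟨hcon.1, hcon.2.imp fun k hk => Or.inl hk⟩
    refine ⟨fun φ hφ hcs hsupp => ?_, (hW.contDiffOn_two ht.integrable ht.memLp ht.isOpen
      ht.contDiffOn).mono hsub, fun z hz => ?_⟩
    · rw [← hW.weak ht.integrable ht.isOpen ht.countable ht.contDiffOn.continuousOn hφ hcs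
        (hsupp.trans fun z hz => hz.1)]
      congr 1
      funext z
      rw [waveOp_congr_potential]
      by_cases hz : z ∈ tsupport (fun z : ℝ × ℝ => φ z.1 z.2)
      · have := hsupp hz
        exact Or.inr (ht.eq _ (this.1.trans this.2)).symm
      · exact Or.inl (image_eq_zero_of_notMem_tsupport (f := fun z : ℝ × ℝ => φ z.1 z.2) hz)
    · rw [← waveOp_congr_potential (p := p) (Or.inr (ht.eq _ (hz.1.1.trans hz.1.2)))]
      exact hW.waveOp_eq_zero ht.integrable ht.memLp ht.isOpen ht.contDiffOn (hsub z hz)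

end IsKernel

/-! ### The kernels on the interval -/

lemma waveOp_translate {q : ℝ → ℝ} {c : ℝ} (hq : ∀ x, q (x + c) = q x) (w : ℝ → ℝ → ℝ) (d x t : ℝ) :
    waveOp q (fun x t => w (x + c) (t + d)) x t = waveOp q w (x + c) (t + d) := by
  simp only [waveOp]
  rw [iteratedDeriv_comp_add_const 2 (fun s => w (x + c) s) d,
    iteratedDeriv_comp_add_const 2 (fun y => w y (t + d)) c, hq]

lemma integral_waveOp_translate {q : ℝ → ℝ} {W φ : ℝ → ℝ → ℝ} {c : ℝ} (hq : ∀ x, q (x + c) = q x)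
    (d : ℝ) (h : ∫ z : ℝ × ℝ, W z.1 z.2 * waveOp q (fun x t => φ (x + -c) (t + -d)) z.1 z.2 = 0) :
    ∫ z : ℝ × ℝ, W (z.1 + c) (z.2 + d) * waveOp q φ z.1 z.2 = 0 := by
  have hq' : ∀ x, q (x + -c) = q x := fun x => by rw [← hq (x + -c)]; simp
  simp only [waveOp_translate hq'] at h
  rw [← integral_add_right_eq_self _ ((c, d) : ℝ × ℝ)] at h
  simpa only [Prod.fst_add, Prod.snd_add, add_neg_cancel_right] using h

/-- Translations by periods of the potential preserve the wave equation. -/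
lemma SolvesWaveEq.translate {q : ℝ → ℝ} {U U' N N' : Set (ℝ × ℝ)} {W : ℝ → ℝ → ℝ} {c : ℝ}
    (h : SolvesWaveEq q U N W) (hq : ∀ x, q (x + c) = q x) (d : ℝ)
    (hU : ∀ z ∈ U', (z.1 + c, z.2 + d) ∈ U) (hN : ∀ z ∈ U' \ N', (z.1 + c, z.2 + d) ∉ N) :
    SolvesWaveEq q U' N' (fun x t => W (x + c) (t + d)) := by
  refine ⟨fun φ hφ hcs hsupp => ?_, ?_, fun z hz => ?_⟩
  · have hφ' : ContDiff ℝ ∞ (fun z : ℝ × ℝ => φ (z.1 + -c) (z.2 + -d)) :=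
      hφ.comp (by fun_prop : ContDiff ℝ ∞ fun z : ℝ × ℝ => (z.1 + -c, z.2 + -d))
    have e : (fun z : ℝ × ℝ => φ (z.1 + -c) (z.2 + -d)) =
        (fun z : ℝ × ℝ => φ z.1 z.2) ∘ Homeomorph.addRight ((-c, -d) : ℝ × ℝ) := rfl
    have hcs' : HasCompactSupport (fun z : ℝ × ℝ => φ (z.1 + -c) (z.2 + -d)) := by
      rw [e]
      exact hcs.comp_homeomorph _
    have hsupp' : tsupport (fun z : ℝ × ℝ => φ (z.1 + -c) (z.2 + -d)) ⊆ U := by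
      rw [e, tsupport_comp_eq_preimage]
      intro z hz
      have h1 := hU _ (hsupp hz)
      simp only [Homeomorph.coe_addRight, Prod.fst_add, Prod.snd_add, neg_add_cancel_right] at h1
      exact h1
    exact integral_waveOp_translate hq d (h.weak (fun x t => φ (x + -c) (t + -d)) hφ' hcs' hsupp')
  · have hm : MapsTo (fun z : ℝ × ℝ => (z.1 + c, z.2 + d)) (U' \ N') (U \ N) :=
      fun z hz => ⟨hU z hz.1, hN z hz⟩
    have hs : ContDiff ℝ 2 (fun z : ℝ × ℝ => (z.1 + c, z.2 + d)) := by fun_prop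
    have hc := h.c2.comp hs.contDiffOn hm
    simpa only [Function.comp_def] using hc
  · have h1 := h.classical (z.1 + c, z.2 + d) ⟨hU z hz.1, hN z hz⟩
    rwa [waveOp_translate hq]

/-- The kernel on the `m`-th period to the right of the vertex, with time counted from the arrival
at that period. -/
noncomputable def rightPiece (W : ℝ → ℝ → ℝ) (m : ℕ) (x t : ℝ) : ℝ := W (x + 2 * π * m) (t + 2 * π * m)

/-- The kernel on the `m`-th period to the left of the vertex, with time counted from the arrival
at that period. -/
noncomputable def leftPiece (W : ℝ → ℝ → ℝ) (m : ℕ) (x t : ℝ) : ℝ :=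
  W (x + -(2 * π * (m + 1))) (t + 2 * π * m)

lemma four_pi_mul_int_ne {y : ℝ} (h0 : 0 < y) (h1 : y < 4 * π) (k : ℤ) : y ≠ 4 * π * k := by
  rintro rfl
  have hp : (0 : ℝ) < 4 * π := by positivity
  have h2 : (0 : ℝ) < k := pos_of_mul_pos_right h0 hp.le
  have h3 : (k : ℝ) < 1 := lt_of_mul_lt_mul_left (by linarith) hp.le
  have h4 : 0 < k := by exact_mod_cast h2
  have h5 : k < 1 := by exact_mod_cast h3
  omega

lemma eq_of_eq_four_pi_mul_int {y : ℝ} (h0 : 0 < y) (h1 : y < 8 * π) {k : ℤ} (h : y = 4 * π * k) :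
    y = 4 * π := by
  by_contra hne
  rcases lt_or_gt_of_ne hne with h2 | h2
  · exact four_pi_mul_int_ne h0 h2 k h
  · exact four_pi_mul_int_ne (y := y - 4 * π) (by linarith) (by linarith) (k - 1)
      (by push_cast; linarith)

lemma add_period_ne {x : ℝ} (hx : x ∈ Ioo 0 (2 * π)) (m k : ℤ) : x + 2 * π * m ≠ 2 * π * k := by
  intro h
  exact four_pi_mul_int_ne (y := 2 * x) (by linarith [hx.1]) (by linarith [hx.2]) (k - m)
    (by push_cast; linarith)

namespace IsKernel

variable {p q : ℝ → ℝ} {a τ τ₀ : ℝ} {W : ℝ → ℝ → ℝ} {O : Set ℝ} {N : Set (ℝ × ℝ)}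

lemma isGoursatKernel_translate (hW : IsKernel p a (-1 / 4) W) (ht : IsTruncation q τ₀ p O)
    {front : ℝ → ℝ} {c d b : ℝ} (hq : ∀ x, q (x + c) = q x)
    (hfront : ∀ x ∈ Icc 0 (2 * π), |x + c| = front x + d) (hτ : τ + d ≤ τ₀)
    (hN : ∀ x t, x ∈ Icc 0 (2 * π) → front x < t → t < τ → (x, t) ∉ N →
      (x + c, t + d) ∉ badLines q)
    (hx : ∀ x ∈ Ioo 0 (2 * π), ∀ k : ℤ, x + c ≠ 2 * π * k)
    (hchar : ∀ x ∈ Ioo 0 (2 * π), HasDerivAt (fun y => W (y + c) (front y + d)) (b * q x) x) :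
    IsGoursatKernel q front b τ N (fun x t => W (x + c) (t + d)) where
  cont := (hW.cont.comp
    (by fun_prop : Continuous fun z : ℝ × ℝ => (z.1 + c, z.2 + d))).continuousOn
  c1 := by
    have hm : MapsTo (fun z : ℝ × ℝ => (z.1 + c, z.2 + d))
        ({z | z.1 ∈ Icc 0 (2 * π) ∧ front z.1 < z.2 ∧ z.2 < τ} \ N)
        ({z | |z.1| < z.2 ∧ z.2 < τ₀} \ badLines q) := by
      rintro ⟨x, t⟩ ⟨⟨h1, h2, h3⟩, h4⟩
      simp only at h1 h2 h3
      refine ⟨⟨?_, ?_⟩, hN x t h1 h2 h3 h4⟩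
      · show |x + c| < t + d
        rw [hfront x h1]
        linarith
      · show t + d < τ₀
        linarith
    have hs : ContDiff ℝ 1 (fun z : ℝ × ℝ => (z.1 + c, z.2 + d)) := by fun_prop
    have hc := (hW.contDiffOn_cone ht).comp hs.contDiffOn hm
    simpa only [Function.comp_def] using hc
  eqn := by
    refine (hW.goursatLine ht).eqn.translate hq d ?_ ?_
    · rintro ⟨x, t⟩ ⟨h1, h2, h3⟩
      simp only at h1 h2 h3
      refine ⟨?_, ?_⟩
      · show |x + c| < t + d
        rw [hfront x ⟨h1.1.le, h1.2.le⟩]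
        linarith
      · show t + d < τ₀
        linarith
    · rintro ⟨x, t⟩ ⟨⟨h1, h2, h3⟩, h4⟩ ⟨h5, k, h6 | h6⟩
      · exact hx x h1 k h6
      · exact hN x t ⟨h1.1.le, h1.2.le⟩ h2 h3 h4 ⟨h5, k, h6⟩
  char := hchar

lemma isGoursatKernel_rightPiece (hW : IsKernel p a (-1 / 4) W) (ht : IsTruncation q τ₀ p O)
    (hper : Function.Periodic q (2 * π)) (m : ℕ) (hτ0 : 2 * π ≤ τ) (hτ : τ + 2 * π * m ≤ τ₀)
    (hN : ∀ x t, x ∈ Icc 0 (2 * π) → x < t → t < τ → (x, t) ∉ N → (x, t) ∉ badLines q) :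
    IsGoursatKernel q (fun x => x) a τ N (rightPiece W m) := by
  have hq : ∀ x, q (x + 2 * π * m) = q x := fun x => by
    rw [mul_comm]; exact hper.nat_mul m x
  have hm : (0 : ℝ) ≤ 2 * π * m := by positivity
  refine hW.isGoursatKernel_translate ht hq (fun x hx => ?_) hτ (fun x t hx h1 h2 h3 h4 => ?_)
    (fun x hx k => by exact_mod_cast add_period_ne hx m k) fun x hx => ?_
  · rw [abs_of_nonneg (by linarith [hx.1])]
  · refine hN x t hx h1 h2 h3 ⟨h4.1, ?_⟩
    obtain ⟨k, h5 | h5⟩ := h4.2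
    · exact ⟨k, Or.inl (by simp only at h5 ⊢; linarith)⟩
    · exact ⟨k - m, Or.inr (by simp only at h5 ⊢; push_cast; linarith)⟩
  · have h1 := (hW.goursatLine ht).char_right (x + 2 * π * m)
      ⟨by linarith [hx.1], by linarith [hx.2]⟩
      (Or.inr fun k => by exact_mod_cast add_period_ne hx m k)
    rw [hq] at h1
    exact HasDerivAt.comp_add_const x _ h1

lemma isGoursatKernel_leftPiece (hW : IsKernel p a (-1 / 4) W) (ht : IsTruncation q τ₀ p O)
    (hper : Function.Periodic q (2 * π)) (m : ℕ) (hτ0 : 2 * π ≤ τ) (hτ : τ + 2 * π * m ≤ τ₀)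
    (hN : ∀ x t, x ∈ Icc 0 (2 * π) → 2 * π - x < t → t < τ → (x, t) ∉ N →
      (x - 2 * π, t) ∉ badLines q) :
    IsGoursatKernel q (fun x => 2 * π - x) (-1 / 4) τ N (leftPiece W m) := by
  have hq : ∀ x, q (x + -(2 * π * (m + 1))) = q x := fun x => by
    have := hper.sub_nat_mul_eq (x := x) (m + 1)
    push_cast at this
    rw [← this, mul_comm (2 * π), sub_eq_add_neg]
  have hm : (0 : ℝ) ≤ 2 * π * m := by positivity
  have hne : ∀ x ∈ Ioo 0 (2 * π), ∀ k : ℤ, x + -(2 * π * (m + 1)) ≠ 2 * π * k := by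
    intro x hx k hk
    refine add_period_ne hx (-(m + 1 : ℤ)) k ?_
    push_cast
    linarith
  refine hW.isGoursatKernel_translate ht hq (fun x hx => ?_) hτ (fun x t hx h1 h2 h3 h4 => ?_)
    hne fun x hx => ?_
  · rw [abs_of_nonpos (by linarith [hx.2])]
    ring
  · refine hN x t hx h1 h2 h3 ⟨h4.1, ?_⟩
    obtain ⟨k, h5 | h5⟩ := h4.2
    · exact ⟨k - m, Or.inl (by simp only at h5 ⊢; push_cast; linarith)⟩
    · exact ⟨k, Or.inr (by simp only at h5 ⊢; linarith)⟩
  · have h1 := (hW.goursatLine ht).char_left (x + -(2 * π * (m + 1)))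
      ⟨by linarith [hx.1], by linarith [hx.2]⟩ (Or.inr (hne x hx))
    rw [hq] at h1
    refine (HasDerivAt.comp_add_const x _ h1).congr_of_eventuallyEq
      (Eventually.of_forall fun y => ?_)
    show W _ _ = W _ _
    congr 1
    ring

lemma differentiableAt_slice (hW : IsKernel p a (-1 / 4) W) (ht : IsTruncation q τ₀ p O)
    {x s : ℝ} (hx : |x| < s) (hs : s < τ₀) (hb : (x, s) ∉ badLines q) :
    DifferentiableAt ℝ (fun y => W y s) x := by
  have hmem := ht.mem_regSet (z := (x, s)) ⟨hx, hs⟩ hb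
  exact (HasFDerivAt.partial_fst (hW.hasFDerivAt ht.integrable (ne_of_gt hx)
    (ht.continuousAt (by simpa [add_comm] using hmem.2.1))
    (ht.continuousAt hmem.2.2))).differentiableAt

end IsKernel

/-- Two translates of the same differentiable function match at the ends of the period. -/
lemma glue_of_translate {w a b : ℝ → ℝ} {x₀ : ℝ} (h : DifferentiableAt ℝ w x₀)
    (ha : ∀ x, a x = w (x + x₀)) (hb : ∀ x, b x = w (x + (x₀ - 2 * π))) : Glue a b := by
  refine ⟨by rw [ha, hb]; congr 1; ring, deriv w x₀, ?_, ?_⟩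
  · rw [funext ha]
    exact (HasDerivAt.comp_add_const (0 : ℝ) x₀
      (by rw [zero_add]; exact h.hasDerivAt)).hasDerivWithinAt
  · rw [funext hb]
    exact (HasDerivAt.comp_add_const (2 * π) (x₀ - 2 * π)
      (by rw [add_sub_cancel]; exact h.hasDerivAt)).hasDerivWithinAt

namespace IsKernel

variable {p q : ℝ → ℝ} {a : ℝ} {W : ℝ → ℝ → ℝ} {O : Set ℝ}

theorem goursatPair (hW : IsKernel p a (-1 / 4) W) (ht : IsTruncation q (4 * π) p O)
    (hper : Function.Periodic q (2 * π)) :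
    GoursatPair q a (rightPiece W 0) (leftPiece W 0) where
  kernel0 := by
    refine hW.isGoursatKernel_rightPiece ht hper 0 le_rfl (by simp; linarith [Real.pi_pos])
      fun x t hx h1 h2 _ => ?_
    rintro ⟨-, k, h | h⟩
    · exact four_pi_mul_int_ne (by simp only; linarith [hx.1]) (by simp only; linarith [hx.1]) k h
    · exact four_pi_mul_int_ne (by simp only; linarith [hx.1]) (by simp only; linarith [hx.2]) k h
  kernel2 := by
    refine hW.isGoursatKernel_leftPiece ht hper 0 le_rfl (by simp; linarith [Real.pi_pos])
      fun x t hx h1 h2 _ => ?_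
    rintro ⟨-, k, h | h⟩
    · exact four_pi_mul_int_ne (by simp only; linarith [hx.2]) (by simp only; linarith [hx.1]) k h
    · exact four_pi_mul_int_ne (by simp only; linarith [hx.1]) (by simp only; linarith [hx.2]) k h
  corner := by simp [rightPiece, leftPiece, (hW.goursatLine ht).corner]
  glue s hs := by
    refine glue_of_translate (w := fun y => W y s) (x₀ := 0) (hW.differentiableAt_slice ht
      (by simpa using hs.1) (by linarith [hs.2, hs.1]) ?_) (fun x => by simp [rightPiece])
      fun x => by simp [leftPiece]
    rintro ⟨-, k, h | h⟩
    · exact four_pi_mul_int_ne (by simpa using hs.1) (by simp only; linarith [hs.1, hs.2]) k h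
    · exact four_pi_mul_int_ne (by simpa using hs.1) (by simp only; linarith [hs.1, hs.2]) k h

theorem goursatQuadruple (hW : IsKernel p a (-1 / 4) W) (ht : IsTruncation q (4 * π) p O)
    (hper : Function.Periodic q (2 * π)) :
    GoursatQuadruple q a (rightPiece W 0) (leftPiece W 0) (rightPiece W 1) (leftPiece W 1) where
  kernel0 := by
    refine hW.isGoursatKernel_rightPiece ht hper 0 (by linarith [Real.pi_pos]) (by simp)
      fun x t hx h1 h2 h3 => ?_
    rintro ⟨hq, k, h | h⟩
    · exact four_pi_mul_int_ne (by simp only; linarith [hx.1]) (by simp only; linarith [hx.1]) k h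
    · exact h3 ⟨hq, eq_of_eq_four_pi_mul_int (by simp only; linarith [hx.1])
        (by simp only; linarith [hx.2, Real.pi_pos]) h⟩
  kernel2 := by
    refine hW.isGoursatKernel_leftPiece ht hper 0 (by linarith [Real.pi_pos]) (by simp)
      fun x t hx h1 h2 h3 => ?_
    rintro ⟨hq, k, h | h⟩
    · have := eq_of_eq_four_pi_mul_int (by simp only; linarith [hx.2])
        (by simp only; linarith [hx.1, Real.pi_pos]) h
      exact h3 ⟨hq, by simp only at this ⊢; linarith⟩
    · exact four_pi_mul_int_ne (by simp only; linarith [hx.1]) (by simp only; linarith [hx.2]) k h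
  kernel0' := by
    refine hW.isGoursatKernel_rightPiece ht hper 1 le_rfl (by simp; linarith)
      fun x t hx h1 h2 _ => ?_
    rintro ⟨-, k, h | h⟩
    · exact four_pi_mul_int_ne (by simp only; linarith [hx.1]) (by simp only; linarith [hx.1]) k h
    · exact four_pi_mul_int_ne (by simp only; linarith [hx.1]) (by simp only; linarith [hx.2]) k h
  kernel2' := by
    refine hW.isGoursatKernel_leftPiece ht hper 1 le_rfl (by simp; linarith)
      fun x t hx h1 h2 _ => ?_
    rintro ⟨-, k, h | h⟩
    · exact four_pi_mul_int_ne (by simp only; linarith [hx.2]) (by simp only; linarith [hx.1]) k h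
    · exact four_pi_mul_int_ne (by simp only; linarith [hx.1]) (by simp only; linarith [hx.2]) k h
  corner := by
    refine ⟨by simp [rightPiece, (hW.goursatLine ht).corner],
      by simp [leftPiece, (hW.goursatLine ht).corner], by simp [rightPiece], ?_⟩
    simp only [leftPiece]
    norm_num
    congr 1
    ring
  glue s hs := by
    refine glue_of_translate (w := fun y => W y s) (x₀ := 0) (hW.differentiableAt_slice ht
      (by simpa using hs.1) hs.2 ?_) (fun x => by simp [rightPiece]) fun x => by simp [leftPiece]
    rintro ⟨-, k, h | h⟩
    · exact four_pi_mul_int_ne (by simpa using hs.1) (by simpa using hs.2) k h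
    · exact four_pi_mul_int_ne (by simpa using hs.1) (by simpa using hs.2) k h
  glue0 s hs := by
    refine glue_of_translate (w := fun y => W y s) (x₀ := 2 * π) (hW.differentiableAt_slice ht
      (by rw [abs_of_pos Real.two_pi_pos]; exact hs.1) hs.2 ?_) (fun x => by simp [rightPiece])
      fun x => by simp [rightPiece]
    rintro ⟨-, k, h | h⟩
    · exact four_pi_mul_int_ne (by simp only; linarith [hs.1])
        (by simp only; linarith [hs.2, Real.pi_pos]) k h
    · exact four_pi_mul_int_ne (y := s - 2 * π) (by linarith [hs.1])
        (by linarith [hs.2, Real.pi_pos]) (k - 1) (by push_cast; simp only at h; linarith)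
  glue2 s hs := by
    refine glue_of_translate (w := fun y => W y s) (x₀ := -(2 * π)) (hW.differentiableAt_slice ht
      (by rw [abs_neg, abs_of_pos Real.two_pi_pos]; exact hs.1) hs.2 ?_)
      (fun x => by simp [leftPiece]) fun x => ?_
    · rintro ⟨-, k, h | h⟩
      · exact four_pi_mul_int_ne (y := s - 2 * π) (by linarith [hs.1])
          (by linarith [hs.2, Real.pi_pos]) (k - 1) (by push_cast; simp only at h; linarith)
      · exact four_pi_mul_int_ne (by simp only; linarith [hs.1])
          (by simp only; linarith [hs.2, Real.pi_pos]) k h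
    · simp only [leftPiece]
      norm_num
      congr 1
      ring

end IsKernel

/-! ### Representation of the solution -/

lemma IsSolution.mono {q f₁ f₂ : ℝ → ℝ} {T T' : ℝ} {u : ℝ → ℝ → ℝ} (hu : IsSolution q f₁ f₂ T u)
    (h : T' ≤ T) : IsSolution q f₁ f₂ T' u where
  c2 := hu.c2.mono (prod_mono_right (Ioo_subset_Ioo_right h))
  c1 := hu.c1.mono (prod_mono_right (Ico_subset_Ico_right h))
  pde x hx t ht := hu.pde x hx t ⟨ht.1, ht.2.trans_le h⟩
  boundary t ht := hu.boundary t ⟨ht.1, ht.2.trans_le h⟩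
  initial := hu.initial

/-- The wave that the controls `f₁` (jump of the value) and `f₂'` (jump of the derivative) send
from the vertex to the right. -/
noncomputable def rightWave (W₁ W₂ : ℝ → ℝ → ℝ) (f₁ f₂ : ℝ → ℝ) (x t : ℝ) : ℝ :=
  outWave 1 (-2 * (-1 / 4)) W₁ f₁ x t + outWave 1 (-2 * (1 / 4)) W₂ f₂ x t

/-- The wave that the controls `f₁` (jump of the value) and `f₂'` (jump of the derivative) send
from the vertex to the left. -/
noncomputable def leftWave (W₁ W₂ : ℝ → ℝ → ℝ) (f₁ f₂ : ℝ → ℝ) (x t : ℝ) : ℝ :=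
  outWave (-1) (2 * (-1 / 4)) W₁ f₁ x t + outWave (-1) (2 * (-1 / 4)) W₂ f₂ x t

lemma integral_add_eq_conv {W₁ W₂ : ℝ → ℝ → ℝ} (h₁ : Continuous (fun z : ℝ × ℝ => W₁ z.1 z.2))
    (h₂ : Continuous (fun z : ℝ × ℝ => W₂ z.1 z.2)) {f₁ f₂ : ℝ → ℝ} (hf₁ : IsCausal f₁)
    (hf₂ : IsCausal f₂) (x t : ℝ) :
    ∫ s in |x|..t, (W₁ x s * f₁ (t - s) + W₂ x s * f₂ (t - s)) =
      conv W₁ f₁ x t + conv W₂ f₂ x t := by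
  rw [intervalIntegral.integral_add
    ((continuous_conv_integrand h₁ hf₁.continuous x t).intervalIntegrable _ _)
    ((continuous_conv_integrand h₂ hf₂.continuous x t).intervalIntegrable _ _),
    integral_eq_conv h₁ hf₁ le_rfl, integral_eq_conv h₂ hf₂ le_rfl]

/-- The two kernels, of the truncated potential, from which the representation is made up. -/
structure KernelPair (q : ℝ → ℝ) (τ : ℝ) (p : ℝ → ℝ) (O : Set ℝ) (W₁ W₂ : ℝ → ℝ → ℝ) : Prop where
  trunc : IsTruncation q τ p O
  kernel₁ : IsKernel p (-1 / 4) (-1 / 4) W₁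
  kernel₂ : IsKernel p (1 / 4) (-1 / 4) W₂

lemma exists_kernelPair {q : ℝ → ℝ} (hper : Function.Periodic q (2 * π))
    (hC2 : ContDiffOn ℝ 2 q (Ioo 0 (2 * π))) (hL2 : MemLp q 2 (volume.restrict (Ioo 0 (2 * π))))
    (τ : ℝ) : ∃ p O W₁ W₂, KernelPair q τ p O W₁ W₂ := by
  obtain ⟨p, O, ht⟩ := exists_isTruncation hper hC2 hL2 τ
  obtain ⟨W₁, h₁⟩ := exists_isKernel ht.integrable (-1 / 4) (-1 / 4)
  obtain ⟨W₂, h₂⟩ := exists_isKernel ht.integrable (1 / 4) (-1 / 4)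
  exact ⟨p, O, W₁, W₂, ht, h₁, h₂⟩

namespace KernelPair

variable {q : ℝ → ℝ} {τ : ℝ} {p : ℝ → ℝ} {O : Set ℝ} {W₁ W₂ : ℝ → ℝ → ℝ} {f₁ f₂ : ℝ → ℝ}

lemma rightWave_eq (h : KernelPair q τ p O W₁ W₂) (hf₁ : IsCausal f₁) (hf₂ : IsCausal f₂) {x : ℝ}
    (hx : 0 ≤ x) (t : ℝ) :
    1 / 2 * f₁ (t - x) - 1 / 2 * f₂ (t - x)
      + ∫ s in x..t, (W₁ x s * f₁ (t - s) + W₂ x s * f₂ (t - s)) = rightWave W₁ W₂ f₁ f₂ x t := by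
  have := integral_add_eq_conv h.kernel₁.cont h.kernel₂.cont hf₁ hf₂ x t
  rw [abs_of_nonneg hx] at this
  rw [this, rightWave, outWave, outWave]
  ring_nf

lemma leftWave_eq (h : KernelPair q τ p O W₁ W₂) (hf₁ : IsCausal f₁) (hf₂ : IsCausal f₂) {x : ℝ}
    (hx : x ≤ 0) (t : ℝ) :
    -(1 / 2) * f₁ (t + x) - 1 / 2 * f₂ (t + x)
      + ∫ s in (-x)..t, (W₁ x s * f₁ (t - s) + W₂ x s * f₂ (t - s)) = leftWave W₁ W₂ f₁ f₂ x t := by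
  have := integral_add_eq_conv h.kernel₁.cont h.kernel₂.cont hf₁ hf₂ x t
  rw [abs_of_nonpos hx] at this
  rw [this, leftWave, outWave, outWave]
  ring_nf

/-- The choice of the constants `∓1/4` makes the first control produce a jump of the value only,
and the second one a jump of the derivative only. -/
lemma wavePair (h : KernelPair q τ p O W₁ W₂) (hf₁ : IsCausal f₁) (hf₂ : IsCausal f₂) :
    WavePair p O f₁ (deriv f₂) (rightWave W₁ W₂ f₁ f₂) (leftWave W₁ W₂ f₁ f₂) := by
  have hpO := h.trunc.contDiffOn.continuousOn
  have key := (h.kernel₁.wavePair h.trunc.integrable hf₁ h.trunc.isOpen hpO).add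
    (h.kernel₂.wavePair h.trunc.integrable hf₂ h.trunc.isOpen hpO)
  convert key using 1
  · funext t
    ring
  · funext t
    ring
  · rfl
  · rfl

theorem isSolution {n : ℕ} (h : KernelPair q (2 * n * π) p O W₁ W₂)
    (hper : Function.Periodic q (2 * π)) (hf₁ : IsSmoothControl f₁) (hf₂ : IsSmoothControl f₂) {T : ℝ}
    (hT : T ≤ 2 * n * π) :
    IsSolution q f₁ f₂ T (waveSum (rightWave W₁ W₂ f₁ f₂) (leftWave W₁ W₂ f₁ f₂) n) :=
  (h.wavePair hf₁.isCausal hf₂.isCausal).isSolution_waveSum hper h.trunc.eq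
    (fun x hx hk => h.trunc.mem x hx (Or.inr hk)) hT

theorem eq_waveSum {n : ℕ} (h : KernelPair q (2 * n * π) p O W₁ W₂)
    (hper : Function.Periodic q (2 * π)) (hq : IntegrableOn q (Ioo 0 (2 * π)))
    (hf₁ : IsSmoothControl f₁) (hf₂ : IsSmoothControl f₂) {T : ℝ} {u : ℝ → ℝ → ℝ}
    (hu : IsSolution q f₁ f₂ T u) {x t : ℝ} (hx : x ∈ Ioo 0 (2 * π)) (ht : t ∈ Ioo 0 T)
    (htn : t < 2 * n * π) :
    u x t = waveSum (rightWave W₁ W₂ f₁ f₂) (leftWave W₁ W₂ f₁ f₂) n x t :=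
  IsSolution.unique hq (hu.mono (min_le_left T (2 * n * π)))
    (h.isSolution hper hf₁ hf₂ (min_le_right T (2 * n * π))) hx ⟨ht.1, lt_min ht.2 htn⟩

lemma waveSum_eq_sum_lineWave (h : KernelPair q τ p O W₁ W₂) (hf₁ : IsCausal f₁)
    (hf₂ : IsCausal f₂) (n : ℕ) {x : ℝ} (hx : x ∈ Ioo 0 (2 * π)) (t : ℝ) :
    waveSum (rightWave W₁ W₂ f₁ f₂) (leftWave W₁ W₂ f₁ f₂) n x t =
      ∑ k ∈ Finset.Icc 1 n, (lineWaveCW W₁ W₂ f₁ f₂ k x t + lineWaveCCW W₁ W₂ f₁ f₂ k x t) := by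
  refine Finset.sum_congr rfl fun k hk => ?_
  have hk1 : (1 : ℝ) ≤ k := by exact_mod_cast (Finset.mem_Icc.1 hk).1
  have h3 : 0 ≤ 2 * ((k : ℝ) - 1) * π :=
    mul_nonneg (mul_nonneg zero_le_two (by linarith)) Real.pi_pos.le
  have h4 : 2 * π ≤ 2 * (k : ℝ) * π := by linarith
  rw [← h.rightWave_eq hf₁ hf₂ (by linarith [hx.1]), ← h.leftWave_eq hf₁ hf₂ (by linarith [hx.2]),
    lineWaveCW, lineWaveCCW, sub_sub, neg_sub, add_sub_assoc]

lemma waveCW_rightPiece (h : KernelPair q τ p O W₁ W₂) (hf₁ : IsCausal f₁)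
    (hf₂ : IsCausal f₂) (m : ℕ) {x : ℝ} (hx : x ∈ Ioo 0 (2 * π)) (t : ℝ) :
    waveCW (rightPiece W₁ m) (rightPiece W₂ m) f₁ f₂ x (t - 2 * π * m) =
      rightWave W₁ W₂ f₁ f₂ (x + 2 * π * m) t := by
  have hm : (0 : ℝ) ≤ 2 * π * m := by positivity
  have hi := intervalIntegral.integral_comp_add_right (a := x) (b := t - 2 * π * m)
    (fun s => W₁ (x + 2 * π * m) s * f₁ (t - s) + W₂ (x + 2 * π * m) s * f₂ (t - s)) (2 * π * m)
  rw [sub_add_cancel] at hi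
  rw [← h.rightWave_eq hf₁ hf₂ (by linarith [hx.1]), ← hi, waveCW]
  simp only [rightPiece, sub_sub, add_comm (2 * π * (m : ℝ))]

lemma waveCCW_leftPiece (h : KernelPair q τ p O W₁ W₂) (hf₁ : IsCausal f₁)
    (hf₂ : IsCausal f₂) (m : ℕ) {x : ℝ} (hx : x ∈ Ioo 0 (2 * π)) (t : ℝ) :
    waveCCW (leftPiece W₁ m) (leftPiece W₂ m) f₁ f₂ x (t - 2 * π * m) =
      leftWave W₁ W₂ f₁ f₂ (x + -(2 * π * (m + 1))) t := by
  have hm : (0 : ℝ) ≤ 2 * π * m := by positivity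
  have hi := intervalIntegral.integral_comp_add_right (a := 2 * π - x) (b := t - 2 * π * m)
    (fun s => W₁ (x + -(2 * π * (m + 1))) s * f₁ (t - s)
      + W₂ (x + -(2 * π * (m + 1))) s * f₂ (t - s)) (2 * π * m)
  rw [sub_add_cancel] at hi
  have e1 : 2 * π - x + 2 * π * m = -(x + -(2 * π * (m + 1))) := by ring
  have e2 : t - 2 * π * m + x - 2 * π = t + (x + -(2 * π * (m + 1))) := by ring
  rw [e1] at hi
  rw [← h.leftWave_eq hf₁ hf₂ (by linarith [hx.2]), ← hi, waveCCW, e2]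
  simp only [leftPiece, sub_sub, add_comm (2 * π * (m : ℝ))]

lemma waveSum_two (R L : ℝ → ℝ → ℝ) (x t : ℝ) :
    waveSum R L 2 x t = R x t + L (x + -(2 * π)) t + (R (x + 2 * π) t + L (x + -(4 * π)) t) := by
  have e : Finset.Icc 1 2 = {1, 2} := rfl
  rw [waveSum, e, Finset.sum_pair (by norm_num)]
  norm_num
  ring_nf

end KernelPair

end PeriodicWave

theorem theorem1 (q : ℝ → ℝ) (hper : Function.Periodic q (2 * π))
    (hC2 : ContDiffOn ℝ 2 q (Ioo 0 (2 * π)))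
    (hL2 : MemLp q 2 (volume.restrict (Ioo 0 (2 * π)))) :
    -- the solution exists on every time interval
    (∀ f₁ f₂ : ℝ → ℝ, PeriodicWave.IsSmoothControl f₁ → PeriodicWave.IsSmoothControl f₂ →
      ∀ T : ℝ, 0 < T → ∃ u : ℝ → ℝ → ℝ, PeriodicWave.IsSolution q f₁ f₂ T u) ∧
    -- 1) the representation for `0 < t < 2π`
    (∃ w₁0 w₁2 w₂0 w₂2 : ℝ → ℝ → ℝ,
      PeriodicWave.GoursatPair q (-1 / 4) w₁0 w₁2 ∧
      PeriodicWave.GoursatPair q (1 / 4) w₂0 w₂2 ∧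
      PeriodicWave.Represents q (2 * π) (fun f₁ f₂ x t =>
        PeriodicWave.waveCW w₁0 w₂0 f₁ f₂ x t + PeriodicWave.waveCCW w₁2 w₂2 f₁ f₂ x t)) ∧
    -- 2) the representation for `0 < t < 4π`
    (∃ w₁0 w₁2 w₂0 w₂2 v₁0 v₁2 v₂0 v₂2 : ℝ → ℝ → ℝ,
      PeriodicWave.GoursatQuadruple q (-1 / 4) w₁0 w₁2 v₁0 v₁2 ∧
      PeriodicWave.GoursatQuadruple q (1 / 4) w₂0 w₂2 v₂0 v₂2 ∧
      PeriodicWave.Represents q (4 * π) (fun f₁ f₂ x t =>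
        PeriodicWave.waveCW w₁0 w₂0 f₁ f₂ x t + PeriodicWave.waveCCW w₁2 w₂2 f₁ f₂ x t
          + PeriodicWave.waveCW v₁0 v₂0 f₁ f₂ x (t - 2 * π)
          + PeriodicWave.waveCCW v₁2 v₂2 f₁ f₂ x (t - 2 * π))) ∧
    -- 3) the representation for `0 < t < 2nπ`
    (∀ n : ℕ, 1 < n → ∃ w₁ w₂ : ℝ → ℝ → ℝ,
      PeriodicWave.GoursatLine q (-1 / 4) (2 * n * π) w₁ ∧
      PeriodicWave.GoursatLine q (1 / 4) (2 * n * π) w₂ ∧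
      PeriodicWave.Represents q (2 * n * π) (fun f₁ f₂ x t =>
        ∑ k ∈ Finset.Icc 1 n,
          (PeriodicWave.lineWaveCW w₁ w₂ f₁ f₂ k x t
            + PeriodicWave.lineWaveCCW w₁ w₂ f₁ f₂ k x t))) := by
  have hq : IntegrableOn q (Set.Ioo 0 (2 * π)) := hL2.integrable (by norm_num)
  refine ⟨fun f₁ f₂ hf₁ hf₂ T hT => ?_, ?_, ?_, fun n hn => ?_⟩
  · obtain ⟨n, hn⟩ := exists_nat_ge (T / (2 * π))
    have hTn : T ≤ 2 * n * π := by
      have := (div_le_iff₀ Real.two_pi_pos).1 hn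
      linarith
    obtain ⟨p, O, W₁, W₂, h⟩ := PeriodicWave.exists_kernelPair hper hC2 hL2 (2 * n * π)
    exact ⟨_, h.isSolution hper hf₁ hf₂ hTn⟩
  · obtain ⟨p, O, W₁, W₂, h⟩ := PeriodicWave.exists_kernelPair hper hC2 hL2 (2 * (2 : ℕ) * π)
    have ht : PeriodicWave.IsTruncation q (4 * π) p O := by
      have := h.trunc
      norm_num at this
      exact this
    refine ⟨PeriodicWave.rightPiece W₁ 0, PeriodicWave.leftPiece W₁ 0,
      PeriodicWave.rightPiece W₂ 0, PeriodicWave.leftPiece W₂ 0,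
      h.kernel₁.goursatPair ht hper, h.kernel₂.goursatPair ht hper, ?_⟩
    intro f₁ f₂ hf₁ hf₂ T u hT hu x hx t ht' htτ
    have hw := h.wavePair hf₁.isCausal hf₂.isCausal
    rw [h.eq_waveSum hper hq hf₁ hf₂ hu hx ht' (by push_cast; linarith [Real.pi_pos]),
      PeriodicWave.KernelPair.waveSum_two]
    -- the waves of the second winding have not yet entered the interval
    rw [hw.zero_right (x + 2 * π) t (by linarith [hx.1, Real.pi_pos]) (by linarith [hx.1]),
      hw.zero_left (x + -(4 * π)) t (by linarith [hx.2, Real.pi_pos]) (by linarith [hx.2])]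
    have e1 := h.waveCW_rightPiece hf₁.isCausal hf₂.isCausal 0 hx t
    have e2 := h.waveCCW_leftPiece hf₁.isCausal hf₂.isCausal 0 hx t
    simp only [Nat.cast_zero, mul_zero, sub_zero, add_zero, zero_add, mul_one] at e1 e2
    rw [← e1, ← e2]
    ring
  · obtain ⟨p, O, W₁, W₂, h⟩ := PeriodicWave.exists_kernelPair hper hC2 hL2 (2 * (2 : ℕ) * π)
    have ht : PeriodicWave.IsTruncation q (4 * π) p O := by
      have := h.trunc
      norm_num at this
      exact this
    refine ⟨PeriodicWave.rightPiece W₁ 0, PeriodicWave.leftPiece W₁ 0,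
      PeriodicWave.rightPiece W₂ 0, PeriodicWave.leftPiece W₂ 0,
      PeriodicWave.rightPiece W₁ 1, PeriodicWave.leftPiece W₁ 1,
      PeriodicWave.rightPiece W₂ 1, PeriodicWave.leftPiece W₂ 1,
      h.kernel₁.goursatQuadruple ht hper, h.kernel₂.goursatQuadruple ht hper, ?_⟩
    intro f₁ f₂ hf₁ hf₂ T u hT hu x hx t ht' htτ
    rw [h.eq_waveSum hper hq hf₁ hf₂ hu hx ht' (by push_cast; linarith [Real.pi_pos]),
      PeriodicWave.KernelPair.waveSum_two]
    have e1 := h.waveCW_rightPiece hf₁.isCausal hf₂.isCausal 0 hx t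
    have e2 := h.waveCCW_leftPiece hf₁.isCausal hf₂.isCausal 0 hx t
    have e3 := h.waveCW_rightPiece hf₁.isCausal hf₂.isCausal 1 hx t
    have e4 := h.waveCCW_leftPiece hf₁.isCausal hf₂.isCausal 1 hx t
    have e5 : 2 * π * (1 + 1) = 4 * π := by ring
    simp only [Nat.cast_zero, Nat.cast_one, mul_zero, sub_zero, add_zero, zero_add, mul_one, e5]
      at e1 e2 e3 e4
    rw [← e1, ← e2, ← e3, ← e4]
    ring
  · obtain ⟨p, O, W₁, W₂, h⟩ := PeriodicWave.exists_kernelPair hper hC2 hL2 (2 * n * π)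
    refine ⟨W₁, W₂, h.kernel₁.goursatLine h.trunc, h.kernel₂.goursatLine h.trunc, ?_⟩
    intro f₁ f₂ hf₁ hf₂ T u hT hu x hx t ht' htτ
    rw [h.eq_waveSum hper hq hf₁ hf₂ hu hx ht' htτ,
      h.waveSum_eq_sum_lineWave hf₁.isCausal hf₂.isCausal n hx t]
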